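/- **Theorem.** Let $\Delta$ be a quantifier-free formula of linear real arithmetic over the real variables $X_1,\dots,X_n$, $n\ge 2$, in conjunctive normal form: a conjunction of non-empty clauses, each clause a disjunction of literals, each literal an atom $\sum_i a_iX_i\bowtie c$ with real $a_i,c$ and $\bowtie\,\in\{<,\le,=\}$, or the negation of such an atom. Let $m$ be the number of literals in $\Delta$ (counted with multiplicity). The *model integral* is $$\mathrm{MI}(\Delta)=\int_{\mathbb R^n}[x\models\Delta]\,dx .$$ The *primal graph* $G$ of $\Delta$ has the variables as vertices, and two variables are adjacent if they appear (with non-zero coefficients) in a common clause. Suppose that $G$ is a tree; write $\Delta_i$ for the conjunction of the clauses in which no variable other than $X_i$ appears, and $\Delta_{i,j}$ for that of the clauses in which both $X_i$ and $X_j$ appear. A *pseudo tree* of $G$ is a spanning tree of $G$ of least diameter, directed away from a root $r$. The height of a rooted tree is its number of levels (one more than the largest distance from the root). The algorithm *MP-MI* computes, as explicit univariate piecewise polynomials, the messages $$m_{i\to j}(x_j)=\int_{\mathbb R}[x_i,x_j\models\Delta_{i,j}]\,[x_i\models\Delta_i]\prod_{c\in\mathrm{neigh}(i)\setminus\{j\}}m_{c\to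 i}(x_i)\,dx_i$$ along all edges of $G$, by symbolic integration, first from children to parents (upward pass) and then from parents to children (downward pass) with respect to the root $r$; then the beliefs $b_i=\prod_{c\in\mathrm{neigh}(i)}m_{c\to i}$ of all nodes; and finally $\int_{\mathbb R}[x_r\models\Delta_r]\,b_r(x_r)\,dx_r$. On pieces where the integral defining a message diverges, its entry may be an arbitrary polynomial. Running time is the number of steps of a unit-cost random access machine with exact arithmetic. There are an implementation of MP-MI (an explicit step-counted program) and an absolute constant $C$ such that, for all such $n$ and $\Delta$, if $h_p$ is the height of the primal tree $G$ rooted at any vertex, and a pseudo tree of $G$ with root $r$ has $l$ leaves and height $h_t$, then MP-MI on $\Delta$ with root $r$, including both passes and all beliefs, takes at most $$C\cdot l\cdot\left(n^3\cdot m^{h_p}\right)^{h_t}$$ steps; and, if $\mathrm{MI}(\Delta)<\infty$, it returns exactly $\mathrm{MI}(\Delta)$. -/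

import Mathlib

open MeasureTheory
open scoped ENNReal

namespace MPMI

/-! ### Formulas -/

/-- The relation symbol of a linear atom. -/
inductive Rel
  | lt
  | le
  | eq

/-- A literal of linear real arithmetic over the variables `X_0, …, X_{n-1}`: the atom
`∑ i, coeff i * X_i ⋈ const` (with `⋈` one of `<`, `≤`, `=`) if `pos = true`,
and the negation of this atom if `pos = false`. -/
structure Literal (n : ℕ) (K : Type) where
  coeff : Fin n → K
  const : K
  rel : Rel
  pos : Bool

/-- A clause is a disjunction of literals. -/
abbrev Clause (n : ℕ) (K : Type) := List (Literal n K)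

/-- A formula in conjunctive normal form is a conjunction of clauses. -/
abbrev CNF (n : ℕ) (K : Type) := List (Clause n K)

/-- The relation `a ⋈ b`. -/
def Rel.Holds {K : Type} [LinearOrder K] : Rel → K → K → Prop
  | .lt, a, b => a < b
  | .le, a, b => a ≤ b
  | .eq, a, b => a = b

/-- The point `x` satisfies the literal `ℓ`. -/
def Literal.Holds {n : ℕ} (ℓ : Literal n ℝ) (x : Fin n → ℝ) : Prop :=
  ℓ.rel.Holds (∑ i, ℓ.coeff i * x i) ℓ.const ↔ ℓ.pos = true

/-- The point `x` satisfies the formula `Δ`. -/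
def Sat {n : ℕ} (Δ : CNF n ℝ) (x : Fin n → ℝ) : Prop :=
  ∀ Γ ∈ Δ, ∃ ℓ ∈ Γ, ℓ.Holds x

/-- The number of literals (literal occurrences) of a formula. -/
def numLiterals {n : ℕ} {K : Type} (Δ : CNF n K) : ℕ := (Δ.map List.length).sum

/-- The model integral `∫ [x ⊨ Δ] dx` over `ℝⁿ`. -/
noncomputable def MI {n : ℕ} (Δ : CNF n ℝ) : ℝ≥0∞ :=
  ∫⁻ x : Fin n → ℝ, {x | Sat Δ x}.indicator 1 x

/-- The variable `X_i` appears in the clause `Γ`. -/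
def Appears {n : ℕ} (i : Fin n) (Γ : Clause n ℝ) : Prop := ∃ ℓ ∈ Γ, ℓ.coeff i ≠ 0

/-- The primal graph: two variables are adjacent if they appear together in some clause. -/
def primalGraph {n : ℕ} (Δ : CNF n ℝ) : SimpleGraph (Fin n) where
  Adj i j := i ≠ j ∧ ∃ Γ ∈ Δ, Appears i Γ ∧ Appears j Γ
  symm := ⟨fun _ _ h => ⟨h.1.symm, h.2.imp fun _ hΓ => ⟨hΓ.1, hΓ.2.2, hΓ.2.1⟩⟩⟩
  loopless := ⟨fun _ h => h.1 rfl⟩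

/-! ### Rooted trees -/

/-- `T` is a spanning tree of `G` of least diameter; together with a root, from which all its
edges are directed away, it is a pseudo tree of `G`. -/
def IsPseudoTree {V : Type} (G T : SimpleGraph V) : Prop :=
  T ≤ G ∧ T.IsTree ∧ ∀ T' : SimpleGraph V, T' ≤ G → T'.IsTree → T.diam ≤ T'.diam

/-- The height (number of levels) of the tree `T` rooted at `r`. -/
noncomputable def height {n : ℕ} (T : SimpleGraph (Fin n)) (r : Fin n) : ℕ :=
  (Finset.univ.sup fun v => T.dist r v) + 1

/-- The number of leaves (vertices without children) of the tree `T` rooted at `r`. -/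
noncomputable def numLeaves {n : ℕ} (T : SimpleGraph (Fin n)) (r : Fin n) : ℕ :=
  {v : Fin n | ¬ ∃ w, T.Adj v w ∧ T.dist r w = T.dist r v + 1}.ncard

/-! ### Step counting

The cost model is the unit-cost random access machine with exact arithmetic: `tick` counts one
step, which stands for a bounded number of elementary operations (an arithmetic operation or a
comparison of two numbers or indices, reading or writing one memory cell, one list constructor or
destructor). Every call of every function below that inspects a list spends at least one step per
list cell. -/

/-- The result of a computation, together with the number of steps it took. -/
structure Timed (α : Type) where
  val : α
  steps : ℕ

instance : Monad Timed where
  pure a := ⟨a, 0⟩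
  bind x f := ⟨(f x.val).val, x.steps + (f x.val).steps⟩

/-- Spend one step. -/
def tick : Timed Unit := ⟨(), 1⟩

section Lists

variable {α β : Type}

def foldT (f : β → α → Timed β) : β → List α → Timed β
  | b, [] => do
    tick
    return b
  | b, a :: s => do
    tick
    let b' ← f b a
    foldT f b' s

/-- As `foldT`, but the last element of the list is processed first. -/
def foldrT (f : β → α → Timed β) (b : β) : List α → Timed β
  | [] => do
    tick
    return b
  | a :: s => do
    tick
    let b' ← foldrT f b s
    f b' a

def mapT (f : α → Timed β) : List α → Timed (List β)
  | [] => do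
    tick
    return []
  | a :: s => do
    tick
    let b ← f a
    let t ← mapT f s
    return b :: t

def filterT (p : α → Timed Bool) : List α → Timed (List α)
  | [] => do
    tick
    return []
  | a :: s => do
    tick
    let b ← p a
    let t ← filterT p s
    return if b then a :: t else t

def anyT (p : α → Timed Bool) : List α → Timed Bool
  | [] => do
    tick
    return false
  | a :: s => do
    tick
    let b ← p a
    if b then return true else anyT p s

def allT (p : α → Timed Bool) : List α → Timed Bool
  | [] => do
    tick
    return true
  | a :: s => do
    tick
    let b ← p a
    if b then allT p s else return false

def appendT : List α → List α → Timed (List α)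
  | [], t => do
    tick
    return t
  | a :: s, t => do
    tick
    let r ← appendT s t
    return a :: r

def flattenT : List (List α) → Timed (List α)
  | [] => do
    tick
    return []
  | a :: s => do
    tick
    let r ← flattenT s
    appendT a r

end Lists

section Algorithm

variable {K : Type} [Field K] [LinearOrder K]

/-! ### Polynomials -/

/-- A univariate polynomial: the list of its coefficients, the constant one first. -/
abbrev Poly (K : Type) := List K

namespace Poly

def add : Poly K → Poly K → Timed (Poly K)
  | [], q => do
    tick
    return q
  | a :: p, [] => do
    tick
    return a :: p
  | a :: p, b :: q => do
    tick
    let r ← add p q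
    return (a + b) :: r

def scale (c : K) : Poly K → Timed (Poly K) :=
  mapT fun a => do
    tick
    return c * a

/-- Multiplication by the variable. -/
def shift : Poly K → Timed (Poly K)
  | [] => do
    tick
    return []
  | a :: p => do
    tick
    return 0 :: a :: p

def mul : Poly K → Poly K → Timed (Poly K)
  | [], _ => do
    tick
    return []
  | a :: p, q => do
    tick
    let u ← scale a q
    let r ← mul p q
    let v ← shift r
    add u v

/-- The value of the polynomial at `x`. -/
def eval (x : K) : Poly K → Timed K
  | [] => do
    tick
    return 0
  | a :: p => do
    tick
    let v ← eval x p
    return a + x * v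

/-- The polynomial `p (slope * X + icpt)`. -/
def comp (slope icpt : K) : Poly K → Timed (Poly K)
  | [] => do
    tick
    return []
  | a :: p => do
    tick
    let q ← comp slope icpt p
    let r ← mul [icpt, slope] q
    add [a] r

/-- Divides the coefficients by `d, d + 1, d + 2, …`. -/
def divCoeffs (d : K) : Poly K → Timed (Poly K)
  | [] => do
    tick
    return []
  | a :: p => do
    tick
    let q ← divCoeffs (d + 1) p
    return a / d :: q

/-- The antiderivative that vanishes at `0`. -/
def antideriv (p : Poly K) : Timed (Poly K) := do
  tick
  let q ← divCoeffs 1 p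
  return 0 :: q

end Poly

/-! ### Piecewise polynomials -/

/-- A piecewise polynomial function on the line. The list `[(β₁, p₁), …, (βₖ, pₖ)]` with
`β₁ < … < βₖ` and the polynomial `p₀ = first` stand for the function that is `p₀` on `(-∞, β₁)`,
`pᵢ` on `(βᵢ, βᵢ₊₁)`, and `pₖ` on `(βₖ, ∞)`. -/
structure PW (K : Type) where
  first : Poly K
  rest : List (K × Poly K)

namespace PW

/-- The pieces of `op f g` to the right of the point where the sweep stands, if the current pieces
of `f` and `g` are `p` and `q`, and their remaining pieces are the two lists. -/
def merge (op : Poly K → Poly K → Timed (Poly K)) (p q : Poly K) :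
    List (K × Poly K) → List (K × Poly K) → Timed (List (K × Poly K))
  | [], [] => do
    tick
    return []
  | (x, p') :: s, [] => do
    tick
    let r ← op p' q
    let t ← merge op p' q s []
    return (x, r) :: t
  | [], (y, q') :: s => do
    tick
    let r ← op p q'
    let t ← merge op p q' [] s
    return (y, r) :: t
  | (x, p') :: s, (y, q') :: s' => do
    tick
    if x < y then
      let r ← op p' q
      let t ← merge op p' q s ((y, q') :: s')
      return (x, r) :: t
    else if y < x then
      let r ← op p q'
      let t ← merge op p q' ((x, p') :: s) s'
      return (y, r) :: t
    else
      let r ← op p' q'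
      let t ← merge op p' q' s s'
      return (x, r) :: t
termination_by s t => s.length + t.length

/-- The piecewise polynomial `op f g`, on the common refinement of the pieces. -/
def zip (op : Poly K → Poly K → Timed (Poly K)) (f g : PW K) : Timed (PW K) := do
  tick
  let p ← op f.first g.first
  let s ← merge op f.first g.first f.rest g.rest
  return ⟨p, s⟩

def add (f g : PW K) : Timed (PW K) := zip Poly.add f g

def mul (f g : PW K) : Timed (PW K) := zip Poly.mul f g

/-- Antiderivatives of the remaining pieces, continuing the antiderivative `P` of the current
piece continuously. -/
def antiderivFrom (P : Poly K) : List (K × Poly K) → Timed (List (K × Poly K))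
  | [] => do
    tick
    return []
  | (x, q) :: s => do
    tick
    let Q ← Poly.antideriv q
    let v ← Poly.eval x P
    let w ← Poly.eval x Q
    let Q' ← Poly.add [v - w] Q
    let t ← antiderivFrom Q' s
    return (x, Q') :: t

/-- A continuous antiderivative. -/
def antideriv (f : PW K) : Timed (PW K) := do
  tick
  let P ← Poly.antideriv f.first
  let s ← antiderivFrom P f.rest
  return ⟨P, s⟩

def lastFrom (p : Poly K) : List (K × Poly K) → Timed (Poly K)
  | [] => do
    tick
    return p
  | (_, q) :: s => do
    tick
    lastFrom q s

/-- The limit at `-∞` of a piecewise polynomial that is constant near `-∞`. -/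
def atBot (f : PW K) : Timed K := do
  tick
  return f.first.headD 0

/-- The limit at `∞` of a piecewise polynomial that is constant near `∞`. -/
def atTop (f : PW K) : Timed K := do
  let p ← lastFrom f.first f.rest
  tick
  return p.headD 0

def evalFrom (x : K) (p : Poly K) : List (K × Poly K) → Timed K
  | [] => do
    tick
    Poly.eval x p
  | (y, q) :: s => do
    tick
    if x < y then Poly.eval x p else evalFrom x q s

/-- The value at `x`. -/
def eval (x : K) (f : PW K) : Timed K := evalFrom x f.first f.rest

/-- Reflects the pieces when a line of negative slope is substituted. -/
def reflect (slope icpt : K) (p : Poly K) (acc : List (K × Poly K)) :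
    List (K × Poly K) → Timed (PW K)
  | [] => do
    tick
    let p' ← Poly.comp slope icpt p
    return ⟨p', acc⟩
  | (x, q) :: s => do
    tick
    let p' ← Poly.comp slope icpt p
    reflect slope icpt q (((x - icpt) / slope, p') :: acc) s

/-- The piecewise polynomial `f (slope * X + icpt)`, for a continuous `f`. -/
def comp (slope icpt : K) (f : PW K) : Timed (PW K) := do
  tick
  if 0 < slope then
    let p ← Poly.comp slope icpt f.first
    let s ← mapT (fun a => do
      tick
      let q ← Poly.comp slope icpt a.2
      return ((a.1 - icpt) / slope, q)) f.rest
    return ⟨p, s⟩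
  else if slope < 0 then
    reflect slope icpt f.first [] f.rest
  else
    let v ← eval icpt f
    return ⟨[v], []⟩

def samplesFrom (f : K → Timed (Poly K)) (x : K) : List K → Timed (List (K × Poly K))
  | [] => do
    tick
    let p ← f (x + 1)
    return [(x, p)]
  | y :: s => do
    tick
    let p ← f ((x + y) / 2)
    let t ← samplesFrom f y s
    return (x, p) :: t

/-- The intervals cut out by a sorted list of points, each with the polynomial that `f` assigns to
one point of the interval. -/
def fromSamples (f : K → Timed (Poly K)) : List K → Timed (PW K)
  | [] => do
    tick
    let p ← f 0
    return ⟨p, []⟩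
  | x :: s => do
    tick
    let p ← f (x - 1)
    let t ← samplesFrom f x s
    return ⟨p, t⟩

end PW

/-! ### Inspecting the formula -/

section Formula

variable {n : ℕ}

/-- Inserts a point into a sorted list of points without repetitions. -/
def insertPoint (x : K) : List K → Timed (List K)
  | [] => do
    tick
    return [x]
  | y :: s => do
    tick
    if x < y then
      return x :: y :: s
    else if y < x then
      let t ← insertPoint x s
      return y :: t
    else
      return y :: s

/-- Whether the variable `X_i` appears in the clause. -/
def appearsT (i : Fin n) (Γ : Clause n K) : Timed Bool :=
  anyT (fun ℓ => do
    tick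
    return decide (ℓ.coeff i ≠ 0)) Γ

/-- The neighbours of `X_i` in the primal graph. -/
def neighbours (Δ : CNF n K) (i : Fin n) : Timed (List (Fin n)) :=
  filterT (fun j => do
    tick
    if j = i then
      return false
    else
      anyT (fun Γ => do
        let a ← appearsT i Γ
        let b ← appearsT j Γ
        return a && b) Δ) (List.finRange n)

/-- The formula `Δ_i`: the clauses in which no variable other than `X_i` appears. -/
def nodeFormula (Δ : CNF n K) (i : Fin n) : Timed (CNF n K) :=
  filterT (fun Γ => allT (fun k => do
    tick
    if k = i then
      return true
    else
      let a ← appearsT k Γ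
      return !a) (List.finRange n)) Δ

/-- The formula `Δ_{i,j}`: the clauses in which both `X_i` and `X_j` appear. -/
def edgeFormula (Δ : CNF n K) (i j : Fin n) : Timed (CNF n K) :=
  filterT (fun Γ => do
    let a ← appearsT i Γ
    let b ← appearsT j Γ
    return a && b) Δ

def Rel.test : Rel → K → K → Bool
  | .lt, a, b => decide (a < b)
  | .le, a, b => decide (a ≤ b)
  | .eq, a, b => decide (a = b)

/-- Whether `X_i = u` satisfies a formula over the variable `X_i`. -/
def nodeTest (Δ : CNF n K) (i : Fin n) (u : K) : Timed Bool :=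
  allT (fun Γ => anyT (fun ℓ => do
    tick
    return ℓ.rel.test (ℓ.coeff i * u) ℓ.const == ℓ.pos) Γ) Δ

/-- Whether `X_i = u, X_j = v` satisfies a formula over the variables `X_i, X_j`. -/
def edgeTest (Δ : CNF n K) (i j : Fin n) (u v : K) : Timed Bool :=
  allT (fun Γ => anyT (fun ℓ => do
    tick
    return ℓ.rel.test (ℓ.coeff i * u + ℓ.coeff j * v) ℓ.const == ℓ.pos) Γ) Δ

/-- Adds to the sorted list `P` the point `const / coeff i` for every literal selected by `use` in
which `X_i` appears. If no other variable appears in such a literal, this is the point at which its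
truth value changes. -/
def literalPoints (use : Literal n K → Bool) (i : Fin n) (P : List K) (Δ : CNF n K) :
    Timed (List K) :=
  foldT (fun P Γ => foldT (fun P ℓ => do
    tick
    if ℓ.coeff i ≠ 0 && use ℓ then
      insertPoint (ℓ.const / ℓ.coeff i) P
    else
      return P) P Γ) P Δ

/-- The indicator function of `Δ_i`. -/
def nodeIndicator (Δ : CNF n K) (i : Fin n) : Timed (PW K) := do
  let D ← nodeFormula Δ i
  let P ← literalPoints (fun _ => true) i [] D
  PW.fromSamples (fun u => do
    let b ← nodeTest D i u
    return if b then [1] else []) P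

/-! ### Symbolic bounds

A line `(s, c)` stands for the symbolic bound `X_i = s * X_j + c`. -/

/-- The boundary lines of the literals of `Δ_{i,j}` in which `X_i` appears, without repetitions. -/
def boundLines (D : CNF n K) (i j : Fin n) : Timed (List (K × K)) :=
  foldT (fun S Γ => foldT (fun S ℓ => do
    tick
    if ℓ.coeff i ≠ 0 then
      let L : K × K := (-ℓ.coeff j / ℓ.coeff i, ℓ.const / ℓ.coeff i)
      let b ← anyT (fun L' => do
        tick
        return decide (L' = L)) S
      return if b then S else L :: S
    else
      return S) S Γ) [] D

/-- The values of `X_j` at which the order of the symbolic bounds, or the truth value of a literal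
of `Δ_{i,j}` without `X_i`, changes. -/
def criticalPoints (D : CNF n K) (i j : Fin n) (S : List (K × K)) : Timed (List K) := do
  let P ← literalPoints (fun ℓ => decide (ℓ.coeff i = 0)) j [] D
  foldT (fun P L => foldT (fun P L' => do
    tick
    if L.1 = L'.1 then
      return P
    else
      insertPoint ((L'.2 - L.2) / (L.1 - L'.1)) P) P S) P S

/-- A point just below `y`: no element of the list lies between it and `y`. -/
def justBelow (y : K) (ys : List K) : Timed K := do
  let z ← foldT (fun z y' => do
    tick
    return if z < y' ∧ y' < y then y' else z) (y - 1) ys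
  return (z + y) / 2

/-- A point just above `y`: no element of the list lies between it and `y`. -/
def justAbove (y : K) (ys : List K) : Timed K := do
  let z ← foldT (fun z y' => do
    tick
    return if y < y' ∧ y' < z then y' else z) (y + 1) ys
  return (y + z) / 2

def valuesAt (S : List (K × K)) (v : K) : Timed (List K) :=
  mapT (fun L => do
    tick
    return L.1 * v + L.2) S

/-- For each value of `X_j`, the values of `X_i` that satisfy `Δ_{i,j}` form, up to finitely many
points, a union of intervals between symbolic bounds. The function returned is `1` where the line
`L` is the upper bound of such an interval, `-1` where it is the lower bound of such an interval,
and `0` where it is neither or both; here `S` is the list of all lines and `P` that of the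
critical points. -/
def boundSign (D : CNF n K) (i j : Fin n) (S : List (K × K)) (P : List K) (L : K × K) :
    Timed (PW K) :=
  PW.fromSamples (fun v => do
    let ys ← valuesAt S v
    tick
    let y := L.1 * v + L.2
    let u ← justBelow y ys
    let w ← justAbove y ys
    let a ← edgeTest D i j u v
    let b ← edgeTest D i j w v
    return [(if a then 1 else 0) - (if b then 1 else 0)]) P

/-- The contribution of the bounds `∞` and `-∞`, where the antiderivative has the limits `top` and
`bot`: `top` where the values of `X_i` above all the lines satisfy `Δ_{i,j}`, minus `bot` where
those below all the lines do. -/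
def infiniteBounds (D : CNF n K) (i j : Fin n) (S : List (K × K)) (P : List K) (bot top : K) :
    Timed (PW K) :=
  PW.fromSamples (fun v => do
    let ys ← valuesAt S v
    let u ← foldT (fun z y => do
      tick
      return min z y) 0 ys
    let w ← foldT (fun z y => do
      tick
      return max z y) 0 ys
    let a ← edgeTest D i j (u - 1) v
    let b ← edgeTest D i j (w + 1) v
    return [(if b then top else 0) - (if a then bot else 0)]) P

/-! ### Message passing -/

/-- The product of the messages in the table `M` that the nodes of the list send to `i`. -/
def product (M : Fin n → Fin n → PW K) (i : Fin n) (cs : List (Fin n)) : Timed (PW K) :=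
  foldT (fun b c => PW.mul (M c i) b) ⟨[1], []⟩ cs

/-- The message from `i` to `j`,
`m_{i → j}(x_j) = ∫ [x_i, x_j ⊨ Δ_{i,j}] [x_i ⊨ Δ_i] ∏_{c ∈ neigh(i) \ {j}} m_{c → i}(x_i) dx_i`,
by symbolic integration: with `F` an antiderivative of the part of the integrand that depends only
on `x_i`, it is the sum of `F(upper bound) - F(lower bound)` over the symbolic intervals of
integration. -/
def sendMessage (Δ : CNF n K) (M : Fin n → Fin n → PW K) (i j : Fin n) : Timed (PW K) := do
  let nb ← neighbours Δ i
  let cs ← filterT (fun c => do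
    tick
    return decide (c ≠ j)) nb
  let b ← product M i cs
  let χ ← nodeIndicator Δ i
  let f ← PW.mul χ b
  let F ← PW.antideriv f
  let D ← edgeFormula Δ i j
  let S ← boundLines D i j
  let P ← criticalPoints D i j S
  let bot ← PW.atBot F
  let top ← PW.atTop F
  let m₀ ← infiniteBounds D i j S P bot top
  foldT (fun m L => do
    let σ ← boundSign D i j S P L
    let G ← PW.comp L.1 L.2 F
    let t ← PW.mul σ G
    PW.add t m) m₀ S

/-- The nodes of the primal tree that are reached from `i` without passing through its parent, each
with its parent, parents before children. The first argument bounds the depth of the search. -/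
def preorder (Δ : CNF n K) : ℕ → Option (Fin n) → Fin n →
    Timed (List (Fin n × Option (Fin n)))
  | 0, _, _ => do
    tick
    return []
  | fuel + 1, p, i => do
    tick
    let nb ← neighbours Δ i
    let cs ← filterT (fun c => do
      tick
      return decide (some c ≠ p)) nb
    let ts ← mapT (preorder Δ fuel (some i)) cs
    let t ← flattenT ts
    return (i, p) :: t

/-- Writes one cell of the table of messages. -/
def store (M : Fin n → Fin n → PW K) (i j : Fin n) (m : PW K) : Timed (Fin n → Fin n → PW K) := do
  tick
  return Function.update M i (Function.update (M i) j m)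

/-- The upward pass: each node, children before parents, sends a message to its parent. -/
def upward (Δ : CNF n K) (V : List (Fin n × Option (Fin n))) (M : Fin n → Fin n → PW K) :
    Timed (Fin n → Fin n → PW K) :=
  foldrT (fun M a => do
    tick
    match a with
    | (_, none) => return M
    | (i, some p) => do
      let m ← sendMessage Δ M i p
      store M i p m) M V

/-- The downward pass: each node, parents before children, receives a message from its parent. -/
def downward (Δ : CNF n K) (V : List (Fin n × Option (Fin n))) (M : Fin n → Fin n → PW K) :
    Timed (Fin n → Fin n → PW K) :=
  foldT (fun M a => do
    tick
    match a with
    | (_, none) => return M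
    | (i, some p) => do
      let m ← sendMessage Δ M p i
      store M p i m) M V

/-- The belief of the node `i`: the product of the messages from all its neighbours. -/
def belief (Δ : CNF n K) (M : Fin n → Fin n → PW K) (i : Fin n) : Timed (PW K) := do
  let nb ← neighbours Δ i
  product M i nb

/-- `∫ [x ⊨ Δ_i] b(x) dx`. -/
def integrateBelief (Δ : CNF n K) (i : Fin n) (b : PW K) : Timed K := do
  let χ ← nodeIndicator Δ i
  let f ← PW.mul χ b
  let F ← PW.antideriv f
  let bot ← PW.atBot F
  let top ← PW.atTop F
  tick
  return top - bot

/-- The output of the algorithm: the beliefs of all nodes, and the model integral. -/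
structure Output (n : ℕ) (K : Type) where
  beliefs : List (Fin n × PW K)
  value : K

/-- Message passing model integration on the primal tree rooted at `r`: the upward pass, the
downward pass, the beliefs of all nodes, and the integral of the belief of the root. -/
def mpmi (Δ : CNF n K) (r : Fin n) : Timed (Output n K) := do
  let V ← preorder Δ n none r
  let M₁ ← upward Δ V fun _ _ => ⟨[], []⟩
  let M₂ ← downward Δ V M₁
  let bs ← mapT (fun a => do
    let b ← belief Δ M₂ a.1
    return (a.1, b)) V
  let b ← belief Δ M₂ r
  let v ← integrateBelief Δ r b
  return ⟨bs, v⟩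

end Formula

end Algorithm

end MPMI

/-!
The running time and the correctness of the algorithm both rest on a description of its messages
that does not mention the algorithm. Removing the edge between adjacent vertices `i` and `j` of the
primal tree cuts off a *branch*, the component of `i`. The exact message from `i` to `j`
(`exactMessage`) is the integral, over all variables of this branch, of the indicator function of
the clauses in which one of them, or no variable at all, appears. Since the primal graph is a tree,
such a clause involves no variables but those of the branch and `X_j`, the branches at `i` other
than that of `j` have no variables in common, and by Tonelli's theorem the exact messages satisfy
the recursion that defines the messages of the algorithm (`exactMessage_eq`). In the same way, the
model integral is the integral of `[x ⊨ Δ_r]` times the exact messages that arrive at the root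
(`MI_eq`).

*Correctness.* A piecewise polynomial `Represents` a message if it agrees with it almost everywhere
where the message is finite. Products preserve this relation, and so does symbolic integration
(`toReal_lintegral_eq`, `represents_symbolicIntegral`): if the message from `i` to `j` is finite at
`v`, its integrand is finite almost everywhere on the domain of integration, and the pieces of the
integrand on unbounded parts of this domain vanish, because a non-negative polynomial with a finite
integral over a half-line is zero. What remains is the fundamental theorem of calculus on finitely
many intervals, whose end points are values of the boundary lines of the literals at `v`. Between
consecutive critical points the order of these lines does not change, so that the result is
piecewise polynomial in `v`.

*Running time.* Let `m` be the number of literals. The formulas of a vertex and of the edges at it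
have no clauses in common (`numLiterals_star_le`), so that the breakpoints of the factors of an
integrand add up to at most `m` times the largest power of `m` that bounds one of the factors, and
each edge contributes one further factor. Hence a message has at most `m ^ (d + 1)` breakpoints if
its branch has `d` levels, and its pieces have degree at most `n` (`IsMessage`). Computing it takes
`O(n³ m ^ E)` steps if `E ≥ d + 2` and `E ≥ 4` (`isMessage_sendMessage`), and the whole algorithm
takes `O(n⁴ m ^ E)` steps (`mpmi_spec`). The distance of two vertices is bounded both through the
height `h_p` and through the height `h_t`, which gives `d + 2 ≤ h_p + h_t`
(`branchDepth_add_two_le`). Both heights are at least `2`, so that `E = h_p * h_t` is a valid choice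
and `n⁴ ≤ n ^ (3 * h_t)`.
-/

namespace MPMI

/-! ### Values and costs of timed computations -/

section Timed

variable {α β : Type}

@[simp] theorem Timed.val_bind (x : Timed α) (f : α → Timed β) : (x >>= f).val = (f x.val).val :=
  rfl

@[simp] theorem Timed.steps_bind (x : Timed α) (f : α → Timed β) :
    (x >>= f).steps = x.steps + (f x.val).steps := rfl

@[simp] theorem Timed.val_pure (a : α) : (pure a : Timed α).val = a := rfl

@[simp] theorem Timed.steps_pure (a : α) : (pure a : Timed α).steps = 0 := rfl

@[simp] theorem steps_tick : tick.steps = 1 := rfl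

theorem Timed.val_ite (c : Prop) [Decidable c] (x y : Timed α) :
    (if c then x else y).val = if c then x.val else y.val := by split_ifs <;> rfl

theorem Timed.steps_ite (c : Prop) [Decidable c] (x y : Timed α) :
    (if c then x else y).steps = if c then x.steps else y.steps := by split_ifs <;> rfl

@[simp] theorem val_foldT (f : β → α → Timed β) (b : β) (l : List α) :
    (foldT f b l).val = l.foldl (fun b a => (f b a).val) b := by
  induction l generalizing b with
  | nil => rfl
  | cons a l ih => simp [foldT, ih]

@[simp] theorem val_mapT (f : α → Timed β) (l : List α) :
    (mapT f l).val = l.map fun a => (f a).val := by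
  induction l with
  | nil => rfl
  | cons a l ih => simp [mapT, ih]

@[simp] theorem val_filterT (p : α → Timed Bool) (l : List α) :
    (filterT p l).val = l.filter fun a => (p a).val := by
  induction l with
  | nil => rfl
  | cons a l ih => simp [filterT, ih, List.filter_cons]

@[simp] theorem val_anyT (p : α → Timed Bool) (l : List α) :
    (anyT p l).val = l.any fun a => (p a).val := by
  induction l with
  | nil => rfl
  | cons a l ih =>
    simp only [anyT, Timed.val_bind, Timed.val_ite, ih, Timed.val_pure, List.any_cons]
    cases (p a).val <;> simp

@[simp] theorem val_allT (p : α → Timed Bool) (l : List α) :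
    (allT p l).val = l.all fun a => (p a).val := by
  induction l with
  | nil => rfl
  | cons a l ih =>
    simp only [allT, Timed.val_bind, Timed.val_ite, ih, Timed.val_pure, List.all_cons]
    cases (p a).val <;> simp

@[simp] theorem val_appendT (l t : List α) : (appendT l t).val = l ++ t := by
  induction l with
  | nil => rfl
  | cons a l ih => simp [appendT, ih]

@[simp] theorem val_flattenT (l : List (List α)) : (flattenT l).val = l.flatten := by
  induction l with
  | nil => rfl
  | cons a l ih => simp [flattenT, ih]

theorem steps_mapT (f : α → Timed β) (l : List α) :
    (mapT f l).steps = (l.map fun a => (f a).steps + 1).sum + 1 := by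
  induction l with
  | nil => rfl
  | cons a l ih => simp [mapT, ih]; omega

theorem steps_filterT (p : α → Timed Bool) (l : List α) :
    (filterT p l).steps = (l.map fun a => (p a).steps + 1).sum + 1 := by
  induction l with
  | nil => rfl
  | cons a l ih => simp [filterT, ih]; omega

theorem steps_anyT_le (p : α → Timed Bool) (l : List α) :
    (anyT p l).steps ≤ (l.map fun a => (p a).steps + 1).sum + 1 := by
  induction l with
  | nil => simp [anyT]
  | cons a l ih => simp only [anyT, Timed.steps_bind, Timed.steps_ite, steps_tick,
      Timed.steps_pure, List.map_cons, List.sum_cons]; split_ifs <;> omega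

theorem steps_allT_le (p : α → Timed Bool) (l : List α) :
    (allT p l).steps ≤ (l.map fun a => (p a).steps + 1).sum + 1 := by
  induction l with
  | nil => simp [allT]
  | cons a l ih => simp only [allT, Timed.steps_bind, Timed.steps_ite, steps_tick,
      Timed.steps_pure, List.map_cons, List.sum_cons]; split_ifs <;> omega

theorem steps_appendT (l t : List α) : (appendT l t).steps = l.length + 1 := by
  induction l with
  | nil => rfl
  | cons a l ih => simp [appendT, ih]; omega

theorem steps_flattenT (l : List (List α)) :
    (flattenT l).steps = (l.map fun s => s.length + 2).sum + 1 := by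
  induction l with
  | nil => rfl
  | cons a l ih => simp [flattenT, ih, steps_appendT]; omega

theorem sum_map_le_length_mul (l : List α) (g : α → ℕ) (c : ℕ) (h : ∀ a ∈ l, g a ≤ c) :
    (l.map g).sum ≤ l.length * c := by
  induction l with
  | nil => simp
  | cons a l ih =>
    have h₁ := h a (by simp)
    have h₂ := ih fun b hb => h b (by simp [hb])
    simp only [List.map_cons, List.sum_cons, List.length_cons, add_mul]
    omega

theorem steps_mapT_le (f : α → Timed β) (l : List α) (c : ℕ) (h : ∀ a ∈ l, (f a).steps ≤ c) :
    (mapT f l).steps ≤ l.length * (c + 1) + 1 := by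
  rw [steps_mapT]
  have := sum_map_le_length_mul l (fun a => (f a).steps + 1) (c + 1) fun a ha => by
    have := h a ha; omega
  omega

theorem steps_filterT_le (p : α → Timed Bool) (l : List α) (c : ℕ)
    (h : ∀ a ∈ l, (p a).steps ≤ c) : (filterT p l).steps ≤ l.length * (c + 1) + 1 := by
  rw [steps_filterT]
  have := sum_map_le_length_mul l (fun a => (p a).steps + 1) (c + 1) fun a ha => by
    have := h a ha; omega
  omega

theorem steps_anyT_le_of_le (p : α → Timed Bool) (l : List α) (c : ℕ)
    (h : ∀ a ∈ l, (p a).steps ≤ c) : (anyT p l).steps ≤ l.length * (c + 1) + 1 := by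
  have := sum_map_le_length_mul l (fun a => (p a).steps + 1) (c + 1) fun a ha => by
    have := h a ha; omega
  have := steps_anyT_le p l
  omega

theorem steps_allT_le_of_le (p : α → Timed Bool) (l : List α) (c : ℕ)
    (h : ∀ a ∈ l, (p a).steps ≤ c) : (allT p l).steps ≤ l.length * (c + 1) + 1 := by
  have := sum_map_le_length_mul l (fun a => (p a).steps + 1) (c + 1) fun a ha => by
    have := h a ha; omega
  have := steps_allT_le p l
  omega

/-- A property that every step of a loop preserves holds at its end. -/
theorem foldT_induction (f : β → α → Timed β) (I : β → Prop) (l : List α) (b : β) (hb : I b)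
    (h : ∀ b, ∀ a ∈ l, I b → I (f b a).val) : I (foldT f b l).val := by
  induction l generalizing b with
  | nil => exact hb
  | cons a l ih =>
    simp only [foldT, Timed.val_bind]
    exact ih _ (h b a (by simp) hb) fun b a' ha' => h b a' (by simp [ha'])

theorem foldT_steps_le (f : β → α → Timed β) (I : β → Prop) (c : ℕ) (l : List α) (b : β)
    (hb : I b) (h : ∀ b, ∀ a ∈ l, I b → I (f b a).val ∧ (f b a).steps ≤ c) :
    (foldT f b l).steps ≤ l.length * (c + 1) + 1 := by
  induction l generalizing b with
  | nil => simp [foldT]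
  | cons a l ih =>
    obtain ⟨h₁, h₂⟩ := h b a (by simp) hb
    have := ih _ h₁ fun b a' ha' => h b a' (by simp [ha'])
    simp only [foldT, Timed.steps_bind, steps_tick, List.length_cons, add_mul]
    omega

theorem len_foldT_le (f : β → α → Timed β) (len : β → ℕ) (g : α → ℕ) (l : List α) (b : β)
    (hg : ∀ b, ∀ a ∈ l, len (f b a).val ≤ len b + g a) :
    len (foldT f b l).val ≤ len b + (l.map g).sum := by
  induction l generalizing b with
  | nil => simp [foldT]
  | cons a l ih =>
    have h₁ := hg b a (by simp)
    have h₂ := ih (f b a).val fun b a' ha' => hg b a' (by simp [ha'])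
    simp only [foldT, Timed.val_bind, List.map_cons, List.sum_cons]
    omega

/-- A loop that lets the size `len` of its state grow by at most `g a` in the step for `a`, where
a step costs at most `c` as long as the size stays below `L`. -/
theorem foldT_growth (f : β → α → Timed β) (len : β → ℕ) (g : α → ℕ) (c L : ℕ) (l : List α)
    (b : β) (hc : ∀ b, ∀ a ∈ l, len b + g a ≤ L → (f b a).steps ≤ c)
    (hg : ∀ b, ∀ a ∈ l, len (f b a).val ≤ len b + g a) (hL : len b + (l.map g).sum ≤ L) :
    (foldT f b l).steps ≤ l.length * (c + 1) + 1 ∧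
      len (foldT f b l).val ≤ len b + (l.map g).sum := by
  refine ⟨?_, len_foldT_le f len g l b hg⟩
  induction l generalizing b with
  | nil => simp [foldT]
  | cons a l ih =>
    simp only [List.map_cons, List.sum_cons] at hL
    have h₁ := hc b a (by simp) (by omega)
    have h₂ := hg b a (by simp)
    have h₃ := ih (f b a).val (fun b a' ha' => hc b a' (by simp [ha']))
      (fun b a' ha' => hg b a' (by simp [ha'])) (by omega)
    simp only [foldT, Timed.steps_bind, steps_tick, List.length_cons, add_mul]
    omega

end Timed

/-! ### Polynomials -/

namespace Poly

theorem length_add (p q : Poly ℝ) : (add p q).val.length = max p.length q.length := by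
  induction p generalizing q with
  | nil => simp [add]
  | cons a p ih => cases q <;> simp [add, ih]

theorem steps_add_le (p q : Poly ℝ) :
    (add p q).steps ≤ p.length + 1 ∧ (add p q).steps ≤ q.length + 1 := by
  induction p generalizing q with
  | nil => simp [add]
  | cons a p ih =>
    cases q with
    | nil => simp [add]
    | cons b q =>
      have := ih q
      simp [add]; omega

theorem length_scale (c : ℝ) (p : Poly ℝ) : (scale c p).val.length = p.length := by
  simp [scale]

theorem steps_scale (c : ℝ) (p : Poly ℝ) : (scale c p).steps = 2 * p.length + 1 := by
  simp [scale, steps_mapT]; omega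

/-- The second statement excludes the product of a polynomial with the empty list from the truncated
subtraction in the first one. -/
theorem length_mul (p q : Poly ℝ) :
    (mul p q).val.length ≤ p.length + q.length - 1 ∧ (q = [] → (mul p q).val = []) := by
  induction p with
  | nil => simp [mul]
  | cons a p ih =>
    obtain ⟨h₁, h₂⟩ := ih
    have h₃ : (shift (mul p q).val).val.length ≤ p.length + q.length ∧
        (q = [] → (shift (mul p q).val).val = []) := by
      generalize (mul p q).val = r at *
      cases r with
      | nil => simp [shift]
      | cons b r =>
        simp only [shift, Timed.val_bind, Timed.val_pure, List.length_cons] at *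
        refine ⟨?_, fun hq => by simp at h₂; exact absurd hq h₂⟩
        omega
    constructor
    · simp only [mul, Timed.val_bind, length_add, length_scale, List.length_cons]
      omega
    · intro hq
      have h₄ := h₃.2 hq
      subst hq
      simp [mul, h₄, scale, add]

theorem steps_shift (p : Poly ℝ) : (shift p).steps = 1 := by
  cases p <;> simp [shift]

theorem steps_mul_le (p q : Poly ℝ) : (mul p q).steps ≤ p.length * (3 * q.length + 4) + 1 := by
  induction p with
  | nil => simp [mul]
  | cons a p ih =>
    have := (steps_add_le (scale a q).val (shift (mul p q).val).val).1
    rw [length_scale] at this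
    simp only [mul, Timed.steps_bind, steps_tick, steps_scale, steps_shift, List.length_cons,
      add_mul]
    omega

theorem steps_eval (x : ℝ) (p : Poly ℝ) : (eval x p).steps = p.length + 1 := by
  induction p with
  | nil => simp [eval]
  | cons a p ih => simp [eval, ih]; omega

theorem length_comp (s c : ℝ) (p : Poly ℝ) : (comp s c p).val.length ≤ p.length := by
  induction p with
  | nil => simp [comp]
  | cons a p ih =>
    have := length_mul [c, s] (comp s c p).val
    simp only [comp, Timed.val_bind, length_add, List.length_cons, List.length_nil] at *
    by_cases h : (comp s c p).val = []
    · simp [this.2 h]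
    · omega

theorem steps_comp_le (s c : ℝ) (p : Poly ℝ) :
    (comp s c p).steps ≤ p.length * (6 * p.length + 12) + 1 := by
  induction p with
  | nil => simp [comp]
  | cons a p ih =>
    have h₁ := steps_mul_le [c, s] (comp s c p).val
    have h₂ := length_comp s c p
    have h₃ := (steps_add_le [a] (mul [c, s] (comp s c p).val).val).1
    have h₄ : p.length * (6 * p.length + 12) ≤ p.length * (6 * (p.length + 1) + 12) := by
      gcongr
      omega
    simp only [comp, Timed.steps_bind, steps_tick, List.length_cons, List.length_nil,
      add_mul] at *
    omega

theorem length_divCoeffs (d : ℝ) (p : Poly ℝ) : (divCoeffs d p).val.length = p.length := by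
  induction p generalizing d with
  | nil => simp [divCoeffs]
  | cons a p ih => simp [divCoeffs, ih]

theorem steps_divCoeffs (d : ℝ) (p : Poly ℝ) : (divCoeffs d p).steps = p.length + 1 := by
  induction p generalizing d with
  | nil => simp [divCoeffs]
  | cons a p ih => simp [divCoeffs, ih]; omega

theorem length_antideriv (p : Poly ℝ) : (antideriv p).val.length = p.length + 1 := by
  simp [antideriv, length_divCoeffs]

theorem steps_antideriv (p : Poly ℝ) : (antideriv p).steps = p.length + 2 := by
  simp [antideriv, steps_divCoeffs]; omega

/-- The value at `x` of the polynomial with the given coefficients. -/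
def ev : Poly ℝ → ℝ → ℝ
  | [], _ => 0
  | a :: p, x => a + x * ev p x

@[simp] theorem ev_nil (x : ℝ) : ev [] x = 0 := rfl

@[simp] theorem ev_cons (a : ℝ) (p : Poly ℝ) (x : ℝ) : ev (a :: p) x = a + x * ev p x := rfl

theorem val_eval (x : ℝ) (p : Poly ℝ) : (eval x p).val = ev p x := by
  induction p with
  | nil => rfl
  | cons a p ih => simp [eval, ih]

@[simp] theorem ev_add (p q : Poly ℝ) (x : ℝ) : ev (add p q).val x = ev p x + ev q x := by
  induction p generalizing q with
  | nil => simp [add]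
  | cons a p ih =>
    cases q with
    | nil => simp [add]
    | cons b q => simp [add, ih]; ring

theorem ev_scale (c : ℝ) (p : Poly ℝ) (x : ℝ) : ev (scale c p).val x = c * ev p x := by
  induction p with
  | nil => simp [scale]
  | cons a p ih => simp [scale] at ih ⊢; rw [ih]; ring

theorem ev_shift (p : Poly ℝ) (x : ℝ) : ev (shift p).val x = x * ev p x := by
  cases p <;> simp [shift]

@[simp] theorem ev_mul (p q : Poly ℝ) (x : ℝ) : ev (mul p q).val x = ev p x * ev q x := by
  induction p with
  | nil => simp [mul]
  | cons a p ih => simp [mul, ih, ev_scale, ev_shift]; ring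

@[simp] theorem ev_comp (s c : ℝ) (p : Poly ℝ) (x : ℝ) :
    ev (comp s c p).val x = ev p (s * x + c) := by
  induction p with
  | nil => simp [comp]
  | cons a p ih =>
    simp only [comp, Timed.val_bind, ev_add, ev_mul, ev_cons, ev_nil, ih]
    ring

/-- The antiderivative of `x ^ d * p x`, with the factor `x ^ (d + 1)` taken out of the coefficient
list, so that the recursion of `divCoeffs` applies. -/
theorem hasDerivAt_ev_divCoeffs (p : Poly ℝ) (d : ℕ) (x : ℝ) :
    HasDerivAt (fun x => x ^ (d + 1) * ev (divCoeffs ((d : ℝ) + 1) p).val x)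
      (x ^ d * ev p x) x := by
  induction p generalizing d with
  | nil => simpa [divCoeffs] using hasDerivAt_const x (0 : ℝ)
  | cons a p ih =>
    have h₁ := ih (d + 1)
    have h₂ : HasDerivAt (fun x : ℝ => x ^ (d + 1) * (a / ((d : ℝ) + 1))) (x ^ d * a) x := by
      have := (hasDerivAt_pow (d + 1) x).mul_const (a / ((d : ℝ) + 1))
      refine this.congr_deriv ?_
      have : ((d : ℝ) + 1) ≠ 0 := by positivity
      rw [Nat.add_sub_cancel]
      push_cast
      field_simp
    refine ((h₂.add h₁).congr_deriv (by simp only [ev_cons]; ring)).congr_of_eventuallyEq ?_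
    filter_upwards with y
    simp only [divCoeffs, Timed.val_bind, Timed.val_pure, ev_cons, Pi.add_apply]
    push_cast
    ring

theorem hasDerivAt_antideriv (p : Poly ℝ) (x : ℝ) :
    HasDerivAt (ev (antideriv p).val) (ev p x) x := by
  have := hasDerivAt_ev_divCoeffs p 0 x
  simp only [zero_add, pow_one, pow_zero, one_mul, Nat.cast_zero] at this
  refine this.congr_of_eventuallyEq ?_
  filter_upwards with y
  simp [antideriv]

theorem continuous_ev (p : Poly ℝ) : Continuous (ev p) := by
  induction p with
  | nil => exact continuous_const
  | cons a p ih => exact continuous_const.add (continuous_id.mul ih)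

/-- A coefficient list as a Mathlib polynomial. -/
noncomputable def toPolynomial : Poly ℝ → Polynomial ℝ
  | [] => 0
  | a :: p => Polynomial.C a + Polynomial.X * toPolynomial p

theorem eval_toPolynomial (p : Poly ℝ) (x : ℝ) : (toPolynomial p).eval x = ev p x := by
  induction p with
  | nil => simp [toPolynomial]
  | cons a p ih => simp [toPolynomial, ih]

theorem coeff_toPolynomial (p : Poly ℝ) (k : ℕ) : (toPolynomial p).coeff k = p.getD k 0 := by
  induction p generalizing k with
  | nil => simp [toPolynomial]
  | cons a p ih => cases k <;> simp [toPolynomial, ih, Polynomial.coeff_C]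

/-- A polynomial that takes the value `c` infinitely often is the constant `c`, and then `c` is its
first coefficient, even if the list of coefficients is followed by zeros. -/
theorem headD_eq_of_infinite (p : Poly ℝ) (c : ℝ) (s : Set ℝ) (hs : s.Infinite)
    (h : ∀ x ∈ s, ev p x = c) : p.headD 0 = c ∧ ∀ x, ev p x = c := by
  have : toPolynomial p = Polynomial.C c := by
    refine Polynomial.eq_of_infinite_eval_eq _ _ (hs.mono fun x hx => ?_)
    simp [eval_toPolynomial, h x hx]
  refine ⟨?_, fun x => by rw [← eval_toPolynomial, this, Polynomial.eval_C]⟩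
  have h₀ := coeff_toPolynomial p 0
  rw [this, Polynomial.coeff_C_zero] at h₀
  rw [h₀]
  cases p <;> simp

end Poly

/-! ### Piecewise polynomials -/

namespace PW

/-- The polynomial of the piece that contains `x`, where a breakpoint belongs to the piece on its
right; `p` is the piece to the left of all breakpoints of the list. -/
noncomputable def lookFrom (x : ℝ) (p : Poly ℝ) : List (ℝ × Poly ℝ) → Poly ℝ
  | [] => p
  | (y, q) :: s => if x < y then p else lookFrom x q s

/-- The polynomial of the piece of `f` that contains `x`. -/
noncomputable def look (f : PW ℝ) (x : ℝ) : Poly ℝ := lookFrom x f.first f.rest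

/-- The value of the piecewise polynomial `f` at `x`. -/
noncomputable def ev (f : PW ℝ) (x : ℝ) : ℝ := (f.look x).ev x

/-- The breakpoints of `f`. -/
def bpts (f : PW ℝ) : List ℝ := f.rest.map Prod.fst

/-- The breakpoints of `f` are listed in strictly increasing order. -/
def Sorted (f : PW ℝ) : Prop := f.bpts.Pairwise (· < ·)

/-- All pieces of `f` have at most `d` coefficients. -/
def CoeffsLe (f : PW ℝ) (d : ℕ) : Prop := f.first.length ≤ d ∧ ∀ a ∈ f.rest, a.2.length ≤ d

theorem CoeffsLe.mono {f : PW ℝ} {d d' : ℕ} (h : f.CoeffsLe d) (hd : d ≤ d') : f.CoeffsLe d' :=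
  ⟨h.1.trans hd, fun a ha => (h.2 a ha).trans hd⟩

theorem length_bpts (f : PW ℝ) : f.bpts.length = f.rest.length := by simp [bpts]

theorem lookFrom_of_lt {x : ℝ} {p : Poly ℝ} {s : List (ℝ × Poly ℝ)} (h : ∀ a ∈ s, x < a.1) :
    lookFrom x p s = p := by
  cases s with
  | nil => rfl
  | cons a s => simp [lookFrom, h a (by simp)]

/-! ### Binary operations on piecewise polynomials -/

section Merge

variable (op : Poly ℝ → Poly ℝ → Timed (Poly ℝ))

theorem lookFrom_merge (x : ℝ) (p q : Poly ℝ) (s t : List (ℝ × Poly ℝ)) :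
    lookFrom x (op p q).val (merge op p q s t).val =
      (op (lookFrom x p s) (lookFrom x q t)).val := by
  induction p, q, s, t using merge.induct with
  | case1 p q => simp [merge, lookFrom]
  | case2 p q y p' s ih =>
    rw [merge]
    simp only [Timed.val_bind, Timed.val_pure, lookFrom] at ih ⊢
    split_ifs <;> simp_all
  | case3 p q y q' s ih =>
    rw [merge]
    simp only [Timed.val_bind, Timed.val_pure, lookFrom] at ih ⊢
    split_ifs <;> simp_all
  | case4 p q y p' s z q' s' ih₁ ih₂ ih₃ =>
    rw [merge]
    rcases lt_trichotomy y z with h | rfl | h'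
    · simp only [h, if_true, Timed.val_bind, Timed.val_pure, lookFrom] at ih₁ ⊢
      split_ifs with h₁ h₂ h₂
      · rfl
      · exact absurd (h₁.trans h) h₂
      · rw [ih₁, if_pos h₂]
      · rw [ih₁, if_neg h₂]
    · have h := lt_irrefl y
      simp only [h, if_false, Timed.val_bind, Timed.val_pure, lookFrom] at ih₃ ⊢
      split_ifs
      · rfl
      · rw [ih₃]
    · have h : ¬y < z := not_lt.2 h'.le
      simp only [h, h', if_true, if_false, Timed.val_bind, Timed.val_pure, lookFrom] at ih₂ ⊢
      split_ifs with h₁ h₂ h₂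
      · rfl
      · exact absurd (h₁.trans h') h₂
      · rw [ih₂, if_pos h₂]
      · rw [ih₂, if_neg h₂]

theorem mem_bpts_merge (x : ℝ) (p q : Poly ℝ) (s t : List (ℝ × Poly ℝ)) :
    x ∈ (merge op p q s t).val.map Prod.fst ↔ x ∈ s.map Prod.fst ∨ x ∈ t.map Prod.fst := by
  induction p, q, s, t using merge.induct with
  | case1 p q => simp [merge]
  | case2 p q y p' s ih =>
    rw [merge]
    simp only [Timed.val_bind, Timed.val_pure, List.map_cons, List.mem_cons, ih, or_assoc]
  | case3 p q y q' s ih =>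
    rw [merge]
    simp only [Timed.val_bind, Timed.val_pure, List.map_cons, List.mem_cons, ih, or_left_comm]
  | case4 p q y p' s z q' s' ih₁ ih₂ ih₃ =>
    rw [merge]
    rcases lt_trichotomy y z with h | rfl | h'
    · simp only [h, if_true, Timed.val_bind, Timed.val_pure, List.map_cons, List.mem_cons] at ih₁ ⊢
      tauto
    · have h := lt_irrefl y
      simp only [h, if_false, Timed.val_bind, Timed.val_pure, List.map_cons, List.mem_cons] at ih₃ ⊢
      tauto
    · have h : ¬y < z := not_lt.2 h'.le
      simp only [h, h', if_true, if_false, Timed.val_bind, Timed.val_pure, List.map_cons,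
        List.mem_cons] at ih₂ ⊢
      tauto

theorem pairwise_merge (p q : Poly ℝ) (s t : List (ℝ × Poly ℝ))
    (hs : (s.map Prod.fst).Pairwise (· < ·)) (ht : (t.map Prod.fst).Pairwise (· < ·)) :
    ((merge op p q s t).val.map Prod.fst).Pairwise (· < ·) := by
  induction p, q, s, t using merge.induct with
  | case1 p q => simp [merge]
  | case2 p q y p' s ih =>
    rw [merge]
    simp only [Timed.val_bind, Timed.val_pure, List.map_cons, List.pairwise_cons,
      mem_bpts_merge] at hs ⊢
    exact ⟨fun a ha => hs.1 a (by simpa using ha), ih hs.2 ht⟩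
  | case3 p q y q' s ih =>
    rw [merge]
    simp only [Timed.val_bind, Timed.val_pure, List.map_cons, List.pairwise_cons,
      mem_bpts_merge] at ht ⊢
    exact ⟨fun a ha => ht.1 a (by simpa using ha), ih hs ht.2⟩
  | case4 p q y p' s z q' s' ih₁ ih₂ ih₃ =>
    rw [merge]
    rcases lt_trichotomy y z with h | rfl | h'
    · have hs' := hs
      have ht' := ht
      simp only [h, if_true, Timed.val_bind, Timed.val_pure, List.map_cons, List.pairwise_cons,
        mem_bpts_merge, List.mem_cons] at hs ht ih₁ ⊢
      refine ⟨?_, ih₁ hs.2 ht⟩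
      rintro a (ha | rfl | ha)
      · exact hs.1 a ha
      · exact h
      · exact h.trans (ht.1 a ha)
    · have h := lt_irrefl y
      simp only [h, if_false, Timed.val_bind, Timed.val_pure, List.map_cons,
        List.pairwise_cons, mem_bpts_merge] at hs ht ih₃ ⊢
      refine ⟨?_, ih₃ hs.2 ht.2⟩
      rintro a (ha | ha)
      · exact hs.1 a ha
      · exact ht.1 a ha
    · have h : ¬y < z := not_lt.2 h'.le
      simp only [h, h', if_true, if_false, Timed.val_bind, Timed.val_pure, List.map_cons,
        List.pairwise_cons, mem_bpts_merge, List.mem_cons] at hs ht ih₂ ⊢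
      refine ⟨?_, ih₂ hs ht.2⟩
      rintro a ((rfl | ha) | ha)
      · exact h'
      · exact h'.trans (hs.1 a ha)
      · exact ht.1 a ha

theorem merge_cost {d₁ d₂ d c : ℕ}
    (hop : ∀ p q : Poly ℝ, p.length ≤ d₁ → q.length ≤ d₂ →
      (op p q).val.length ≤ d ∧ (op p q).steps ≤ c)
    (p q : Poly ℝ) (s t : List (ℝ × Poly ℝ)) (hp : p.length ≤ d₁) (hq : q.length ≤ d₂)
    (hs : ∀ a ∈ s, a.2.length ≤ d₁) (ht : ∀ a ∈ t, a.2.length ≤ d₂) :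
    (∀ a ∈ (merge op p q s t).val, a.2.length ≤ d) ∧
      (merge op p q s t).steps ≤ (s.length + t.length) * (c + 1) + 1 := by
  induction p, q, s, t using merge.induct with
  | case1 p q => simp [merge]
  | case2 p q y p' s ih =>
    rw [merge]
    simp only [List.forall_mem_cons] at hs
    obtain ⟨h₁, h₂⟩ := hop _ _ hs.1 hq
    obtain ⟨h₃, h₄⟩ := ih hs.1 hq hs.2 ht
    simp only [Timed.val_bind, Timed.steps_bind, Timed.steps_pure, Timed.val_pure, steps_tick,
      List.forall_mem_cons, List.length_cons, List.length_nil, add_zero, add_mul] at *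
    exact ⟨⟨h₁, h₃⟩, by omega⟩
  | case3 p q y q' s ih =>
    rw [merge]
    simp only [List.forall_mem_cons] at ht
    obtain ⟨h₁, h₂⟩ := hop _ _ hp ht.1
    obtain ⟨h₃, h₄⟩ := ih hp ht.1 hs ht.2
    simp only [Timed.val_bind, Timed.steps_bind, Timed.steps_pure, Timed.val_pure, steps_tick,
      List.forall_mem_cons, List.length_cons, List.length_nil, zero_add, add_mul] at *
    exact ⟨⟨h₁, h₃⟩, by omega⟩
  | case4 p q y p' s z q' s' ih₁ ih₂ ih₃ =>
    rw [merge]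
    rcases lt_trichotomy y z with h | rfl | h'
    · have hs' := hs
      simp only [List.forall_mem_cons] at hs'
      obtain ⟨h₁, h₂⟩ := hop _ _ hs'.1 hq
      obtain ⟨h₃, h₄⟩ := ih₁ hs'.1 hq hs'.2 ht
      simp only [h, if_true, Timed.val_bind, Timed.steps_bind, Timed.steps_pure, Timed.val_pure,
        steps_tick, List.forall_mem_cons, List.length_cons, add_mul] at *
      exact ⟨⟨h₁, h₃⟩, by omega⟩
    · have h := lt_irrefl y
      simp only [List.forall_mem_cons] at hs ht
      obtain ⟨h₁, h₂⟩ := hop _ _ hs.1 ht.1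
      obtain ⟨h₃, h₄⟩ := ih₃ hs.1 ht.1 hs.2 ht.2
      simp only [h, if_false, Timed.val_bind, Timed.steps_bind, Timed.steps_pure,
        Timed.val_pure, steps_tick, List.forall_mem_cons, List.length_cons, add_mul] at *
      exact ⟨⟨h₁, h₃⟩, by omega⟩
    · have h : ¬y < z := not_lt.2 h'.le
      have ht' := ht
      simp only [List.forall_mem_cons] at ht'
      obtain ⟨h₁, h₂⟩ := hop _ _ hp ht'.1
      obtain ⟨h₃, h₄⟩ := ih₂ hp ht'.1 hs ht'.2
      simp only [h, h', if_true, if_false, Timed.val_bind, Timed.steps_bind, Timed.steps_pure,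
        Timed.val_pure, steps_tick, List.forall_mem_cons, List.length_cons, add_mul] at *
      exact ⟨⟨h₁, h₃⟩, by omega⟩

theorem look_zip (f g : PW ℝ) (x : ℝ) :
    (zip op f g).val.look x = (op (f.look x) (g.look x)).val := lookFrom_merge op x _ _ _ _

theorem mem_bpts_zip (f g : PW ℝ) (x : ℝ) :
    x ∈ (zip op f g).val.bpts ↔ x ∈ f.bpts ∨ x ∈ g.bpts := mem_bpts_merge op x _ _ _ _

theorem sorted_zip {f g : PW ℝ} (hf : f.Sorted) (hg : g.Sorted) : (zip op f g).val.Sorted :=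
  pairwise_merge op _ _ _ _ hf hg

theorem zip_cost {d₁ d₂ d c : ℕ}
    (hop : ∀ p q : Poly ℝ, p.length ≤ d₁ → q.length ≤ d₂ →
      (op p q).val.length ≤ d ∧ (op p q).steps ≤ c)
    {f g : PW ℝ} (hf : f.CoeffsLe d₁) (hg : g.CoeffsLe d₂) :
    (zip op f g).val.CoeffsLe d ∧
      (zip op f g).steps ≤ (f.bpts.length + g.bpts.length + 1) * (c + 1) + 1 := by
  obtain ⟨h₁, h₂⟩ := hop _ _ hf.1 hg.1
  obtain ⟨h₃, h₄⟩ := merge_cost op hop _ _ _ _ hf.1 hg.1 hf.2 hg.2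
  refine ⟨⟨h₁, h₃⟩, ?_⟩
  simp only [zip, Timed.steps_bind, Timed.steps_pure, steps_tick, length_bpts, add_mul] at *
  omega

end Merge

theorem ev_mul (f g : PW ℝ) (x : ℝ) : (mul f g).val.ev x = f.ev x * g.ev x := by
  simp [ev, mul, look_zip]

theorem ev_add (f g : PW ℝ) (x : ℝ) : (add f g).val.ev x = f.ev x + g.ev x := by
  simp [ev, add, look_zip]

theorem mul_cost {d₁ d₂ : ℕ} {f g : PW ℝ} (hf : f.CoeffsLe (d₁ + 1)) (hg : g.CoeffsLe (d₂ + 1)) :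
    (mul f g).val.CoeffsLe (d₁ + d₂ + 1) ∧
      (mul f g).steps ≤
        (f.bpts.length + g.bpts.length + 1) * ((d₁ + 1) * (3 * (d₂ + 1) + 4) + 2) + 1 := by
  refine zip_cost _ (c := (d₁ + 1) * (3 * (d₂ + 1) + 4) + 1) (fun p q hp hq => ⟨?_, ?_⟩) hf hg
  · have := (Poly.length_mul p q).1
    omega
  · refine (Poly.steps_mul_le p q).trans ?_
    gcongr

theorem add_cost {d : ℕ} {f g : PW ℝ} (hf : f.CoeffsLe d) (hg : g.CoeffsLe d) :
    (add f g).val.CoeffsLe d ∧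
      (add f g).steps ≤ (f.bpts.length + g.bpts.length + 1) * (d + 2) + 1 := by
  refine zip_cost _ (c := d + 1) (fun p q hp hq => ⟨?_, ?_⟩) hf hg
  · have := Poly.length_add p q
    omega
  · have := (Poly.steps_add_le p q).1
    omega

/-! ### Antiderivatives of piecewise polynomials -/

theorem bpts_antiderivFrom (P : Poly ℝ) (s : List (ℝ × Poly ℝ)) :
    (antiderivFrom P s).val.map Prod.fst = s.map Prod.fst := by
  induction s generalizing P with
  | nil => rfl
  | cons a s ih => simp [antiderivFrom, ih]

theorem bpts_antideriv (f : PW ℝ) : (antideriv f).val.bpts = f.bpts :=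
  bpts_antiderivFrom _ _

theorem hasDerivAt_lookFrom_antiderivFrom (P p : Poly ℝ) (s : List (ℝ × Poly ℝ))
    (h : ∀ y, HasDerivAt P.ev (p.ev y) y) (x y : ℝ) :
    HasDerivAt (lookFrom x P (antiderivFrom P s).val).ev ((lookFrom x p s).ev y) y := by
  induction s generalizing P p with
  | nil => exact h y
  | cons a s ih =>
    obtain ⟨z, q⟩ := a
    simp only [antiderivFrom, Timed.val_bind, Timed.val_pure, lookFrom]
    split_ifs
    · exact h y
    · refine ih _ _ fun y => ?_
      have := (Poly.hasDerivAt_antideriv q y).const_add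
        ((Poly.eval z P).val - (Poly.eval z (Poly.antideriv q).val).val)
      refine this.congr_of_eventuallyEq ?_
      filter_upwards with w
      simp

theorem continuous_antiderivFrom (P : Poly ℝ) (s : List (ℝ × Poly ℝ))
    (hs : (s.map Prod.fst).Pairwise (· < ·)) :
    Continuous fun x => (lookFrom x P (antiderivFrom P s).val).ev x := by
  induction s generalizing P with
  | nil => exact Poly.continuous_ev P
  | cons a s ih =>
    obtain ⟨z, q⟩ := a
    simp only [antiderivFrom, Timed.val_bind, Timed.val_pure, lookFrom]
    rw [List.map_cons, List.pairwise_cons] at hs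
    set Q := (Poly.add [(Poly.eval z P).val - (Poly.eval z (Poly.antideriv q).val).val]
      (Poly.antideriv q).val).val with hQ
    have hc := ih Q hs.2
    have hz : lookFrom z Q (antiderivFrom Q s).val = Q := by
      refine lookFrom_of_lt fun _ ha => hs.1 _ ?_
      rw [← bpts_antiderivFrom Q s]
      exact List.mem_map_of_mem ha
    have hzz : P.ev z = Q.ev z := by simp [hQ, Poly.val_eval]
    have := Continuous.if_le hc (Poly.continuous_ev P) continuous_const continuous_id
      (fun x hx => by
        obtain rfl : z = x := hx
        rw [hz, hzz])
    refine this.congr fun x => ?_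
    by_cases h : x < z
    · simp [h]
    · simp [h, not_lt.1 h]

theorem continuous_ev_antideriv {f : PW ℝ} (hf : f.Sorted) :
    Continuous (antideriv f).val.ev := continuous_antiderivFrom _ _ hf

/-- Each piece of the antiderivative has the corresponding piece of `f` as its derivative on the
whole line, not only on its own interval. -/
theorem hasDerivAt_look_antideriv (f : PW ℝ) (x y : ℝ) :
    HasDerivAt ((antideriv f).val.look x).ev ((f.look x).ev y) y :=
  hasDerivAt_lookFrom_antiderivFrom _ _ _ (Poly.hasDerivAt_antideriv _) x y

theorem lookFrom_congr {x y : ℝ} (p : Poly ℝ) (s : List (ℝ × Poly ℝ))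
    (h : ∀ a ∈ s, a.1 ≤ x ↔ a.1 ≤ y) : lookFrom x p s = lookFrom y p s := by
  induction s generalizing p with
  | nil => rfl
  | cons a s ih =>
    have h₁ := h a (by simp)
    simp only [← not_lt] at h₁
    simp only [lookFrom, ih a.2 fun b hb => h b (by simp [hb]), not_iff_not.1 h₁]

theorem look_congr (f : PW ℝ) {x y : ℝ} (h : ∀ b ∈ f.bpts, b ≤ x ↔ b ≤ y) :
    f.look x = f.look y :=
  lookFrom_congr _ _ fun _ ha => h _ (List.mem_map_of_mem ha)

theorem eventually_look_eq (f : PW ℝ) {x : ℝ} (hx : x ∉ f.bpts) :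
    ∀ᶠ y in nhds x, f.look y = f.look x := by
  have : ∀ᶠ y in nhds x, ∀ b ∈ f.bpts.toFinset, b ≤ y ↔ b ≤ x := by
    rw [Filter.eventually_all_finset]
    intro b hb
    rcases lt_or_gt_of_ne (fun h : b = x => hx (by simpa [← h] using hb)) with h | h
    · filter_upwards [lt_mem_nhds h] with y hy
      simp [h.le, hy.le]
    · filter_upwards [gt_mem_nhds h] with y hy
      exact iff_of_false (not_le.2 hy) (not_le.2 h)
  filter_upwards [this] with y hy
  exact look_congr f (by simpa using hy)

theorem hasDerivAt_ev_antideriv (f : PW ℝ) {x : ℝ} (hx : x ∉ f.bpts) :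
    HasDerivAt (antideriv f).val.ev (f.ev x) x := by
  refine (hasDerivAt_look_antideriv f x x).congr_of_eventuallyEq ?_
  filter_upwards [eventually_look_eq (antideriv f).val (by rwa [bpts_antideriv])] with y hy
  simp [ev, hy]

theorem integrableOn_lookFrom (p : Poly ℝ) (s : List (ℝ × Poly ℝ)) (a b : ℝ) :
    IntegrableOn (fun x => (lookFrom x p s).ev x) (Set.Icc a b) := by
  induction s generalizing p with
  | nil => exact (Poly.continuous_ev p).integrableOn_Icc
  | cons z s ih =>
    have := Integrable.piecewise (μ := volume.restrict (Set.Icc a b)) (measurableSet_Iio (a := z.1))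
      (f := p.ev) (g := fun x => (lookFrom x z.2 s).ev x)
      (Integrable.integrableOn (Poly.continuous_ev p).integrableOn_Icc)
      (Integrable.integrableOn (ih z.2))
    refine this.congr ?_
    filter_upwards with x
    by_cases h : x < z.1 <;> simp [lookFrom, Set.piecewise, h]

theorem intervalIntegrable_ev (f : PW ℝ) (a b : ℝ) : IntervalIntegrable f.ev volume a b :=
  (integrableOn_lookFrom _ _ _ _).intervalIntegrable

theorem antiderivFrom_cost {d : ℕ} (P : Poly ℝ) (s : List (ℝ × Poly ℝ)) (hP : P.length ≤ d + 1)
    (hs : ∀ a ∈ s, a.2.length ≤ d) :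
    (∀ a ∈ (antiderivFrom P s).val, a.2.length ≤ d + 1) ∧
      (antiderivFrom P s).steps ≤ s.length * (4 * d + 10) + 1 := by
  induction s generalizing P with
  | nil => simp [antiderivFrom]
  | cons a s ih =>
    obtain ⟨z, q⟩ := a
    simp only [List.forall_mem_cons] at hs
    set Q := (Poly.add [(Poly.eval z P).val - (Poly.eval z (Poly.antideriv q).val).val]
      (Poly.antideriv q).val) with hQ
    have hQl : Q.val.length ≤ d + 1 := by
      rw [hQ, Poly.length_add, Poly.length_antideriv]
      simp
      omega
    have hQs : Q.steps ≤ 2 := (Poly.steps_add_le _ _).1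
    obtain ⟨h₁, h₂⟩ := ih Q.val hQl hs.2
    simp only [antiderivFrom, Timed.val_bind, Timed.val_pure, Timed.steps_bind, steps_tick,
      Timed.steps_pure, List.forall_mem_cons, List.length_cons, Poly.steps_antideriv,
      Poly.steps_eval, Poly.length_antideriv, ← hQ]
    rw [add_mul]
    exact ⟨⟨hQl, h₁⟩, by omega⟩

theorem antideriv_cost {d : ℕ} {f : PW ℝ} (hf : f.CoeffsLe d) :
    (antideriv f).val.CoeffsLe (d + 1) ∧
      (antideriv f).steps ≤ (f.bpts.length + 1) * (4 * d + 10) := by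
  have h : (Poly.antideriv f.first).val.length ≤ d + 1 := by
    rw [Poly.length_antideriv]
    exact Nat.succ_le_succ hf.1
  obtain ⟨h₁, h₂⟩ := antiderivFrom_cost _ f.rest h hf.2
  refine ⟨⟨h, h₁⟩, ?_⟩
  have := hf.1
  simp only [antideriv, Timed.steps_bind, steps_tick, Timed.steps_pure, Poly.steps_antideriv,
    length_bpts, add_mul]
  omega

/-! ### Limits and values of piecewise polynomials -/

theorem val_lastFrom (p : Poly ℝ) (s : List (ℝ × Poly ℝ)) (x : ℝ) (hx : ∀ a ∈ s, a.1 ≤ x) :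
    (lastFrom p s).val = lookFrom x p s := by
  induction s generalizing p with
  | nil => rfl
  | cons a s ih =>
    simp only [List.forall_mem_cons] at hx
    simp [lastFrom, lookFrom, ih a.2 hx.2, not_lt.2 hx.1]

theorem val_atTop (f : PW ℝ) {x : ℝ} (hx : ∀ b ∈ f.bpts, b ≤ x) :
    (atTop f).val = (f.look x).headD 0 := by
  simp only [atTop, Timed.val_bind, Timed.val_pure, look]
  rw [val_lastFrom _ _ x fun a ha => hx _ (List.mem_map_of_mem ha)]

theorem val_atBot (f : PW ℝ) {x : ℝ} (hx : ∀ b ∈ f.bpts, x < b) :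
    (atBot f).val = (f.look x).headD 0 := by
  simp only [atBot, Timed.val_bind, Timed.val_pure, look]
  rw [lookFrom_of_lt fun a ha => hx _ (List.mem_map_of_mem ha)]

theorem steps_atBot (f : PW ℝ) : (atBot f).steps = 1 := rfl

theorem steps_atTop (f : PW ℝ) : (atTop f).steps = f.bpts.length + 2 := by
  have (p : Poly ℝ) (s : List (ℝ × Poly ℝ)) : (lastFrom p s).steps = s.length + 1 := by
    induction s generalizing p with
    | nil => rfl
    | cons a s ih => simp [lastFrom, ih]; omega
  simp [atTop, this, length_bpts]

theorem val_evalFrom (x : ℝ) (p : Poly ℝ) (s : List (ℝ × Poly ℝ)) :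
    (evalFrom x p s).val = (lookFrom x p s).ev x := by
  induction s generalizing p with
  | nil => simp [evalFrom, lookFrom, Poly.val_eval]
  | cons a s ih =>
    simp only [evalFrom, lookFrom, Timed.val_bind, Timed.val_ite, ih, Poly.val_eval]
    split_ifs <;> rfl

theorem val_eval (x : ℝ) (f : PW ℝ) : (eval x f).val = f.ev x := val_evalFrom _ _ _

theorem steps_eval_le {d : ℕ} {f : PW ℝ} (hf : f.CoeffsLe d) (x : ℝ) :
    (eval x f).steps ≤ f.bpts.length + d + 2 := by
  have (p : Poly ℝ) (s : List (ℝ × Poly ℝ)) (hp : p.length ≤ d) (hs : ∀ a ∈ s, a.2.length ≤ d) :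
      (evalFrom x p s).steps ≤ s.length + d + 2 := by
    induction s generalizing p with
    | nil => simp [evalFrom, Poly.steps_eval]; omega
    | cons a s ih =>
      simp only [List.forall_mem_cons] at hs
      have := ih a.2 hs.1 hs.2
      simp only [evalFrom, Timed.steps_bind, Timed.steps_ite, steps_tick, Poly.steps_eval,
        List.length_cons]
      split_ifs <;> omega
  rw [length_bpts]
  exact this _ _ hf.1 hf.2

/-! ### Substitution of a line in a piecewise polynomial -/

theorem bpts_reflect (s c : ℝ) (p : Poly ℝ) (acc l : List (ℝ × Poly ℝ)) :
    (reflect s c p acc l).val.bpts =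
      (l.map fun a => (a.1 - c) / s).reverse ++ acc.map Prod.fst := by
  induction l generalizing p acc with
  | nil => simp [reflect, bpts]
  | cons a l ih => simp [reflect, ih]

/-- The pieces in `acc` have been reflected before, and lie to the right of the images of those in
`l`. The images of breakpoints are excluded, since a breakpoint belongs to the piece on its right,
and this side changes under a reflection. -/
theorem look_reflect {s c : ℝ} (hs : s < 0) (p : Poly ℝ) (acc l : List (ℝ × Poly ℝ))
    (hl : (l.map Prod.fst).Pairwise (· < ·))
    (hacc : ∀ a ∈ acc, ∀ b ∈ l, (b.1 - c) / s < a.1) {x : ℝ}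
    (hx : ∀ b ∈ l, x ≠ (b.1 - c) / s) :
    (reflect s c p acc l).val.look x =
      lookFrom x (Poly.comp s c (lookFrom (s * x + c) p l)).val acc := by
  induction l generalizing p acc with
  | nil => simp [reflect, look, lookFrom]
  | cons b l ih =>
    obtain ⟨z, q⟩ := b
    rw [List.map_cons, List.pairwise_cons] at hl
    simp only [List.forall_mem_cons] at hx
    have hiff : ∀ w, w < (z - c) / s ↔ z < s * w + c := fun w => by
      rw [lt_div_iff_of_neg hs]
      constructor <;> intro h <;> linarith
    simp only [reflect, Timed.val_bind]
    rw [ih _ _ hl.2 ?_ hx.2]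
    · simp only [lookFrom]
      rcases lt_or_gt_of_ne hx.1 with h | h
      · rw [if_pos h, if_neg (not_lt.2 ((hiff x).1 h).le)]
        exact (lookFrom_of_lt fun a ha => h.trans (hacc a ha (z, q) (by simp))).symm
      · have h' : s * x + c < z := by
          rw [div_lt_iff_of_neg hs] at h
          linarith
        rw [if_neg (not_lt.2 h.le), if_pos h']
    · simp only [List.forall_mem_cons]
      refine ⟨fun b hb => ?_, fun a ha b hb => hacc a ha b (by simp [hb])⟩
      have := hl.1 b.1 (List.mem_map_of_mem hb)
      exact (div_lt_div_right_of_neg hs).2 (by linarith)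

theorem bpts_comp_of_pos {s c : ℝ} (hs : 0 < s) (f : PW ℝ) :
    (comp s c f).val.bpts = f.bpts.map fun b => (b - c) / s := by
  simp [comp, hs, bpts, Function.comp_def]

theorem bpts_comp_of_neg {s c : ℝ} (hs : s < 0) (f : PW ℝ) :
    (comp s c f).val.bpts = (f.bpts.map fun b => (b - c) / s).reverse := by
  have := bpts_reflect s c f.first [] f.rest
  simpa [comp, hs, not_lt.2 hs.le, bpts, Function.comp_def] using this

theorem bpts_comp_zero (c : ℝ) (f : PW ℝ) : (comp 0 c f).val.bpts = [] := by
  simp [comp, bpts]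

theorem length_bpts_comp_le (s c : ℝ) (f : PW ℝ) :
    (comp s c f).val.bpts.length ≤ f.bpts.length := by
  rcases lt_trichotomy s 0 with hs | rfl | hs
  · simp [bpts_comp_of_neg hs]
  · simp [bpts_comp_zero]
  · simp [bpts_comp_of_pos hs]

theorem sorted_comp (s c : ℝ) {f : PW ℝ} (hf : f.Sorted) : (comp s c f).val.Sorted := by
  rcases lt_trichotomy s 0 with hs | rfl | hs
  · rw [Sorted, bpts_comp_of_neg hs, List.pairwise_reverse, List.pairwise_map]
    exact hf.imp fun h => (div_lt_div_right_of_neg hs).2 (by linarith)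
  · simp [Sorted, bpts_comp_zero]
  · rw [Sorted, bpts_comp_of_pos hs, List.pairwise_map]
    exact hf.imp fun h => (div_lt_div_iff_of_pos_right hs).2 (by linarith)

/-- The breakpoints of the result are excluded: a breakpoint belongs to the piece on its right, and
this side changes under a reflection. -/
theorem ev_comp {s c : ℝ} {f : PW ℝ} (hf : f.Sorted) {x : ℝ} (hx : x ∉ (comp s c f).val.bpts) :
    (comp s c f).val.ev x = f.ev (s * x + c) := by
  rcases lt_trichotomy s 0 with hs | rfl | hs
  · rw [bpts_comp_of_neg hs] at hx
    simp only [ev, comp, hs, not_lt.2 hs.le, if_true, if_false, Timed.val_bind]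
    rw [look_reflect hs _ _ _ hf (by simp)]
    · simp [lookFrom, look]
    · rintro b hb rfl
      refine hx ?_
      rw [List.mem_reverse]
      exact List.mem_map.2 ⟨b.1, List.mem_map_of_mem hb, rfl⟩
  · simp [comp, ev, look, lookFrom, val_eval]
  · have (p : Poly ℝ) (l : List (ℝ × Poly ℝ)) :
        lookFrom x (Poly.comp s c p).val
          (l.map fun a => ((a.1 - c) / s, (Poly.comp s c a.2).val)) =
        (Poly.comp s c (lookFrom (s * x + c) p l)).val := by
      induction l generalizing p with
      | nil => rfl
      | cons a l ih =>
        have : x < (a.1 - c) / s ↔ s * x + c < a.1 := by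
          rw [lt_div_iff₀ hs]
          constructor <;> intro h <;> linarith
        simp only [List.map_cons, lookFrom, ih, this]
        split_ifs <;> rfl
    simp only [ev, look, comp, hs, if_true, Timed.val_bind, Timed.val_pure, val_mapT, this,
      Poly.ev_comp]

theorem reflect_cost {d : ℕ} (s c : ℝ) (p : Poly ℝ) (acc l : List (ℝ × Poly ℝ))
    (hp : p.length ≤ d) (hacc : ∀ a ∈ acc, a.2.length ≤ d) (hl : ∀ a ∈ l, a.2.length ≤ d) :
    (reflect s c p acc l).val.CoeffsLe d ∧
      (reflect s c p acc l).steps ≤ (l.length + 1) * (d * (6 * d + 12) + 2) := by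
  have hc : ∀ p : Poly ℝ, p.length ≤ d → (Poly.comp s c p).val.length ≤ d ∧
      (Poly.comp s c p).steps ≤ d * (6 * d + 12) + 1 := fun p hp =>
    ⟨(Poly.length_comp s c p).trans hp, (Poly.steps_comp_le s c p).trans (by gcongr)⟩
  induction l generalizing p acc with
  | nil =>
    refine ⟨⟨(hc p hp).1, hacc⟩, ?_⟩
    have := (hc p hp).2
    simp only [reflect, Timed.steps_bind, steps_tick, Timed.steps_pure, List.length_nil]
    omega
  | cons a l ih =>
    obtain ⟨z, q⟩ := a
    simp only [List.forall_mem_cons] at hl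
    obtain ⟨h₁, h₂⟩ := ih q (((z - c) / s, (Poly.comp s c p).val) :: acc) hl.1
      (by simpa using ⟨(hc p hp).1, fun a b hb => hacc (a, b) hb⟩) hl.2
    refine ⟨h₁, ?_⟩
    have := (hc p hp).2
    simp only [reflect, Timed.steps_bind, steps_tick, List.length_cons]
    rw [add_mul (l.length + 1)]
    omega

theorem comp_cost {d : ℕ} (s c : ℝ) {f : PW ℝ} (hf : f.CoeffsLe d) (hd : 1 ≤ d) :
    (comp s c f).val.CoeffsLe d ∧
      (comp s c f).steps ≤ (f.bpts.length + 1) * (d * (6 * d + 12) + 5) := by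
  have hc : ∀ p : Poly ℝ, p.length ≤ d → (Poly.comp s c p).val.length ≤ d ∧
      (Poly.comp s c p).steps ≤ d * (6 * d + 12) + 1 := fun p hp =>
    ⟨(Poly.length_comp s c p).trans hp, (Poly.steps_comp_le s c p).trans (by gcongr)⟩
  rcases lt_trichotomy s 0 with hs | rfl | hs
  · obtain ⟨h₁, h₂⟩ := reflect_cost s c f.first [] f.rest hf.1 (by simp) hf.2
    simp only [comp, hs, not_lt.2 hs.le, if_true, if_false, Timed.val_bind, Timed.steps_bind,
      steps_tick, length_bpts]
    refine ⟨h₁, ?_⟩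
    simp only [add_mul, mul_add] at h₂ ⊢
    omega
  · simp only [comp, lt_irrefl, if_false, Timed.val_bind, Timed.steps_bind, Timed.val_pure,
      Timed.steps_pure, steps_tick]
    refine ⟨⟨by simpa using hd, by simp⟩, ?_⟩
    have := steps_eval_le hf c
    have : d * 12 ≤ d * (6 * d + 12) := by gcongr; omega
    have : f.bpts.length * 1 ≤ f.bpts.length * (d * (6 * d + 12) + 5) := by gcongr; omega
    rw [add_mul]
    omega
  · simp only [comp, hs, if_true, Timed.val_bind, Timed.steps_bind, Timed.val_pure,
      Timed.steps_pure, steps_tick]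
    refine ⟨⟨(hc _ hf.1).1, ?_⟩, ?_⟩
    · simp only [val_mapT, Timed.val_bind, Timed.val_pure, List.mem_map]
      rintro _ ⟨a, ha, rfl⟩
      exact (hc _ (hf.2 a ha)).1
    · have h₁ := steps_mapT_le (fun a : ℝ × Poly ℝ => do
          tick
          let q ← Poly.comp s c a.2
          return ((a.1 - c) / s, q)) f.rest (d * (6 * d + 12) + 2) (fun a ha => by
        have := (hc _ (hf.2 a ha)).2
        simp only [Timed.steps_bind, steps_tick, Timed.steps_pure]
        omega)
      have h₂ := (hc _ hf.1).2
      simp only [length_bpts, add_mul, mul_add] at h₁ h₂ ⊢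
      omega

/-! ### Piecewise polynomials from samples -/

section Samples

variable (g : ℝ → Timed (Poly ℝ))

theorem bpts_samplesFrom (x : ℝ) (l : List ℝ) :
    (samplesFrom g x l).val.map Prod.fst = x :: l := by
  induction l generalizing x with
  | nil => rfl
  | cons y l ih => simp [samplesFrom, ih]

theorem bpts_fromSamples (l : List ℝ) : (fromSamples g l).val.bpts = l := by
  cases l with
  | nil => rfl
  | cons x l => exact bpts_samplesFrom g x l

theorem lookFrom_samplesFrom (x : ℝ) (l : List ℝ) (hl : (x :: l).Pairwise (· < ·)) (p : Poly ℝ)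
    (z : ℝ) (hz : x ≤ z) :
    ∃ u, x < u ∧ u ∉ l ∧ (∀ b ∈ l, b ≤ z ↔ b ≤ u) ∧
      lookFrom z p (samplesFrom g x l).val = (g u).val := by
  induction l generalizing x p with
  | nil => exact ⟨x + 1, by simp, by simp, by simp, by simp [samplesFrom, lookFrom, not_lt.2 hz]⟩
  | cons y l ih =>
    rw [List.pairwise_cons] at hl
    obtain ⟨h₁, h₂⟩ := hl
    have hxy := h₁ y (by simp)
    have hyl := (List.pairwise_cons.1 h₂).1
    simp only [samplesFrom, Timed.val_bind, Timed.val_pure, lookFrom, if_neg (not_lt.2 hz)]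
    rcases lt_or_ge z y with hzy | hzy
    · refine ⟨(x + y) / 2, by linarith, ?_, ?_, ?_⟩
      · rw [List.mem_cons, not_or]
        exact ⟨by linarith, fun h => by linarith [hyl _ h]⟩
      · rw [List.forall_mem_cons]
        refine ⟨⟨fun h => by linarith, fun h => by linarith⟩, fun b hb => ?_⟩
        have := hyl b hb
        exact ⟨fun h => by linarith, fun h => by linarith⟩
      · refine lookFrom_of_lt fun a ha => ?_
        have : a.1 ∈ y :: l := by
          rw [← bpts_samplesFrom g y l]
          exact List.mem_map_of_mem ha
        rcases List.mem_cons.1 this with h | h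
        · rwa [h]
        · exact hzy.trans (hyl _ h)
    · obtain ⟨u, hu₁, hu₂, hu₃, hu₄⟩ := ih y h₂ (g ((x + y) / 2)).val hzy
      refine ⟨u, hxy.trans hu₁, ?_, ?_, hu₄⟩
      · rw [List.mem_cons, not_or]
        exact ⟨hu₁.ne', hu₂⟩
      · rw [List.forall_mem_cons]
        exact ⟨⟨fun _ => hu₁.le, fun _ => hzy⟩, hu₃⟩

/-- On each interval, `fromSamples` returns the polynomial of some point of the interior of the same
interval. -/
theorem look_fromSamples (l : List ℝ) (hl : l.Pairwise (· < ·)) (z : ℝ) :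
    ∃ u, u ∉ l ∧ (∀ b ∈ l, b ≤ z ↔ b ≤ u) ∧ (fromSamples g l).val.look z = (g u).val := by
  cases l with
  | nil => exact ⟨0, by simp, by simp, rfl⟩
  | cons x l =>
    have hxl := (List.pairwise_cons.1 hl).1
    rcases lt_or_ge z x with hzx | hzx
    · refine ⟨x - 1, ?_, ?_, ?_⟩
      · rw [List.mem_cons, not_or]
        exact ⟨by linarith, fun h => by linarith [hxl _ h]⟩
      · rw [List.forall_mem_cons]
        refine ⟨⟨fun h => by linarith, fun h => by linarith⟩, fun b hb => ?_⟩
        have := hxl b hb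
        exact ⟨fun h => by linarith, fun h => by linarith⟩
      · refine lookFrom_of_lt fun a ha => ?_
        have : a.1 ∈ x :: l := by
          rw [← bpts_samplesFrom g x l]
          exact List.mem_map_of_mem ha
        rcases List.mem_cons.1 this with h | h
        · rwa [h]
        · exact hzx.trans (hxl _ h)
    · obtain ⟨u, hu₁, hu₂, hu₃, hu₄⟩ := lookFrom_samplesFrom g x l hl (g (x - 1)).val z hzx
      refine ⟨u, ?_, ?_, hu₄⟩
      · rw [List.mem_cons, not_or]
        exact ⟨hu₁.ne', hu₂⟩
      · rw [List.forall_mem_cons]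
        exact ⟨⟨fun _ => hu₁.le, fun _ => hzx⟩, hu₃⟩

theorem fromSamples_cost {d c : ℕ} (l : List ℝ)
    (hg : ∀ u, (g u).val.length ≤ d ∧ (g u).steps ≤ c) :
    (fromSamples g l).val.CoeffsLe d ∧ (fromSamples g l).steps ≤ (l.length + 1) * (c + 1) := by
  have key (x : ℝ) (l : List ℝ) : (∀ a ∈ (samplesFrom g x l).val, a.2.length ≤ d) ∧
      (samplesFrom g x l).steps ≤ (l.length + 1) * (c + 1) := by
    induction l generalizing x with
    | nil =>
      simp only [samplesFrom, Timed.val_bind, Timed.steps_bind, Timed.val_pure, Timed.steps_pure,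
        steps_tick, List.mem_singleton, forall_eq, List.length_nil]
      have := hg (x + 1)
      exact ⟨this.1, by omega⟩
    | cons y l ih =>
      have h₁ := ih y
      have h₂ := hg ((x + y) / 2)
      simp only [samplesFrom, Timed.val_bind, Timed.steps_bind, Timed.val_pure, Timed.steps_pure,
        steps_tick, List.forall_mem_cons, List.length_cons, add_mul] at h₁ ⊢
      exact ⟨⟨h₂.1, h₁.1⟩, by omega⟩
  cases l with
  | nil =>
    have := hg 0
    simp only [fromSamples, Timed.val_bind, Timed.steps_bind, Timed.val_pure, Timed.steps_pure,
      steps_tick, List.length_nil]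
    exact ⟨⟨this.1, by simp⟩, by omega⟩
  | cons x l =>
    have h₁ := key x l
    have h₂ := hg (x - 1)
    simp only [fromSamples, Timed.val_bind, Timed.steps_bind, Timed.val_pure, Timed.steps_pure,
      steps_tick, List.length_cons, add_mul] at h₁ ⊢
    exact ⟨⟨h₂.1, h₁.1⟩, by omega⟩

end Samples

end PW

/-! ### Inspecting the formula -/

/-- Below all breakpoints and strictly between consecutive ones, `u` and `v` are on the same piece
of the line: neither is in `P`, and both have the same elements of `P` to their left. -/
def SamePiece (P : List ℝ) (u v : ℝ) : Prop := u ∉ P ∧ v ∉ P ∧ ∀ b ∈ P, b ≤ u ↔ b ≤ v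

theorem SamePiece.lt_iff {P : List ℝ} {u v b : ℝ} (h : SamePiece P u v) (hb : b ∈ P) :
    (b < u ↔ b < v) ∧ (u < b ↔ v < b) := by
  obtain ⟨h₁, h₂, h₃⟩ := h
  have hu : b ≠ u := fun h => h₁ (h ▸ hb)
  have hv : b ≠ v := fun h => h₂ (h ▸ hb)
  refine ⟨?_, ?_⟩
  · rw [lt_iff_le_and_ne, lt_iff_le_and_ne, h₃ b hb]
    simp [hu, hv]
  · rw [← not_le, ← not_le, h₃ b hb]

section Points

theorem mem_insertPoint (x z : ℝ) (P : List ℝ) : z ∈ (insertPoint x P).val ↔ z = x ∨ z ∈ P := by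
  induction P with
  | nil => simp [insertPoint]
  | cons y P ih =>
    simp only [insertPoint, Timed.val_bind, Timed.val_ite, Timed.val_pure]
    split_ifs with h₁ h₂
    · simp
    · simp only [List.mem_cons, ih]
      tauto
    · obtain rfl : x = y := le_antisymm (not_lt.1 h₂) (not_lt.1 h₁)
      simp

theorem pairwise_insertPoint (x : ℝ) (P : List ℝ) (hP : P.Pairwise (· < ·)) :
    (insertPoint x P).val.Pairwise (· < ·) := by
  induction P with
  | nil => simp [insertPoint]
  | cons y P ih =>
    simp only [insertPoint, Timed.val_bind, Timed.val_ite, Timed.val_pure]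
    have hP' := List.pairwise_cons.1 hP
    split_ifs with h₁ h₂
    · rw [List.pairwise_cons, List.forall_mem_cons]
      exact ⟨⟨h₁, fun z hz => h₁.trans (hP'.1 z hz)⟩, hP⟩
    · rw [List.pairwise_cons]
      refine ⟨fun z hz => ?_, ih hP'.2⟩
      rcases (mem_insertPoint x z P).1 hz with rfl | hz
      · exact h₂
      · exact hP'.1 z hz
    · exact hP

theorem length_insertPoint_le (x : ℝ) (P : List ℝ) :
    (insertPoint x P).val.length ≤ P.length + 1 := by
  induction P with
  | nil => simp [insertPoint]
  | cons y P ih =>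
    simp only [insertPoint, Timed.val_bind, Timed.val_ite, Timed.val_pure]
    split_ifs <;> simp [ih]

theorem steps_insertPoint_le (x : ℝ) (P : List ℝ) : (insertPoint x P).steps ≤ P.length + 1 := by
  induction P with
  | nil => simp [insertPoint]
  | cons y P ih =>
    simp only [insertPoint, Timed.steps_bind, Timed.steps_ite, Timed.steps_pure, steps_tick,
      List.length_cons]
    split_ifs <;> omega

end Points

section CNF

variable {n : ℕ}

theorem numLiterals_cons {K : Type} (Γ : Clause n K) (Δ : CNF n K) :
    numLiterals (Γ :: Δ) = Γ.length + numLiterals Δ := by simp [numLiterals]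

theorem length_le_numLiterals {Δ : CNF n ℝ} (hΔ : ∀ Γ ∈ Δ, Γ ≠ []) :
    Δ.length ≤ numLiterals Δ := by
  induction Δ with
  | nil => simp
  | cons Γ Δ ih =>
    rw [List.forall_mem_cons] at hΔ
    have h₁ := ih hΔ.2
    have h₂ := List.length_pos_of_ne_nil hΔ.1
    rw [numLiterals_cons, List.length_cons]
    omega

theorem length_clause_le {Δ : CNF n ℝ} {Γ : Clause n ℝ} (h : Γ ∈ Δ) :
    Γ.length ≤ numLiterals Δ := by
  induction Δ with
  | nil => simp at h
  | cons Γ' Δ ih =>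
    rw [numLiterals_cons]
    rcases List.mem_cons.1 h with rfl | h
    · omega
    · have := ih h
      omega

theorem sum_map_clause_le {Δ : CNF n ℝ} (hΔ : ∀ Γ ∈ Δ, Γ ≠ []) (g : Clause n ℝ → ℕ) (a b : ℕ)
    (hg : ∀ Γ ∈ Δ, g Γ ≤ a * Γ.length + b) :
    (Δ.map g).sum ≤ (a + b) * numLiterals Δ := by
  induction Δ with
  | nil => simp
  | cons Γ Δ ih =>
    rw [List.forall_mem_cons] at hΔ hg
    have h₁ := ih hΔ.2 hg.2
    have h₂ : b * 1 ≤ b * Γ.length :=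
      Nat.mul_le_mul_left b (List.length_pos_of_ne_nil hΔ.1)
    have h₃ := hg.1
    rw [numLiterals_cons, List.map_cons, List.sum_cons, mul_add, add_mul a b Γ.length]
    omega

/-- Disjoint parts of a formula have together at most as many literals as the formula. -/
theorem sum_numLiterals_filter_le (Q : List (Clause n ℝ → Bool)) (Δ : CNF n ℝ)
    (hQ : Q.Pairwise fun p q => ∀ Γ ∈ Δ, p Γ = true → q Γ = false) :
    (Q.map fun q => numLiterals (Δ.filter q)).sum ≤ numLiterals Δ := by
  induction Q generalizing Δ with
  | nil => simp
  | cons p Q ih =>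
    rw [List.pairwise_cons] at hQ
    have h₁ : numLiterals (Δ.filter p) + numLiterals (Δ.filter fun Γ => !p Γ) =
        numLiterals Δ := by
      clear ih hQ
      induction Δ with
      | nil => rfl
      | cons Γ Δ ih =>
        cases h : p Γ <;> simp [h, numLiterals_cons] <;> omega
    have h₂ := ih (Δ.filter fun Γ => !p Γ)
      (hQ.2.imp fun h Γ hΓ => h Γ (List.mem_filter.1 hΓ).1)
    have h₃ : (Q.map fun q => numLiterals ((Δ.filter fun Γ => !p Γ).filter q)) =
        Q.map fun q => numLiterals (Δ.filter q) := by
      refine List.map_congr_left fun q hq => ?_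
      rw [List.filter_filter]
      congr 1
      refine List.filter_congr fun Γ hΓ => ?_
      have := hQ.1 q hq Γ hΓ
      revert this
      cases p Γ <;> cases q Γ <;> simp
    rw [h₃] at h₂
    simp only [List.map_cons, List.sum_cons]
    omega

theorem appearsT_eq_true (i : Fin n) (Γ : Clause n ℝ) :
    (appearsT i Γ).val = true ↔ Appears i Γ := by simp [appearsT, Appears]

theorem steps_appearsT_le (i : Fin n) (Γ : Clause n ℝ) :
    (appearsT i Γ).steps ≤ 2 * Γ.length + 1 := by
  have := steps_anyT_le_of_le (fun ℓ : Literal n ℝ => do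
    tick
    return decide (ℓ.coeff i ≠ 0)) Γ 1 (by simp)
  rw [appearsT]
  omega

theorem mem_neighbours (Δ : CNF n ℝ) (i j : Fin n) :
    j ∈ (neighbours Δ i).val ↔ (primalGraph Δ).Adj i j := by
  simp only [neighbours, primalGraph, val_filterT, List.mem_filter, List.mem_finRange, true_and,
    Timed.val_bind, Timed.val_ite, Timed.val_pure, val_anyT, ne_eq]
  split_ifs with h
  · simp [h]
  · simp [appearsT_eq_true, Ne.symm h]

theorem nodup_neighbours (Δ : CNF n ℝ) (i : Fin n) : (neighbours Δ i).val.Nodup := by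
  rw [neighbours, val_filterT]
  exact (List.nodup_finRange n).filter _

theorem length_neighbours_le (Δ : CNF n ℝ) (i : Fin n) : (neighbours Δ i).val.length ≤ n := by
  simpa using (nodup_neighbours Δ i).length_le_card

theorem steps_neighbours_le {Δ : CNF n ℝ} (hΔ : ∀ Γ ∈ Δ, Γ ≠ []) (i : Fin n) :
    (neighbours Δ i).steps ≤ n * (7 * numLiterals Δ + 3) + 1 := by
  have h : ∀ j : Fin n, (anyT (fun Γ => do
      let a ← appearsT i Γ
      let b ← appearsT j Γ
      return a && b) Δ).steps ≤ 7 * numLiterals Δ + 1 := fun j => by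
    refine (steps_anyT_le _ _).trans (Nat.succ_le_succ ?_)
    refine sum_map_clause_le hΔ _ 4 3 fun Γ _ => ?_
    have h₁ := steps_appearsT_le i Γ
    have h₂ := steps_appearsT_le j Γ
    simp only [Timed.steps_bind, Timed.steps_pure]
    omega
  have := steps_filterT_le (fun j : Fin n => do
    tick
    if j = i then
      return false
    else
      anyT (fun Γ => do
        let a ← appearsT i Γ
        let b ← appearsT j Γ
        return a && b) Δ) (List.finRange n) (7 * numLiterals Δ + 2) fun j _ => by
      have := h j
      simp only [Timed.steps_bind, Timed.steps_ite, Timed.steps_pure, steps_tick] at this ⊢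
      split_ifs <;> omega
  rwa [List.length_finRange] at this

open Classical in
theorem val_nodeFormula (Δ : CNF n ℝ) (i : Fin n) :
    (nodeFormula Δ i).val = Δ.filter fun Γ => decide (∀ k, k ≠ i → ¬ Appears k Γ) := by
  rw [nodeFormula, val_filterT]
  refine List.filter_congr fun Γ _ => ?_
  rw [Bool.eq_iff_iff, val_allT, List.all_eq_true, decide_eq_true_iff]
  simp only [List.mem_finRange, true_implies]
  refine forall_congr' fun k => ?_
  by_cases hk : k = i <;> simp [hk, ← appearsT_eq_true]

open Classical in
theorem val_edgeFormula (Δ : CNF n ℝ) (i j : Fin n) :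
    (edgeFormula Δ i j).val = Δ.filter fun Γ => decide (Appears i Γ ∧ Appears j Γ) := by
  rw [edgeFormula, val_filterT]
  refine List.filter_congr fun Γ _ => ?_
  rw [Bool.eq_iff_iff]
  simp [← appearsT_eq_true]

theorem mem_nodeFormula {Δ : CNF n ℝ} {i : Fin n} {Γ : Clause n ℝ} :
    Γ ∈ (nodeFormula Δ i).val ↔ Γ ∈ Δ ∧ ∀ k, k ≠ i → ¬ Appears k Γ := by
  simp [val_nodeFormula]

theorem mem_edgeFormula {Δ : CNF n ℝ} {i j : Fin n} {Γ : Clause n ℝ} :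
    Γ ∈ (edgeFormula Δ i j).val ↔ Γ ∈ Δ ∧ Appears i Γ ∧ Appears j Γ := by
  simp [val_edgeFormula]

theorem edgeFormula_comm (Δ : CNF n ℝ) (i j : Fin n) :
    (edgeFormula Δ i j).val = (edgeFormula Δ j i).val := by
  rw [val_edgeFormula, val_edgeFormula]
  exact List.filter_congr fun Γ _ => by rw [decide_eq_decide, and_comm]

theorem steps_nodeFormula_le {Δ : CNF n ℝ} (hΔ : ∀ Γ ∈ Δ, Γ ≠ []) (i : Fin n) :
    (nodeFormula Δ i).steps ≤ (5 * n + 2) * numLiterals Δ + 1 := by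
  refine (steps_filterT _ _).le.trans (Nat.succ_le_succ ?_)
  refine (sum_map_clause_le hΔ _ (2 * n) (3 * n + 2) fun Γ _ => ?_).trans_eq (by ring)
  have h := steps_allT_le_of_le (fun k : Fin n => do
    tick
    if k = i then
      return true
    else
      let a ← appearsT k Γ
      return !a) (List.finRange n) (2 * Γ.length + 2) fun k _ => by
    have := steps_appearsT_le k Γ
    simp only [Timed.steps_bind, Timed.steps_ite, Timed.steps_pure, steps_tick]
    split_ifs <;> omega
  rw [List.length_finRange] at h
  calc _ ≤ n * (2 * Γ.length + 2 + 1) + 1 + 1 := Nat.succ_le_succ h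
    _ = 2 * n * Γ.length + (3 * n + 2) := by ring

theorem steps_edgeFormula_le {Δ : CNF n ℝ} (hΔ : ∀ Γ ∈ Δ, Γ ≠ []) (i j : Fin n) :
    (edgeFormula Δ i j).steps ≤ 7 * numLiterals Δ + 1 := by
  refine (steps_filterT _ _).le.trans (Nat.succ_le_succ ?_)
  refine sum_map_clause_le hΔ _ 4 3 fun Γ _ => ?_
  have h₁ := steps_appearsT_le i Γ
  have h₂ := steps_appearsT_le j Γ
  simp only [Timed.steps_bind, Timed.steps_pure]
  omega

end CNF

/-! ### Testing points -/

section Tests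

variable {n : ℕ}

theorem Rel.test_eq (r : Rel) (a b : ℝ) (p : Bool) :
    (r.test a b == p) = true ↔ (r.Holds a b ↔ p = true) := by
  cases r <;> cases p <;> simp [Rel.test, Rel.Holds]

theorem Rel.holds_congr (r : Rel) {a b c d : ℝ} (h₁ : a < c ↔ b < d) (h₂ : c < a ↔ d < b) :
    r.Holds a c ↔ r.Holds b d := by
  cases r
  · exact h₁
  · simp only [Rel.Holds, ← not_lt, h₂]
  · simp only [Rel.Holds, le_antisymm_iff, ← not_lt, h₁, h₂]

theorem nodeTest_eq_true (D : CNF n ℝ) (i : Fin n) (u : ℝ) :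
    (nodeTest D i u).val = true ↔
      ∀ Γ ∈ D, ∃ ℓ ∈ Γ, ℓ.rel.Holds (ℓ.coeff i * u) ℓ.const ↔ ℓ.pos = true := by
  simp only [nodeTest, val_allT, val_anyT, List.all_eq_true, List.any_eq_true, Timed.val_bind,
    Timed.val_pure, Rel.test_eq]

theorem edgeTest_eq_true (D : CNF n ℝ) (i j : Fin n) (u v : ℝ) :
    (edgeTest D i j u v).val = true ↔
      ∀ Γ ∈ D, ∃ ℓ ∈ Γ, ℓ.rel.Holds (ℓ.coeff i * u + ℓ.coeff j * v) ℓ.const ↔ ℓ.pos = true := by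
  simp only [edgeTest, val_allT, val_anyT, List.all_eq_true, List.any_eq_true, Timed.val_bind,
    Timed.val_pure, Rel.test_eq]

theorem steps_nodeTest_le {D : CNF n ℝ} (hD : ∀ Γ ∈ D, Γ ≠ []) (i : Fin n) (u : ℝ) :
    (nodeTest D i u).steps ≤ 4 * numLiterals D + 1 := by
  refine (steps_allT_le _ _).trans (Nat.succ_le_succ ?_)
  refine sum_map_clause_le hD _ 2 2 fun Γ _ => ?_
  have := steps_anyT_le_of_le (fun ℓ : Literal n ℝ => do
    tick
    return ℓ.rel.test (ℓ.coeff i * u) ℓ.const == ℓ.pos) Γ 1 (by simp)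
  omega

theorem steps_edgeTest_le {D : CNF n ℝ} (hD : ∀ Γ ∈ D, Γ ≠ []) (i j : Fin n) (u v : ℝ) :
    (edgeTest D i j u v).steps ≤ 4 * numLiterals D + 1 := by
  refine (steps_allT_le _ _).trans (Nat.succ_le_succ ?_)
  refine sum_map_clause_le hD _ 2 2 fun Γ _ => ?_
  have := steps_anyT_le_of_le (fun ℓ : Literal n ℝ => do
    tick
    return ℓ.rel.test (ℓ.coeff i * u + ℓ.coeff j * v) ℓ.const == ℓ.pos) Γ 1 (by simp)
  omega

theorem sat_nodeFormula (Δ : CNF n ℝ) (i : Fin n) (x : Fin n → ℝ) :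
    Sat (nodeFormula Δ i).val x ↔ (nodeTest (nodeFormula Δ i).val i (x i)).val = true := by
  rw [nodeTest_eq_true]
  refine forall₂_congr fun Γ hΓ => exists_congr fun ℓ => and_congr_right fun hℓ => ?_
  rw [Literal.Holds, Finset.sum_eq_single i]
  · intro k _ hk
    have := (mem_nodeFormula.1 hΓ).2 k hk
    have : ℓ.coeff k = 0 := by
      by_contra h
      exact this ⟨ℓ, hℓ, h⟩
    rw [this, zero_mul]
  · simp

end Tests

/-! ### Breakpoints of the indicator functions -/

section LiteralPoints

variable {n : ℕ} (use : Literal n ℝ → Bool) (i : Fin n)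

/-- The number of literal occurrences in `D` that are selected by `p`. -/
def countLiterals (p : Literal n ℝ → Bool) (D : CNF n ℝ) : ℕ :=
  (D.map fun Γ => Γ.countP p).sum

theorem countLiterals_add_le (p q : Literal n ℝ → Bool) (hpq : ∀ ℓ, p ℓ = true → q ℓ = false)
    (D : CNF n ℝ) : countLiterals p D + countLiterals q D ≤ numLiterals D := by
  have h (Γ : Clause n ℝ) : Γ.countP p + Γ.countP q ≤ Γ.length := by
    induction Γ with
    | nil => simp
    | cons ℓ Γ ih =>
      have := hpq ℓ
      simp only [List.countP_cons, List.length_cons]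
      cases hp : p ℓ <;> cases hq : q ℓ <;> simp_all <;> omega
  induction D with
  | nil => simp [countLiterals]
  | cons Γ D ih =>
    have := h Γ
    simp only [countLiterals, List.map_cons, List.sum_cons, numLiterals_cons] at ih ⊢
    omega

theorem countP_eq_sum (p : Literal n ℝ → Bool) (Γ : Clause n ℝ) :
    Γ.countP p = (Γ.map fun ℓ => if p ℓ then 1 else 0).sum := by
  induction Γ with
  | nil => rfl
  | cons ℓ Γ ih => simp [List.countP_cons, ih, add_comm]

/-- The cost of a loop over all literals of a formula whose state grows by at most one in the steps
for the literals selected by `p`, and does not grow in the others. -/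
theorem foldT_clauses_growth {σ : Type} (f : σ → Literal n ℝ → Timed σ) (len : σ → ℕ)
    (p : Literal n ℝ → Bool) (c L a : ℕ) {D : CNF n ℝ} (hD : ∀ Γ ∈ D, Γ ≠ [])
    (ha : numLiterals D ≤ a) (s : σ) (hc : ∀ s ℓ, len s ≤ L → (f s ℓ).steps ≤ c)
    (hg : ∀ s ℓ, len (f s ℓ).val ≤ len s + if p ℓ then 1 else 0)
    (hL : len s + countLiterals p D ≤ L) :
    (foldT (fun s Γ => foldT f s Γ) s D).steps ≤ a * (a * (c + 1) + 2) + 1 ∧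
      len (foldT (fun s Γ => foldT f s Γ) s D).val ≤ len s + countLiterals p D := by
  obtain ⟨h₁, h₂⟩ := foldT_growth (fun s Γ => foldT f s Γ) len (fun Γ => Γ.countP p)
    (a * (c + 1) + 1) L D s
    (fun s Γ hΓ h => by
      rw [countP_eq_sum] at h
      refine (foldT_growth f len _ c L Γ s (fun s ℓ _ h => hc s ℓ (by omega))
        (fun s ℓ _ => hg s ℓ) h).1.trans ?_
      have := (length_clause_le hΓ).trans ha
      gcongr)
    (fun s Γ _ => by
      rw [countP_eq_sum]
      exact len_foldT_le f len _ Γ s fun s ℓ _ => hg s ℓ) hL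
  refine ⟨h₁.trans ?_, h₂⟩
  have := (length_le_numLiterals hD).trans ha
  gcongr

/-- A loop that never removes points and whose step for `a` adds the point `z` adds `z`. -/
theorem mem_foldT {α β : Type} (f : List β → α → Timed (List β)) (l : List α) (s : List β) (z : β)
    (hmono : ∀ s, ∀ a ∈ l, z ∈ s → z ∈ (f s a).val)
    (h : z ∈ s ∨ ∃ a ∈ l, ∀ s, z ∈ (f s a).val) : z ∈ (foldT f s l).val := by
  induction l generalizing s with
  | nil => simpa [foldT] using h
  | cons a l ih =>
    simp only [foldT, Timed.val_bind]
    refine ih _ (fun s a ha => hmono s a (by simp [ha])) ?_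
    rcases h with h | ⟨b, hb, h⟩
    · exact Or.inl (hmono s a (by simp) h)
    · rcases List.mem_cons.1 hb with rfl | hb
      · exact Or.inl (h s)
      · exact Or.inr ⟨b, hb, h⟩

theorem mem_foldT_foldT {α β : Type} (f : List β → α → Timed (List β)) (D : List (List α))
    (s : List β) (z : β) (hmono : ∀ s a, z ∈ s → z ∈ (f s a).val) {Γ : List α} (hΓ : Γ ∈ D)
    {a : α} (ha : a ∈ Γ) (h : ∀ s, z ∈ (f s a).val) :
    z ∈ (foldT (fun s Γ => foldT f s Γ) s D).val :=
  mem_foldT _ _ _ _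
    (fun _ _ _ hs => mem_foldT _ _ _ _ (fun s a _ => hmono s a) (Or.inl hs))
    (Or.inr ⟨Γ, hΓ, fun _ => mem_foldT _ _ _ _ (fun s a _ => hmono s a) (Or.inr ⟨a, ha, h⟩)⟩)

theorem pairwise_literalPoints (P : List ℝ) (D : CNF n ℝ) (hP : P.Pairwise (· < ·)) :
    (literalPoints use i P D).val.Pairwise (· < ·) := by
  refine foldT_induction _ (fun P : List ℝ => P.Pairwise (· < ·)) D P hP fun P Γ _ hP => ?_
  refine foldT_induction _ (fun P : List ℝ => P.Pairwise (· < ·)) Γ P hP fun P ℓ _ hP => ?_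
  simp only [Timed.val_bind, Timed.val_ite]
  split_ifs
  · exact pairwise_insertPoint _ _ hP
  · exact hP

theorem mem_literalPoints (D : CNF n ℝ) {Γ : Clause n ℝ} (hΓ : Γ ∈ D)
    {ℓ : Literal n ℝ} (hℓ : ℓ ∈ Γ) (h : ℓ.coeff i ≠ 0) (hu : use ℓ = true) (P : List ℝ) :
    ℓ.const / ℓ.coeff i ∈ (literalPoints use i P D).val := by
  refine mem_foldT_foldT _ _ _ _ (fun s ℓ' hs => ?_) hΓ hℓ fun s => ?_
  · simp only [Timed.val_bind, Timed.val_ite]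
    split_ifs
    · exact (mem_insertPoint _ _ _).2 (Or.inr hs)
    · exact hs
  · simp only [Timed.val_bind, h, hu, ne_eq, not_false_eq_true, decide_true, Bool.and_self,
      if_true]
    exact (mem_insertPoint _ _ _).2 (Or.inl rfl)

theorem literalPoints_cost {D : CNF n ℝ} {a : ℕ} (ha : numLiterals D ≤ a)
    (hD : ∀ Γ ∈ D, Γ ≠ []) :
    (literalPoints use i [] D).val.length ≤
        countLiterals (fun ℓ => decide (ℓ.coeff i ≠ 0) && use ℓ) D ∧
      (literalPoints use i [] D).steps ≤ a * (a * (a + 3) + 2) + 1 := by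
  have h := countLiterals_add_le (fun ℓ => decide (ℓ.coeff i ≠ 0) && use ℓ) (fun _ => false)
    (by simp) D
  obtain ⟨h₁, h₂⟩ := foldT_clauses_growth (fun P (ℓ : Literal n ℝ) => do
        tick
        if ℓ.coeff i ≠ 0 && use ℓ then
          insertPoint (ℓ.const / ℓ.coeff i) P
        else
          return P) List.length
    (fun ℓ => decide (ℓ.coeff i ≠ 0) && use ℓ) (a + 2) a a hD ha []
    (fun P ℓ hP => by
      have := steps_insertPoint_le (ℓ.const / ℓ.coeff i) P
      simp only [Timed.steps_bind, Timed.steps_ite, steps_tick, Timed.steps_pure]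
      split_ifs <;> omega)
    (fun P ℓ => by
      simp only [Timed.val_bind, Timed.val_ite, Timed.val_pure]
      split_ifs
      · exact length_insertPoint_le _ _
      · exact le_rfl) (by simp only [List.length_nil]; omega)
  exact ⟨h₂.trans (by simp), h₁⟩

end LiteralPoints

section Node

variable {n : ℕ}

theorem nodeTest_congr (D : CNF n ℝ) (i : Fin n) {u v : ℝ}
    (h : SamePiece (literalPoints (fun _ => true) i [] D).val u v) :
    (nodeTest D i u).val = (nodeTest D i v).val := by
  rw [Bool.eq_iff_iff, nodeTest_eq_true, nodeTest_eq_true]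
  refine forall₂_congr fun Γ hΓ => exists_congr fun ℓ => and_congr_right fun hℓ => ?_
  refine iff_congr ?_ Iff.rfl
  by_cases hi : ℓ.coeff i = 0
  · simp [hi]
  · obtain ⟨h₁, h₂⟩ := h.lt_iff (mem_literalPoints _ i D hΓ hℓ hi rfl [])
    refine Rel.holds_congr _ ?_ ?_ <;> rcases lt_or_gt_of_ne hi with hi | hi
    · simpa [div_lt_iff_of_neg' hi] using h₁
    · simpa [lt_div_iff₀' hi] using h₂
    · simpa [lt_div_iff_of_neg' hi] using h₂
    · simpa [div_lt_iff₀' hi] using h₁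

theorem sorted_nodeIndicator (Δ : CNF n ℝ) (i : Fin n) : (nodeIndicator Δ i).val.Sorted := by
  simp only [nodeIndicator, Timed.val_bind, PW.Sorted, PW.bpts_fromSamples]
  exact pairwise_literalPoints _ _ _ _ List.Pairwise.nil

theorem ev_nodeIndicator (Δ : CNF n ℝ) (i : Fin n) {u : ℝ} (hu : u ∉ (nodeIndicator Δ i).val.bpts) :
    (nodeIndicator Δ i).val.ev u =
      if (nodeTest (nodeFormula Δ i).val i u).val then 1 else 0 := by
  simp only [nodeIndicator, Timed.val_bind, PW.bpts_fromSamples, PW.ev] at hu ⊢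
  obtain ⟨w, hw₁, hw₂, hw₃⟩ := PW.look_fromSamples (fun u => do
    let b ← nodeTest (nodeFormula Δ i).val i u
    return if b then [1] else []) _
    (pairwise_literalPoints (fun _ => true) i [] (nodeFormula Δ i).val List.Pairwise.nil) u
  rw [hw₃, nodeTest_congr _ i ⟨hu, hw₁, hw₂⟩]
  simp only [Timed.val_bind, Timed.val_pure]
  split_ifs <;> simp

theorem nodeIndicator_cost {Δ : CNF n ℝ} (hΔ : ∀ Γ ∈ Δ, Γ ≠ []) (i : Fin n) {m : ℕ}
    (hm : numLiterals Δ ≤ m) (hm₁ : 1 ≤ m) (hn : 1 ≤ n) :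
    (nodeIndicator Δ i).val.CoeffsLe 1 ∧
      (nodeIndicator Δ i).val.bpts.length ≤ numLiterals (nodeFormula Δ i).val ∧
      (nodeIndicator Δ i).steps ≤ 30 * (n * m ^ 3) := by
  set D := (nodeFormula Δ i).val with hDdef
  have hD : ∀ Γ ∈ D, Γ ≠ [] := fun Γ hΓ => hΔ Γ (mem_nodeFormula.1 hΓ).1
  have hDm : numLiterals D ≤ m := by
    classical
    have := sum_numLiterals_filter_le [fun Γ => decide (∀ k, k ≠ i → ¬ Appears k Γ)] Δ (by simp)
    rw [hDdef, val_nodeFormula]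
    simpa using this.trans hm
  obtain ⟨h₁, h₂⟩ := literalPoints_cost (fun _ => true) i hDm hD
  obtain ⟨h₃, h₄⟩ := PW.fromSamples_cost (d := 1) (c := 4 * m + 1) (fun u => do
    let b ← nodeTest D i u
    return if b then [1] else []) (literalPoints (fun _ => true) i [] D).val (fun u => by
      have := steps_nodeTest_le hD i u
      simp only [Timed.val_bind, Timed.steps_bind, Timed.val_pure, Timed.steps_pure]
      refine ⟨by split_ifs <;> simp, by omega⟩)
  have h₅ := countLiterals_add_le (fun ℓ => decide (ℓ.coeff i ≠ 0) && true) (fun _ => false)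
    (by simp) D
  have h₆ := steps_nodeFormula_le hΔ i
  refine ⟨h₃, ?_, ?_⟩
  · simp only [nodeIndicator, Timed.val_bind, PW.bpts_fromSamples]
    exact h₁.trans (by omega)
  · simp only [nodeIndicator, Timed.steps_bind]
    rw [← hDdef]
    have h₇ : ((literalPoints (fun _ => true) i [] D).val.length + 1) * (4 * m + 1 + 1) ≤
        (m + 1) * (4 * m + 1 + 1) := by gcongr; omega
    have h₈ : (5 * n + 2) * numLiterals Δ ≤ (5 * n + 2) * m := by gcongr
    refine (Nat.add_le_add (h₆.trans (Nat.succ_le_succ h₈))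
      (Nat.add_le_add h₂ (h₄.trans h₇))).trans ?_
    have e₁ : n * m ≤ n * m ^ 3 := by gcongr; exact Nat.le_self_pow (by norm_num) m
    have e₂ : m ^ 3 ≤ n * m ^ 3 := Nat.le_mul_of_pos_left _ hn
    have e₃ : m ^ 2 ≤ m ^ 3 := Nat.pow_le_pow_right hm₁ (by norm_num)
    have e₄ : m ≤ m ^ 3 := Nat.le_self_pow (by norm_num) m
    have e₅ : 1 ≤ m ^ 3 := Nat.one_le_pow _ _ hm₁
    have : (5 * n + 2) * m + 1 + (m * (m * (m + 3) + 2) + 1 + (m + 1) * (4 * m + 1 + 1)) =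
      5 * (n * m) + m ^ 3 + 7 * m ^ 2 + 10 * m + 4 := by ring
    rw [Nat.succ_eq_add_one, this]
    omega

end Node

/-! ### Symbolic bounds -/

section Lines

variable {n : ℕ} (D : CNF n ℝ) (i j : Fin n)

/-- The value at `X_j = v` of the symbolic bound `L`. -/
def lineAt (L : ℝ × ℝ) (v : ℝ) : ℝ := L.1 * v + L.2

/-- The boundary line of a literal in which `X_i` appears. -/
noncomputable def Literal.line (ℓ : Literal n ℝ) : ℝ × ℝ :=
  (-ℓ.coeff j / ℓ.coeff i, ℓ.const / ℓ.coeff i)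

theorem mem_boundLines {Γ : Clause n ℝ} (hΓ : Γ ∈ D) {ℓ : Literal n ℝ} (hℓ : ℓ ∈ Γ)
    (h : ℓ.coeff i ≠ 0) : ℓ.line i j ∈ (boundLines D i j).val := by
  refine mem_foldT_foldT _ _ _ _ (fun s ℓ' hs => ?_) hΓ hℓ fun s => ?_
  · simp only [Timed.val_bind, Timed.val_ite, Timed.val_pure]
    split_ifs
    · exact hs
    · exact List.mem_cons_of_mem _ hs
    · exact hs
  · simp only [Timed.val_bind, Timed.val_pure, if_pos h, val_anyT, List.any_eq_true,
      decide_eq_true_eq, exists_eq_right]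
    split_ifs with hs
    · exact hs
    · exact List.mem_cons_self

theorem nodup_boundLines : (boundLines D i j).val.Nodup := by
  refine foldT_induction _ (fun S : List (ℝ × ℝ) => S.Nodup) D [] List.nodup_nil
    fun S Γ _ hS => ?_
  refine foldT_induction _ (fun S : List (ℝ × ℝ) => S.Nodup) Γ S hS fun S ℓ _ hS => ?_
  simp only [Timed.val_bind, Timed.val_ite, Timed.val_pure, val_anyT, List.any_eq_true,
      decide_eq_true_eq, exists_eq_right]
  split_ifs with h₁ h₂
  · exact hS
  · exact List.nodup_cons.2 ⟨h₂, hS⟩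
  · exact hS

variable {D} in
theorem boundLines_cost {a : ℕ} (ha : numLiterals D ≤ a) (hD : ∀ Γ ∈ D, Γ ≠ []) :
    (boundLines D i j).val.length ≤ countLiterals (fun ℓ => decide (ℓ.coeff i ≠ 0)) D ∧
      (boundLines D i j).steps ≤ a * (a * (2 * a + 3) + 2) + 1 := by
  have h := countLiterals_add_le (fun ℓ => decide (ℓ.coeff i ≠ 0)) (fun _ => false) (by simp) D
  obtain ⟨h₁, h₂⟩ := foldT_clauses_growth (fun S (ℓ : Literal n ℝ) => do
        tick
        if ℓ.coeff i ≠ 0 then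
          let L : ℝ × ℝ := (-ℓ.coeff j / ℓ.coeff i, ℓ.const / ℓ.coeff i)
          let b ← anyT (fun L' => do
            tick
            return decide (L' = L)) S
          return if b then S else L :: S
        else
          return S) List.length
    (fun ℓ => decide (ℓ.coeff i ≠ 0)) (2 * a + 2) a a hD ha []
    (fun S ℓ hS => by
      have := steps_anyT_le_of_le (fun L' => do
            tick
            return decide (L' = (-ℓ.coeff j / ℓ.coeff i, ℓ.const / ℓ.coeff i))) S 1 (by simp)
      simp only [Timed.steps_bind, Timed.steps_ite, steps_tick, Timed.steps_pure] at this ⊢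
      split_ifs <;> omega)
    (fun S ℓ => by
      simp only [Timed.val_bind, Timed.val_ite, Timed.val_pure, decide_eq_true_eq]
      split_ifs <;> simp) (by simp only [List.length_nil]; omega)
  exact ⟨h₂.trans (by simp), h₁⟩

variable (S : List (ℝ × ℝ))

theorem pairwise_criticalPoints : (criticalPoints D i j S).val.Pairwise (· < ·) := by
  simp only [criticalPoints, Timed.val_bind]
  refine foldT_induction _ (fun P : List ℝ => P.Pairwise (· < ·)) S _
    (pairwise_literalPoints _ _ _ _ List.Pairwise.nil) fun P L _ hP => ?_
  refine foldT_induction _ (fun P : List ℝ => P.Pairwise (· < ·)) S P hP fun P L' _ hP => ?_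
  simp only [Timed.val_bind, Timed.val_ite]
  split_ifs
  · exact hP
  · exact pairwise_insertPoint _ _ hP

theorem mem_criticalPoints_of_literal {Γ : Clause n ℝ} (hΓ : Γ ∈ D) {ℓ : Literal n ℝ}
    (hℓ : ℓ ∈ Γ) (hi : ℓ.coeff i = 0) (hj : ℓ.coeff j ≠ 0) :
    ℓ.const / ℓ.coeff j ∈ (criticalPoints D i j S).val := by
  have h := mem_literalPoints (fun ℓ => decide (ℓ.coeff i = 0)) j D hΓ hℓ hj (by simpa using hi) []
  simp only [criticalPoints, Timed.val_bind]
  refine mem_foldT _ _ _ _ (fun P L _ hP => ?_) (Or.inl h)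
  refine mem_foldT _ _ _ _ (fun P L' _ hP => ?_) (Or.inl hP)
  simp only [Timed.val_bind, Timed.val_ite]
  split_ifs
  · exact hP
  · exact (mem_insertPoint _ _ _).2 (Or.inr hP)

variable {S} in
theorem mem_criticalPoints_of_lines {L L' : ℝ × ℝ} (hL : L ∈ S) (hL' : L' ∈ S)
    (h : L.1 ≠ L'.1) : (L'.2 - L.2) / (L.1 - L'.1) ∈ (criticalPoints D i j S).val := by
  have hmono : ∀ (L : ℝ × ℝ) (z : ℝ) (P : List ℝ), ∀ L' ∈ S, z ∈ P → z ∈ (do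
      tick
      if L.1 = L'.1 then
        return P
      else
        insertPoint ((L'.2 - L.2) / (L.1 - L'.1)) P : Timed (List ℝ)).val := by
    intro L z P L' _ hP
    simp only [Timed.val_bind, Timed.val_ite]
    split_ifs
    · exact hP
    · exact (mem_insertPoint _ _ _).2 (Or.inr hP)
  simp only [criticalPoints, Timed.val_bind]
  refine mem_foldT _ _ _ _ (fun P L _ hP => mem_foldT _ _ _ _ (hmono L _) (Or.inl hP))
    (Or.inr ⟨L, hL, fun P => mem_foldT _ _ _ _ (hmono L _) (Or.inr ⟨L', hL', fun P => ?_⟩)⟩)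
  simp only [Timed.val_bind, if_neg h]
  exact (mem_insertPoint _ _ _).2 (Or.inl rfl)

variable {D} in
/-- With `k` breakpoints added by each line, there are at most `a * (a + k)` breakpoints in all: the
literals with and without `X_i` are disjoint, so that the numbers of lines and of critical points
from single literals add up to at most `a`. -/
theorem criticalPoints_cost {a : ℕ} (ha : numLiterals D ≤ a) (hD : ∀ Γ ∈ D, Γ ≠ [])
    (hS : S.length ≤ countLiterals (fun ℓ => decide (ℓ.coeff i ≠ 0)) D) :
    (∀ k, (criticalPoints D i j S).val.length + S.length * k ≤ a * (a + k)) ∧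
      (criticalPoints D i j S).steps ≤
        a * (a * (a + 3) + 2) + 1 + (a * (a * (a * a + 3) + 2) + 1) := by
  have hc := countLiterals_add_le (fun ℓ => decide (ℓ.coeff i ≠ 0))
    (fun ℓ => decide (ℓ.coeff j ≠ 0) && decide (ℓ.coeff i = 0)) (by simp; tauto) D
  obtain ⟨h₁, h₂⟩ := literalPoints_cost (fun ℓ => decide (ℓ.coeff i = 0)) j ha hD
  set P₀ := literalPoints (fun ℓ => decide (ℓ.coeff i = 0)) j [] D with hP₀
  have hSa : P₀.val.length + S.length ≤ a := by omega
  have hbound : ∀ k, P₀.val.length + S.length * S.length + S.length * k ≤ a * (a + k) := by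
    intro k
    have : (P₀.val.length + S.length) * (P₀.val.length + S.length + k) ≤ a * (a + k) := by gcongr
    have h₃ : P₀.val.length ≤ P₀.val.length * P₀.val.length := Nat.le_mul_self _
    nlinarith [Nat.zero_le (P₀.val.length * S.length), Nat.zero_le (P₀.val.length * k)]
  have hsum : (S.map fun _ => S.length).sum = S.length * S.length := by simp
  have hsum' : (S.map fun _ => 1).sum = S.length := by simp
  have hg : ∀ (L : ℝ × ℝ) (P : List ℝ), ∀ L' ∈ S, (do
      tick
      if L.1 = L'.1 then
        return P
      else
        insertPoint ((L'.2 - L.2) / (L.1 - L'.1)) P : Timed (List ℝ)).val.length ≤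
      P.length + 1 := by
    intro L P L' _
    simp only [Timed.val_bind, Timed.val_ite, Timed.val_pure]
    split_ifs
    · omega
    · exact length_insertPoint_le _ _
  obtain ⟨h₃, h₄⟩ := foldT_growth (fun P (L : ℝ × ℝ) => foldT (fun P (L' : ℝ × ℝ) => do
      tick
      if L.1 = L'.1 then
        return P
      else
        insertPoint ((L'.2 - L.2) / (L.1 - L'.1)) P) P S) List.length (fun _ => S.length)
    (a * (a * a + 3) + 1) (a * a) S P₀.val (fun P L _ hP => by
      have h := (foldT_growth (fun P L' => do
          tick
          if L.1 = L'.1 then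
            return P
          else
            insertPoint ((L'.2 - L.2) / (L.1 - L'.1)) P) List.length (fun _ => 1)
        (a * a + 2) (a * a) S P (fun P L' _ hP => by
          have := steps_insertPoint_le ((L'.2 - L.2) / (L.1 - L'.1)) P
          simp only [Timed.steps_bind, Timed.steps_ite, steps_tick, Timed.steps_pure]
          split_ifs <;> omega) (hg L) (by rwa [hsum'])).1
      refine h.trans ?_
      have : S.length ≤ a := by omega
      gcongr)
    (fun P L _ => by
      have := len_foldT_le (fun P L' => do
          tick
          if L.1 = L'.1 then
            return P
          else
            insertPoint ((L'.2 - L.2) / (L.1 - L'.1)) P) List.length (fun _ => 1) S P (hg L)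
      rwa [hsum'] at this)
    (by
      rw [hsum]
      simpa using hbound 0)
  rw [hsum] at h₄
  have hP : (criticalPoints D i j S).val.length ≤ P₀.val.length + S.length * S.length := h₄
  refine ⟨fun k => by have := hbound k; omega, ?_⟩
  simp only [criticalPoints, Timed.steps_bind, ← hP₀]
  refine Nat.add_le_add h₂ (h₃.trans ?_)
  have : S.length ≤ a := by omega
  gcongr

end Lines

/-! ### Position relative to the symbolic bounds -/

section Position

variable {n : ℕ} {D : CNF n ℝ} {i j : Fin n} {S : List (ℝ × ℝ)}

/-- Between consecutive critical points the lines do not cross. -/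
theorem lineAt_lt_iff {u v : ℝ} (h : SamePiece (criticalPoints D i j S).val u v) {L L' : ℝ × ℝ}
    (hL : L ∈ S) (hL' : L' ∈ S) : lineAt L u < lineAt L' u ↔ lineAt L v < lineAt L' v := by
  by_cases hs : L.1 = L'.1
  · simp [lineAt, hs]
  · obtain ⟨h₁, h₂⟩ := h.lt_iff (mem_criticalPoints_of_lines D i j hL hL' hs)
    simp only [lineAt]
    rcases lt_or_gt_of_ne (sub_ne_zero.2 hs) with hs | hs
    · rw [div_lt_iff_of_neg' hs, div_lt_iff_of_neg' hs] at h₁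
      constructor <;> intro h
      · linarith [h₁.1 (by linarith)]
      · linarith [h₁.2 (by linarith)]
    · rw [lt_div_iff₀' hs, lt_div_iff₀' hs] at h₂
      constructor <;> intro h
      · linarith [h₂.1 (by linarith)]
      · linarith [h₂.2 (by linarith)]

theorem lineAt_ne {v : ℝ} (hv : v ∉ (criticalPoints D i j S).val) {L L' : ℝ × ℝ}
    (hL : L ∈ S) (hL' : L' ∈ S) (h : L ≠ L') : lineAt L v ≠ lineAt L' v := by
  intro heq
  simp only [lineAt] at heq
  by_cases hs : L.1 = L'.1
  · rw [hs] at heq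
    exact h (Prod.ext hs (by linarith))
  · have := mem_criticalPoints_of_lines D i j hL hL' hs
    refine hv ?_
    convert this using 1
    rw [eq_div_iff (sub_ne_zero.2 hs)]
    linarith

/-- The truth value of the formula at a point off the boundary lines depends only on the position of
the point relative to the lines. -/
theorem edgeTest_congr {v v' u u' : ℝ}
    (h : SamePiece (criticalPoints D i j (boundLines D i j).val).val v v')
    (h₁ : ∀ L ∈ (boundLines D i j).val, lineAt L v < u ↔ lineAt L v' < u')
    (h₂ : ∀ L ∈ (boundLines D i j).val, u < lineAt L v ↔ u' < lineAt L v') :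
    (edgeTest D i j u v).val = (edgeTest D i j u' v').val := by
  rw [Bool.eq_iff_iff, edgeTest_eq_true, edgeTest_eq_true]
  refine forall₂_congr fun Γ hΓ => exists_congr fun ℓ => and_congr_right fun hℓ => ?_
  refine iff_congr ?_ Iff.rfl
  by_cases hi : ℓ.coeff i = 0
  · by_cases hj : ℓ.coeff j = 0
    · simp [hi, hj]
    · obtain ⟨h₁, h₂⟩ := h.lt_iff (mem_criticalPoints_of_literal D i j _ hΓ hℓ hi hj)
      simp only [hi, zero_mul, zero_add]
      refine Rel.holds_congr _ ?_ ?_ <;> rcases lt_or_gt_of_ne hj with hj | hj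
      · simpa [div_lt_iff_of_neg' hj] using h₁
      · simpa [lt_div_iff₀' hj] using h₂
      · simpa [lt_div_iff_of_neg' hj] using h₂
      · simpa [div_lt_iff₀' hj] using h₁
  · have hL := mem_boundLines D i j hΓ hℓ hi
    have key (u v : ℝ) : ℓ.coeff i * u + ℓ.coeff j * v - ℓ.const =
        ℓ.coeff i * (u - lineAt (ℓ.line i j) v) := by
      simp only [lineAt, Literal.line]
      field_simp
      ring
    have hneg (hi : ℓ.coeff i < 0) (t : ℝ) :
        (ℓ.coeff i * t < 0 ↔ 0 < t) ∧ (0 < ℓ.coeff i * t ↔ t < 0) :=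
      ⟨⟨fun h => pos_of_mul_neg_right h hi.le, mul_neg_of_neg_of_pos hi⟩,
        ⟨fun h => neg_of_mul_pos_right h hi.le, mul_pos_of_neg_of_neg hi⟩⟩
    have hpos (hi : 0 < ℓ.coeff i) (t : ℝ) :
        (ℓ.coeff i * t < 0 ↔ t < 0) ∧ (0 < ℓ.coeff i * t ↔ 0 < t) :=
      ⟨⟨fun h => neg_of_mul_neg_right h hi.le, mul_neg_of_pos_of_neg hi⟩,
        mul_pos_iff_of_pos_left hi⟩
    refine Rel.holds_congr _ ?_ ?_ <;> rcases lt_or_gt_of_ne hi with hi | hi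
    · rw [← sub_neg, key, ← sub_neg (b := ℓ.const), key, (hneg hi _).1, (hneg hi _).1, sub_pos,
        sub_pos, h₁ _ hL]
    · rw [← sub_neg, key, ← sub_neg (b := ℓ.const), key, (hpos hi _).1, (hpos hi _).1, sub_neg,
        sub_neg, h₂ _ hL]
    · rw [← sub_pos, key, ← sub_pos (b := ℓ.const), key, (hneg hi _).2, (hneg hi _).2, sub_neg,
        sub_neg, h₂ _ hL]
    · rw [← sub_pos, key, ← sub_pos (b := ℓ.const), key, (hpos hi _).2, (hpos hi _).2, sub_pos,
        sub_pos, h₁ _ hL]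

/-- `u` is smaller than `y`, and no element of `ys` lies between them. -/
def JustBelow (ys : List ℝ) (y u : ℝ) : Prop := u < y ∧ ∀ z ∈ ys, z < y → z < u

/-- `u` is larger than `y`, and no element of `ys` lies between them. -/
def JustAbove (ys : List ℝ) (y u : ℝ) : Prop := y < u ∧ ∀ z ∈ ys, y < z → u < z

theorem justBelow_spec (y : ℝ) (ys : List ℝ) : JustBelow ys y (justBelow y ys).val := by
  have key (z : ℝ) (hz : z < y) :
      (foldT (fun z y' => do
        tick
        return if z < y' ∧ y' < y then y' else z) z ys).val < y ∧
      z ≤ (foldT (fun z y' => do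
        tick
        return if z < y' ∧ y' < y then y' else z) z ys).val ∧
      ∀ y' ∈ ys, y' < y → y' ≤ (foldT (fun z y' => do
        tick
        return if z < y' ∧ y' < y then y' else z) z ys).val := by
    induction ys generalizing z with
    | nil => simpa [foldT] using hz
    | cons a ys ih =>
      simp only [foldT, Timed.val_bind, Timed.val_pure, List.forall_mem_cons] at ih ⊢
      split_ifs with h
      · obtain ⟨h₁, h₂, h₃⟩ := ih a h.2
        exact ⟨h₁, h.1.le.trans h₂, fun _ => h₂, h₃⟩
      · obtain ⟨h₁, h₂, h₃⟩ := ih z hz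
        refine ⟨h₁, h₂, fun ha => ?_, h₃⟩
        exact (not_lt.1 fun hza => h ⟨hza, ha⟩).trans h₂
  obtain ⟨h₁, h₂, h₃⟩ := key (y - 1) (by linarith)
  simp only [justBelow, Timed.val_bind, Timed.val_pure]
  refine ⟨by linarith, fun z hz hzy => ?_⟩
  linarith [h₃ z hz hzy]

theorem justAbove_spec (y : ℝ) (ys : List ℝ) : JustAbove ys y (justAbove y ys).val := by
  have key (z : ℝ) (hz : y < z) :
      y < (foldT (fun z y' => do
        tick
        return if y < y' ∧ y' < z then y' else z) z ys).val ∧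
      (foldT (fun z y' => do
        tick
        return if y < y' ∧ y' < z then y' else z) z ys).val ≤ z ∧
      ∀ y' ∈ ys, y < y' → (foldT (fun z y' => do
        tick
        return if y < y' ∧ y' < z then y' else z) z ys).val ≤ y' := by
    induction ys generalizing z with
    | nil => simpa [foldT] using hz
    | cons a ys ih =>
      simp only [foldT, Timed.val_bind, Timed.val_pure, List.forall_mem_cons] at ih ⊢
      split_ifs with h
      · obtain ⟨h₁, h₂, h₃⟩ := ih a h.1
        exact ⟨h₁, h₂.trans h.2.le, fun _ => h₂, h₃⟩
      · obtain ⟨h₁, h₂, h₃⟩ := ih z hz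
        refine ⟨h₁, h₂, fun ha => ?_, h₃⟩
        exact h₂.trans (not_lt.1 fun hza => h ⟨ha, hza⟩)
  obtain ⟨h₁, h₂, h₃⟩ := key (y + 1) (by linarith)
  simp only [justAbove, Timed.val_bind, Timed.val_pure]
  refine ⟨by linarith, fun z hz hzy => ?_⟩
  linarith [h₃ z hz hzy]

theorem steps_justBelow_le (y : ℝ) (ys : List ℝ) :
    (justBelow y ys).steps ≤ 2 * ys.length + 1 := by
  have := foldT_steps_le (fun z y' => do
    tick
    return if z < y' ∧ y' < y then y' else z) (fun _ => True) 1 ys (y - 1) trivial (by simp)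
  simp only [justBelow, Timed.steps_bind, Timed.steps_pure]
  omega

theorem steps_justAbove_le (y : ℝ) (ys : List ℝ) :
    (justAbove y ys).steps ≤ 2 * ys.length + 1 := by
  have := foldT_steps_le (fun z y' => do
    tick
    return if y < y' ∧ y' < z then y' else z) (fun _ => True) 1 ys (y + 1) trivial (by simp)
  simp only [justAbove, Timed.steps_bind, Timed.steps_pure]
  omega

theorem val_valuesAt (S : List (ℝ × ℝ)) (v : ℝ) :
    (valuesAt S v).val = S.map fun L => lineAt L v := by
  simp [valuesAt, lineAt]

theorem steps_valuesAt_le (S : List (ℝ × ℝ)) (v : ℝ) :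
    (valuesAt S v).steps ≤ 2 * S.length + 1 := by
  have := steps_mapT_le (fun L : ℝ × ℝ => do
    tick
    return L.1 * v + L.2) S 1 (by simp)
  rw [valuesAt]
  omega

theorem bpts_boundSign (D : CNF n ℝ) (i j : Fin n) (S : List (ℝ × ℝ)) (P : List ℝ) (L : ℝ × ℝ) :
    (boundSign D i j S P L).val.bpts = P := PW.bpts_fromSamples _ _

theorem bpts_infiniteBounds (D : CNF n ℝ) (i j : Fin n) (S : List (ℝ × ℝ)) (P : List ℝ)
    (bot top : ℝ) : (infiniteBounds D i j S P bot top).val.bpts = P := PW.bpts_fromSamples _ _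

theorem ev_boundSign {L : ℝ × ℝ} (hL : L ∈ (boundLines D i j).val) {v u w : ℝ}
    (hv : v ∉ (criticalPoints D i j (boundLines D i j).val).val)
    (hu : JustBelow ((boundLines D i j).val.map fun L => lineAt L v) (lineAt L v) u)
    (hw : JustAbove ((boundLines D i j).val.map fun L => lineAt L v) (lineAt L v) w) :
    (boundSign D i j (boundLines D i j).val
        (criticalPoints D i j (boundLines D i j).val).val L).val.ev v =
      (if (edgeTest D i j u v).val then 1 else 0) -
        (if (edgeTest D i j w v).val then 1 else 0) := by
  set S := (boundLines D i j).val with hS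
  obtain ⟨v', hv'₁, hv'₂, hv'₃⟩ := PW.look_fromSamples (fun v => do
    let ys ← valuesAt S v
    tick
    let y := L.1 * v + L.2
    let u ← justBelow y ys
    let w ← justAbove y ys
    let a ← edgeTest D i j u v
    let b ← edgeTest D i j w v
    return [(if a then 1 else 0) - (if b then 1 else 0)]) _ (pairwise_criticalPoints D i j S) v
  have hp : SamePiece (criticalPoints D i j S).val v v' := ⟨hv, hv'₁, hv'₂⟩
  simp only [PW.ev, boundSign, hv'₃]
  simp only [Timed.val_bind, Timed.val_pure, val_valuesAt, Poly.ev_cons, Poly.ev_nil, mul_zero,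
    add_zero]
  have hb := justBelow_spec (lineAt L v') (S.map fun L => lineAt L v')
  have ha := justAbove_spec (lineAt L v') (S.map fun L => lineAt L v')
  simp only [JustBelow, JustAbove, List.forall_mem_map] at hu hw hb ha
  change (if (edgeTest D i j (justBelow (lineAt L v') _).val v').val = true then (1 : ℝ) else 0) -
    (if (edgeTest D i j (justAbove (lineAt L v') _).val v').val = true then 1 else 0) = _
  rw [edgeTest_congr (u := u) (u' := (justBelow (lineAt L v') (S.map fun L => lineAt L v')).val)
      hp, edgeTest_congr (u := w)
      (u' := (justAbove (lineAt L v') (S.map fun L => lineAt L v')).val) hp]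
  all_goals
    rw [← hS]
    intro L' hL'
    have h₁ := lineAt_lt_iff hp hL' hL
    have h₂ := lineAt_lt_iff hp hL hL'
  · have h₃ := hw.2 L' hL'
    have h₄ := ha.2 L' hL'
    rcases lt_or_ge (lineAt L v) (lineAt L' v) with h | h
    · have h' := h₂.1 h
      exact iff_of_false (not_lt.2 (h₃ h).le) (not_lt.2 (h₄ h').le)
    · have h' := not_lt.1 (mt h₂.2 (not_lt.2 h))
      exact iff_of_true (h.trans_lt hw.1) (h'.trans_lt ha.1)
  · have h₃ := hw.2 L' hL'
    have h₄ := ha.2 L' hL'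
    rcases lt_or_ge (lineAt L v) (lineAt L' v) with h | h
    · exact iff_of_true (h₃ h) (h₄ (h₂.1 h))
    · have h' := not_lt.1 (mt h₂.2 (not_lt.2 h))
      exact iff_of_false (not_lt.2 (h.trans hw.1.le)) (not_lt.2 (h'.trans ha.1.le))
  · have h₃ := hu.2 L' hL'
    have h₄ := hb.2 L' hL'
    rcases lt_or_ge (lineAt L' v) (lineAt L v) with h | h
    · exact iff_of_true (h₃ h) (h₄ (h₁.1 h))
    · have h' := not_lt.1 (mt h₁.2 (not_lt.2 h))
      exact iff_of_false (not_lt.2 (hu.1.le.trans h)) (not_lt.2 (hb.1.le.trans h'))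
  · have h₃ := hu.2 L' hL'
    have h₄ := hb.2 L' hL'
    rcases lt_or_ge (lineAt L' v) (lineAt L v) with h | h
    · have h' := h₁.1 h
      exact iff_of_false (not_lt.2 (h₃ h).le) (not_lt.2 (h₄ h').le)
    · have h' := not_lt.1 (mt h₁.2 (not_lt.2 h))
      exact iff_of_true (hu.1.trans_le h) (hb.1.trans_le h')

theorem foldT_min_le (b : ℝ) (ys : List ℝ) : ∀ y ∈ ys, (foldT (fun z y => do
      tick
      return min z y) b ys).val ≤ y := by
  have key (b : ℝ) : (foldT (fun z y => do
      tick
      return min z y) b ys).val ≤ b ∧ ∀ y ∈ ys, (foldT (fun z y => do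
      tick
      return min z y) b ys).val ≤ y := by
    induction ys generalizing b with
    | nil => simp [foldT]
    | cons a ys ih =>
      obtain ⟨h₁, h₂⟩ := ih (min b a)
      simp only [foldT, Timed.val_bind, Timed.val_pure, List.forall_mem_cons] at h₁ h₂ ⊢
      exact ⟨h₁.trans (min_le_left _ _), h₁.trans (min_le_right _ _), h₂⟩
  exact (key b).2

theorem le_foldT_max (b : ℝ) (ys : List ℝ) : ∀ y ∈ ys, y ≤ (foldT (fun z y => do
      tick
      return max z y) b ys).val := by
  have key (b : ℝ) : b ≤ (foldT (fun z y => do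
      tick
      return max z y) b ys).val ∧ ∀ y ∈ ys, y ≤ (foldT (fun z y => do
      tick
      return max z y) b ys).val := by
    induction ys generalizing b with
    | nil => simp [foldT]
    | cons a ys ih =>
      obtain ⟨h₁, h₂⟩ := ih (max b a)
      simp only [foldT, Timed.val_bind, Timed.val_pure, List.forall_mem_cons] at h₁ h₂ ⊢
      exact ⟨(le_max_left _ _).trans h₁, (le_max_right _ _).trans h₁, h₂⟩
  exact (key b).2

theorem ev_infiniteBounds {v u w bot top : ℝ}
    (hv : v ∉ (criticalPoints D i j (boundLines D i j).val).val)
    (hu : ∀ L ∈ (boundLines D i j).val, u < lineAt L v)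
    (hw : ∀ L ∈ (boundLines D i j).val, lineAt L v < w) :
    (infiniteBounds D i j (boundLines D i j).val
        (criticalPoints D i j (boundLines D i j).val).val bot top).val.ev v =
      (if (edgeTest D i j w v).val then top else 0) -
        (if (edgeTest D i j u v).val then bot else 0) := by
  set S := (boundLines D i j).val with hS
  obtain ⟨v', hv'₁, hv'₂, hv'₃⟩ := PW.look_fromSamples (fun v => do
    let ys ← valuesAt S v
    let u ← foldT (fun z y => do
      tick
      return min z y) 0 ys
    let w ← foldT (fun z y => do
      tick
      return max z y) 0 ys
    let a ← edgeTest D i j (u - 1) v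
    let b ← edgeTest D i j (w + 1) v
    return [(if b then top else 0) - (if a then bot else 0)]) _ (pairwise_criticalPoints D i j S) v
  have hp : SamePiece (criticalPoints D i j S).val v v' := ⟨hv, hv'₁, hv'₂⟩
  simp only [PW.ev, infiniteBounds, hv'₃]
  simp only [Timed.val_bind, Timed.val_pure, val_valuesAt, Poly.ev_cons, Poly.ev_nil, mul_zero,
    add_zero, val_foldT]
  have h₁ := foldT_min_le 0 (S.map fun L => lineAt L v')
  have h₂ := le_foldT_max 0 (S.map fun L => lineAt L v')
  simp only [val_foldT, Timed.val_bind, Timed.val_pure, List.forall_mem_map] at h₁ h₂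
  generalize List.foldl (fun b a => min b a) 0 (S.map fun L => lineAt L v') = u' at h₁ ⊢
  generalize List.foldl (fun b a => max b a) 0 (S.map fun L => lineAt L v') = w' at h₂ ⊢
  rw [edgeTest_congr (u := u) (u' := u' - 1) hp, edgeTest_congr (u := w) (u' := w' + 1) hp]
  · exact fun L hL => iff_of_true (hw L hL) (by linarith [h₂ L hL])
  · exact fun L hL => iff_of_false (hw L hL).not_gt (not_lt.2 (by linarith [h₂ L hL]))
  · exact fun L hL => iff_of_false (hu L hL).not_gt (not_lt.2 (by linarith [h₁ L hL]))
  · exact fun L hL => iff_of_true (hu L hL) (by linarith [h₁ L hL])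

theorem boundSign_cost {a : ℕ} (ha : numLiterals D ≤ a) (hD : ∀ Γ ∈ D, Γ ≠ []) (hS : S.length ≤ a)
    (P : List ℝ) (L : ℝ × ℝ) :
    (boundSign D i j S P L).val.CoeffsLe 1 ∧
      (boundSign D i j S P L).steps ≤ (P.length + 1) * (14 * a + 7) := by
  refine PW.fromSamples_cost _ P fun v => ?_
  simp only [Timed.val_bind, Timed.steps_bind, Timed.val_pure, Timed.steps_pure, steps_tick]
  have h₁ := steps_valuesAt_le S v
  have h₂ := steps_justBelow_le (L.1 * v + L.2) (valuesAt S v).val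
  have h₃ := steps_justAbove_le (L.1 * v + L.2) (valuesAt S v).val
  have h₄ := fun u => steps_edgeTest_le hD i j u v
  rw [val_valuesAt, List.length_map] at h₂ h₃
  rw [val_valuesAt]
  have h₅ := h₄ (justBelow (L.1 * v + L.2) (S.map fun L => lineAt L v)).val
  have h₆ := h₄ (justAbove (L.1 * v + L.2) (S.map fun L => lineAt L v)).val
  exact ⟨le_rfl, by omega⟩

theorem infiniteBounds_cost {a : ℕ} (ha : numLiterals D ≤ a) (hD : ∀ Γ ∈ D, Γ ≠ [])
    (hS : S.length ≤ a) (P : List ℝ) (bot top : ℝ) :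
    (infiniteBounds D i j S P bot top).val.CoeffsLe 1 ∧
      (infiniteBounds D i j S P bot top).steps ≤ (P.length + 1) * (14 * a + 7) := by
  refine PW.fromSamples_cost _ P fun v => ?_
  simp only [Timed.val_bind, Timed.steps_bind, Timed.val_pure, Timed.steps_pure]
  have h₁ := steps_valuesAt_le S v
  have h₂ := foldT_steps_le (fun z y : ℝ => do
      tick
      return min z y) (fun _ => True) 1 (valuesAt S v).val 0 trivial (by simp)
  have h₃ := foldT_steps_le (fun z y : ℝ => do
      tick
      return max z y) (fun _ => True) 1 (valuesAt S v).val 0 trivial (by simp)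
  have h₄ := fun u => steps_edgeTest_le hD i j u v
  rw [show (valuesAt S v).val.length = S.length by simp [val_valuesAt]] at h₂ h₃
  refine ⟨le_rfl, ?_⟩
  refine (Nat.add_le_add h₁ (Nat.add_le_add h₂ (Nat.add_le_add h₃ (Nat.add_le_add (h₄ _)
    (Nat.add_le_add_right (h₄ _) 0))))).trans ?_
  omega

end Position

/-! ### Branches of a tree -/

section Tree

variable {n : ℕ} {G : SimpleGraph (Fin n)}

/-- For adjacent vertices `i` and `j` of a tree, the branch at `j` that contains `i`: the component
of `i` after the edge between `i` and `j` is removed. It consists of the vertices that are closer to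
`i` than to `j`. -/
noncomputable def branch (G : SimpleGraph (Fin n)) (i j : Fin n) : Finset (Fin n) :=
  {v | G.dist v i < G.dist v j}

/-- The number of levels of the branch at `j` that contains `i`, which is the largest distance of
its vertices from `j`. -/
noncomputable def branchDepth (G : SimpleGraph (Fin n)) (i j : Fin n) : ℕ :=
  (branch G i j).sup fun v => G.dist v j

theorem mem_branch {i j v : Fin n} : v ∈ branch G i j ↔ G.dist v i < G.dist v j := by simp [branch]

theorem self_mem_branch {i j : Fin n} (h : G.Adj i j) : i ∈ branch G i j := by
  rw [mem_branch, SimpleGraph.dist_self, SimpleGraph.dist_eq_one_iff_adj.2 h]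
  exact one_pos

theorem notMem_branch {i j : Fin n} : j ∉ branch G i j := by
  simp [mem_branch]

theorem dist_adj (hG : G.IsTree) {i j : Fin n} (h : G.Adj i j) (v : Fin n) :
    G.dist v i = G.dist v j + 1 ∨ G.dist v j = G.dist v i + 1 :=
  hG.dist_eq_dist_add_one_of_adj v h

/-- Two neighbours of a vertex `i` of a tree that are both closer to `v` than `i` is are equal,
since paths are unique. -/
theorem eq_of_mem_branch (hG : G.IsTree) {i c c' v : Fin n} (hc : G.Adj c i) (hc' : G.Adj c' i)
    (h : v ∈ branch G c i) (h' : v ∈ branch G c' i) : c = c' := by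
  rw [mem_branch] at h h'
  have path (c : Fin n) (hc : G.Adj c i) (h : G.dist v c < G.dist v i) :
      ∃ p : G.Walk i v, p.IsPath ∧ p.snd = c := by
    obtain ⟨q, hq⟩ := hG.connected.exists_walk_length_eq_dist c v
    refine ⟨.cons hc.symm q, SimpleGraph.Walk.isPath_of_length_eq_dist _ ?_, by simp⟩
    rw [SimpleGraph.Walk.length_cons, hq, SimpleGraph.dist_comm, SimpleGraph.dist_comm (u := i)]
    rcases dist_adj hG hc v with h | h <;> omega
  obtain ⟨p, hp, rfl⟩ := path c hc h
  obtain ⟨p', hp', rfl⟩ := path c' hc' h'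
  rw [(hG.existsUnique_path i v).unique hp hp']

theorem exists_mem_branch (hG : G.IsTree) {i v : Fin n} (h : v ≠ i) :
    ∃ c, G.Adj c i ∧ v ∈ branch G c i := by
  obtain ⟨p, hp⟩ := hG.connected.exists_walk_length_eq_dist i v
  cases p with
  | nil => exact absurd rfl h
  | cons hadj q =>
    rename_i c
    refine ⟨c, hadj.symm, ?_⟩
    have := SimpleGraph.dist_le q
    rw [SimpleGraph.Walk.length_cons] at hp
    rw [mem_branch, SimpleGraph.dist_comm, SimpleGraph.dist_comm (v := i)]
    omega

theorem branch_subset (hG : G.IsTree) {i j c : Fin n} (hj : G.Adj j i) (hc : G.Adj c i)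
    (hcj : c ≠ j) : branch G c i ⊆ branch G i j := by
  intro v hv
  rw [mem_branch]
  rcases dist_adj hG hj v with h | h
  · omega
  · exact absurd (eq_of_mem_branch hG hc hj hv (mem_branch.2 (by omega))) hcj

theorem disjoint_branch (hG : G.IsTree) {i c c' : Fin n} (hc : G.Adj c i) (hc' : G.Adj c' i)
    (h : c ≠ c') : Disjoint (branch G c i) (branch G c' i) :=
  Finset.disjoint_left.2 fun _ hv hv' => h (eq_of_mem_branch hG hc hc' hv hv')

theorem mem_branch_cases (hG : G.IsTree) {i j v : Fin n} (hv : v ∈ branch G i j) :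
    v = i ∨ ∃ c, G.Adj c i ∧ c ≠ j ∧ v ∈ branch G c i := by
  by_cases h : v = i
  · exact Or.inl h
  · obtain ⟨c, hc, hvc⟩ := exists_mem_branch hG h
    refine Or.inr ⟨c, hc, ?_, hvc⟩
    rintro rfl
    rw [mem_branch] at hv hvc
    omega

/-- The only edge that leaves a branch is the one at which it was cut off. -/
theorem eq_of_adj_of_notMem_branch (hG : G.IsTree) {c i k l : Fin n} (hc : G.Adj c i)
    (hkl : G.Adj k l) (hk : k ∈ branch G c i) (hl : l ∉ branch G c i) : l = i := by
  by_contra hli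
  obtain ⟨c', hc', hlc'⟩ := exists_mem_branch hG hli
  have hne : c ≠ c' := by
    rintro rfl
    exact hl hlc'
  have hk' : k ∉ branch G c' i := fun h => hne (eq_of_mem_branch hG hc hc' hk h)
  rw [mem_branch] at hk hl hk' hlc'
  have h₁ := dist_adj hG hkl c
  have h₂ := dist_adj hG hkl c'
  have h₃ := dist_adj hG hkl i
  have h₄ := dist_adj hG hc k
  have h₅ := dist_adj hG hc l
  have h₆ := dist_adj hG hc' k
  have h₇ := dist_adj hG hc' l
  simp only [SimpleGraph.dist_comm (u := c), SimpleGraph.dist_comm (u := c'),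
    SimpleGraph.dist_comm (u := i)] at *
  omega

theorem one_le_branchDepth {i j : Fin n} (h : G.Adj i j) : 1 ≤ branchDepth G i j := by
  have := Finset.le_sup (f := fun v => G.dist v j) (self_mem_branch h)
  rwa [SimpleGraph.dist_eq_one_iff_adj.2 h] at this

theorem branchDepth_add_one_le (hG : G.IsTree) {i j c : Fin n} (hj : G.Adj j i) (hc : G.Adj c i)
    (hcj : c ≠ j) : branchDepth G c i + 1 ≤ branchDepth G i j := by
  obtain ⟨v, hv, hvd⟩ := Finset.exists_mem_eq_sup (branch G c i) ⟨c, self_mem_branch hc⟩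
    fun v => G.dist v i
  have hv' := branch_subset hG hj hc hcj hv
  have := Finset.le_sup (f := fun v => G.dist v j) hv'
  rw [mem_branch] at hv'
  rw [branchDepth, branchDepth, hvd]
  omega

/-- The branches at `i` other than the one of `j` fit, together with `i`, into the branch of `i`
at `j`. -/
theorem sum_card_branch_add_one_le (hG : G.IsTree) {i j : Fin n} (hj : G.Adj j i)
    (cs : List (Fin n))
    (hnd : cs.Nodup) (hcs : ∀ c ∈ cs, G.Adj c i ∧ c ≠ j) :
    (cs.map fun c => (branch G c i).card).sum + 1 ≤ (branch G i j).card := by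
  have h : (cs.map fun c => (branch G c i).card).sum =
      (cs.toFinset.biUnion fun c => branch G c i).card := by
    rw [Finset.card_biUnion, List.sum_toFinset _ hnd]
    intro c hc c' hc' hne
    exact disjoint_branch hG (hcs c (List.mem_toFinset.1 hc)).1
      (hcs c' (List.mem_toFinset.1 hc')).1 hne
  rw [h, ← Finset.card_insert_of_notMem (a := i)]
  · refine Finset.card_le_card ?_
    rw [Finset.insert_subset_iff]
    refine ⟨self_mem_branch hj.symm, Finset.biUnion_subset.2 fun c hc => ?_⟩
    have := hcs c (List.mem_toFinset.1 hc)
    exact branch_subset hG hj this.1 this.2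
  · simp [notMem_branch]

theorem sum_card_branch_le (hG : G.IsTree) (i : Fin n) (cs : List (Fin n))
    (hnd : cs.Nodup) (hcs : ∀ c ∈ cs, G.Adj c i) :
    (cs.map fun c => (branch G c i).card).sum + 1 ≤ n := by
  have h : (cs.map fun c => (branch G c i).card).sum =
      (cs.toFinset.biUnion fun c => branch G c i).card := by
    rw [Finset.card_biUnion, List.sum_toFinset _ hnd]
    intro c hc c' hc' hne
    exact disjoint_branch hG (hcs c (List.mem_toFinset.1 hc)) (hcs c' (List.mem_toFinset.1 hc')) hne
  rw [h, ← Finset.card_insert_of_notMem (a := i)]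
  · exact (Finset.card_le_univ _).trans_eq (Fintype.card_fin n)
  · simp [notMem_branch]

end Tree

/-! ### Heights -/

section Height

variable {n : ℕ} {G : SimpleGraph (Fin n)}

theorem dist_lt_height (T : SimpleGraph (Fin n)) (r v : Fin n) : T.dist r v < height T r :=
  Nat.lt_succ_of_le (Finset.le_sup (f := fun v => T.dist r v) (Finset.mem_univ v))

theorem two_le_height (hn : 2 ≤ n) {T : SimpleGraph (Fin n)} (hT : T.IsTree) (r : Fin n) :
    2 ≤ height T r := by
  have : Nontrivial (Fin n) := Fin.nontrivial_iff_two_le.2 hn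
  obtain ⟨v, hv⟩ := exists_ne r
  have := dist_lt_height T r v
  have := hT.connected.pos_dist_of_ne hv.symm
  omega

/-- A vertex at the largest distance from the root is a leaf. -/
theorem one_le_numLeaves (T : SimpleGraph (Fin n)) (r : Fin n) : 1 ≤ numLeaves T r := by
  obtain ⟨v, -, hv⟩ := Finset.exists_max_image Finset.univ (fun v => T.dist r v)
    ⟨r, Finset.mem_univ r⟩
  refine (Set.ncard_pos (Set.toFinite _)).2 ?_
  refine ⟨v, ?_⟩
  rintro ⟨w, -, hw⟩
  have := hv w (Finset.mem_univ w)
  omega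

theorem dist_lt_height_of_le {T : SimpleGraph (Fin n)} (hT : T.IsTree) (hle : T ≤ G)
    (r v : Fin n) : G.dist r v < height T r :=
  (SimpleGraph.Reachable.dist_anti hle (hT.connected r v)).trans_lt (dist_lt_height T r v)

/-- Two vertices are joined by a path through `rp` and by a path through `r`, whose lengths are
bounded by the two heights. Their distance is at most the mean of the two bounds. -/
theorem branchDepth_add_two_le (hG : G.IsTree) {T : SimpleGraph (Fin n)} (hT : T.IsTree)
    (hle : T ≤ G) (rp r i j : Fin n) :
    branchDepth G i j + 2 ≤ height G rp + height T r := by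
  have h (v : Fin n) : G.dist v j + 2 ≤ height G rp + height T r := by
    have h₁ := hG.connected.dist_triangle (u := v) (v := rp) (w := j)
    have h₂ := hG.connected.dist_triangle (u := v) (v := r) (w := j)
    rw [SimpleGraph.dist_comm (u := v) (v := rp)] at h₁
    rw [SimpleGraph.dist_comm (u := v) (v := r)] at h₂
    have h₃ := dist_lt_height G rp v
    have h₄ := dist_lt_height G rp j
    have h₅ := dist_lt_height_of_le hT hle r v
    have h₆ := dist_lt_height_of_le hT hle r j
    omega
  have h₀ := h j
  have : branchDepth G i j ≤ height G rp + height T r - 2 :=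
    Finset.sup_le fun v _ => by have := h v; omega
  omega

end Height

/-! ### Integration of piecewise polynomials -/

section Integration

/-- A polynomial other than `0` is bounded away from `0` near `∞`. -/
theorem Poly.eventually_le_abs_ev (p : Poly ℝ) (h : ∃ x, p.ev x ≠ 0) :
    ∃ δ > 0, ∀ᶠ x in Filter.atTop, δ ≤ |p.ev x| := by
  rcases le_or_gt (toPolynomial p).degree 0 with hd | hd
  · obtain ⟨x, hx⟩ := h
    have hc (y : ℝ) : p.ev y = (toPolynomial p).coeff 0 := by
      rw [← eval_toPolynomial, Polynomial.eq_C_of_degree_le_zero hd, Polynomial.eval_C]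
      simp
    refine ⟨|p.ev x|, abs_pos.2 hx, Filter.Eventually.of_forall fun y => ?_⟩
    rw [hc, hc]
  · refine ⟨1, one_pos, ?_⟩
    filter_upwards [(Polynomial.abs_tendsto_atTop _ hd).eventually_ge_atTop 1] with x hx
    rwa [eval_toPolynomial] at hx

/-- A polynomial that is non-negative and has a finite integral on a half-line vanishes. -/
theorem Poly.ev_eq_zero_of_lintegral_ne_top (p : Poly ℝ) (a : ℝ)
    (hp : ∀ᵐ x, a < x → 0 ≤ p.ev x)
    (hi : ∫⁻ x in Set.Ioi a, ENNReal.ofReal (p.ev x) ≠ ⊤) (x : ℝ) : p.ev x = 0 := by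
  by_contra hx
  obtain ⟨δ, hδ, h⟩ := p.eventually_le_abs_ev ⟨x, hx⟩
  obtain ⟨b, hb⟩ := Filter.eventually_atTop.1 h
  refine hi (top_unique ?_)
  calc (⊤ : ℝ≥0∞) = ∫⁻ x in Set.Ioi (max a b), ENNReal.ofReal δ := by
        rw [setLIntegral_const, Real.volume_Ioi, ENNReal.mul_top]
        simpa using hδ
    _ ≤ ∫⁻ x in Set.Ioi (max a b), ENNReal.ofReal (p.ev x) := by
        refine lintegral_mono_ae ?_
        filter_upwards [ae_restrict_of_ae hp, ae_restrict_mem measurableSet_Ioi] with x hpx hx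
        have h₁ := hb x ((le_max_right a b).trans (le_of_lt hx))
        rw [abs_of_nonneg (hpx ((le_max_left a b).trans_lt hx))] at h₁
        exact ENNReal.ofReal_le_ofReal h₁
    _ ≤ _ := lintegral_mono_set (Set.Ioi_subset_Ioi (le_max_left a b))

theorem Poly.ev_eq_zero_of_lintegral_ne_top' (p : Poly ℝ) (a : ℝ)
    (hp : ∀ᵐ x, x < a → 0 ≤ p.ev x)
    (hi : ∫⁻ x in Set.Iio a, ENNReal.ofReal (p.ev x) ≠ ⊤) (x : ℝ) : p.ev x = 0 := by
  have hm := Measure.measurePreserving_neg (volume : Measure ℝ)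
  have h := ev_eq_zero_of_lintegral_ne_top (Poly.comp (-1) 0 p).val (-a) (by
    filter_upwards [hm.quasiMeasurePreserving.ae hp] with x hx hax
    simpa using hx (by linarith)) (by
    have := hm.setLIntegral_comp_preimage (measurableSet_Iio (a := a))
      (f := fun x => ENNReal.ofReal (p.ev x))
      (Poly.continuous_ev p).measurable.ennreal_ofReal
    simp only [Set.neg_preimage, Set.neg_Iio] at this
    simpa [this] using hi) (-x)
  simpa using h

theorem PW.measurable_ev (g : PW ℝ) : Measurable g.ev := by
  have (p : Poly ℝ) (s : List (ℝ × Poly ℝ)) : Measurable fun x => (lookFrom x p s).ev x := by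
    induction s generalizing p with
    | nil => exact (Poly.continuous_ev p).measurable
    | cons a s ih =>
      have : Measurable fun x => if x < a.1 then p.ev x else (lookFrom x a.2 s).ev x :=
        Measurable.ite measurableSet_Iio (Poly.continuous_ev p).measurable (ih a.2)
      convert this using 2 with x
      by_cases h : x < a.1 <;> simp [lookFrom, h]
  exact this _ _

/-- A function that is constant between consecutive points of `Y` is the sum of its jumps. -/
theorem eq_add_sum_jumps (Y : Finset ℝ) (φ : ℝ → ℝ)
    (hφ : ∀ u u', u ∉ Y → u' ∉ Y → (∀ y ∈ Y, y < u ↔ y < u') → φ u = φ u')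
    (b c : ℝ → ℝ) (hb : ∀ y ∈ Y, b y < y ∧ ∀ z ∈ Y, z < y → z < b y)
    (hc : ∀ y ∈ Y, y < c y ∧ ∀ z ∈ Y, y < z → c y < z)
    (u₀ : ℝ) (hu₀ : ∀ y ∈ Y, u₀ < y) (u : ℝ) (hu : u ∉ Y) :
    φ u = φ u₀ + ∑ y ∈ Y.filter (· < u), (φ (c y) - φ (b y)) := by
  induction h : (Y.filter (· < u)).card using Nat.strong_induction_on generalizing u with
  | _ k ih =>
    have hu₀' : u₀ ∉ Y := fun h => lt_irrefl _ (hu₀ _ h)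
    rcases (Y.filter (· < u)).eq_empty_or_nonempty with he | hne
    · rw [he, Finset.sum_empty, add_zero]
      refine hφ _ _ hu hu₀' fun y hy => iff_of_false (fun hyu => ?_) (hu₀ y hy).not_gt
      have : y ∈ Y.filter (· < u) := by simp [hy, hyu]
      simp [he] at this
    · obtain ⟨y, hy, hmax⟩ := Finset.exists_max_image _ id hne
      rw [Finset.mem_filter] at hy
      obtain ⟨hyY, hyu⟩ := hy
      obtain ⟨hby, hby'⟩ := hb y hyY
      obtain ⟨hcy, hcy'⟩ := hc y hyY
      have hbY : b y ∉ Y := fun h => lt_irrefl _ (hby' _ h hby)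
      have hcY : c y ∉ Y := fun h => lt_irrefl _ (hcy' _ h hcy)
      have h₁ : φ u = φ (c y) := by
        refine hφ _ _ hu hcY fun z hz => ?_
        rcases lt_or_ge y z with hyz | hzy
        · refine iff_of_false (fun hzu => ?_) (hcy' z hz hyz).not_gt
          exact absurd (hmax z (by simp [hz, hzu])) (not_le.2 hyz)
        · exact iff_of_true (hzy.trans_lt hyu) (hzy.trans_lt hcy)
      have h₂ : Y.filter (· < b y) = (Y.filter (· < u)).erase y := by
        ext z
        simp only [Finset.mem_filter, Finset.mem_erase]
        constructor
        · rintro ⟨hz, hzb⟩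
          exact ⟨(hzb.trans hby).ne, hz, hzb.trans (hby.trans hyu)⟩
        · rintro ⟨hne, hz, hzu⟩
          exact ⟨hz, hby' z hz (lt_of_le_of_ne (hmax z (by simp [hz, hzu])) hne)⟩
      have hmem : y ∈ Y.filter (· < u) := by simp [hyY, hyu]
      have h₃ := ih _ (by rw [← h, h₂]; exact Finset.card_erase_lt_of_mem hmem) (b y) hbY rfl
      rw [h₁, ← Finset.add_sum_erase _ _ hmem, ← h₂]
      linarith

/-- The fundamental theorem of calculus for the product of a step function and a piecewise
polynomial. -/
theorem integral_step_mul {g : PW ℝ} (hg : g.Sorted) (Y : Finset ℝ) (φ : ℝ → ℝ)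
    (hφm : Measurable φ) (hφ₁ : ∀ u, |φ u| ≤ 1)
    (J : ℝ → ℝ) (φ₀ a b : ℝ)
    (hφ : ∀ u, u ∉ Y → φ u = φ₀ + ∑ y ∈ Y.filter (· < u), J y)
    (ha : ∀ y ∈ Y, a < y) (hb : ∀ y ∈ Y, y < b) :
    ∫ u in a..b, φ u * g.ev u =
      φ b * (PW.antideriv g).val.ev b - φ₀ * (PW.antideriv g).val.ev a -
        ∑ y ∈ Y, J y * (PW.antideriv g).val.ev y := by
  -- `φ₀ * F x + ∑ y ∈ Y, J y * F (max x y)` is a continuous antiderivative of the integrand.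
  set F := (PW.antideriv g).val.ev with hF
  have hFc : Continuous F := PW.continuous_ev_antideriv hg
  have hint : IntervalIntegrable (fun u => φ u * g.ev u) volume a b := by
    refine (PW.intervalIntegrable_ev g a b).mono_fun
      (hφm.mul (PW.measurable_ev g)).aestronglyMeasurable (Filter.Eventually.of_forall fun u => ?_)
    simp only [norm_mul, Real.norm_eq_abs]
    exact mul_le_of_le_one_left (abs_nonneg _) (hφ₁ u)
  have hd : ∀ x ∈ Set.Ioo (min a b) (max a b) \ ((Y : Set ℝ) ∪ {x | x ∈ g.bpts}),
      HasDerivAt (fun x => φ₀ * F x + ∑ y ∈ Y, J y * F (max x y)) (φ x * g.ev x) x := by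
    rintro x ⟨-, hx⟩
    simp only [Set.mem_union, not_or, Finset.mem_coe, Set.mem_ofPred_eq] at hx
    have hFx : HasDerivAt F (g.ev x) x := PW.hasDerivAt_ev_antideriv g hx.2
    have hsum : HasDerivAt (fun x => ∑ y ∈ Y, J y * F (max x y))
        (∑ y ∈ Y, J y * if y < x then g.ev x else 0) x := by
      refine HasDerivAt.fun_sum fun y hy => HasDerivAt.const_mul _ ?_
      rcases lt_or_gt_of_ne (fun h : y = x => hx.1 (h ▸ hy)) with h | h
      · rw [if_pos h]
        refine hFx.congr_of_eventuallyEq ?_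
        filter_upwards [lt_mem_nhds h] with z hz
        rw [max_eq_left hz.le]
      · rw [if_neg h.not_gt]
        refine (hasDerivAt_const x (F y)).congr_of_eventuallyEq ?_
        filter_upwards [gt_mem_nhds h] with z hz
        rw [max_eq_right hz.le]
    refine ((hFx.const_mul φ₀).add hsum).congr_deriv ?_
    rw [hφ x hx.1, add_mul, Finset.sum_filter, Finset.sum_mul]
    congr 1
    refine Finset.sum_congr rfl fun y _ => ?_
    split_ifs <;> simp
  have hc : Continuous fun x => φ₀ * F x + ∑ y ∈ Y, J y * F (max x y) := by fun_prop
  rw [integral_eq_of_hasDerivAt_off_countable _ _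
    (Y.countable_toSet.union g.bpts.finite_toSet.countable) hc.continuousOn hd hint]
  have h₁ : ∑ y ∈ Y, J y * F (max b y) = (∑ y ∈ Y, J y) * F b := by
    rw [Finset.sum_mul]
    exact Finset.sum_congr rfl fun y hy => by rw [max_eq_left (hb y hy).le]
  have h₂ : ∑ y ∈ Y, J y * F (max a y) = ∑ y ∈ Y, J y * F y :=
    Finset.sum_congr rfl fun y hy => by rw [max_eq_right (ha y hy).le]
  have h₃ : φ b = φ₀ + ∑ y ∈ Y, J y := by
    rw [hφ b fun h => lt_irrefl _ (hb b h), Finset.filter_true_of_mem hb]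
  rw [h₁, h₂, h₃]
  ring

/-- `g` is a piecewise polynomial that agrees with `f` almost everywhere where `f` is finite. Where
`f` is infinite, `g` may have any value. -/
def Represents (g : PW ℝ) (f : ℝ → ℝ≥0∞) : Prop :=
  g.Sorted ∧ Measurable f ∧ ∀ᵐ u, f u ≠ ⊤ → (f u).toReal = g.ev u

theorem Represents.mul {g₁ g₂ : PW ℝ} {f₁ f₂ : ℝ → ℝ≥0∞} (h₁ : Represents g₁ f₁)
    (h₂ : Represents g₂ f₂) : Represents (PW.mul g₁ g₂).val fun u => f₁ u * f₂ u := by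
  refine ⟨PW.sorted_zip _ h₁.1 h₂.1, h₁.2.1.mul h₂.2.1, ?_⟩
  filter_upwards [h₁.2.2, h₂.2.2] with u hu₁ hu₂ hu
  rw [PW.ev_mul, ENNReal.toReal_mul]
  -- A factor `⊤` of a finite product comes with a factor `0`, which is represented correctly.
  by_cases ht₁ : f₁ u = ⊤
  · have h0 : f₂ u = 0 := by
      by_contra h0
      exact hu (by rw [ht₁, ENNReal.top_mul h0])
    rw [← hu₂ (by simp [h0]), h0]
    simp
  · by_cases ht₂ : f₂ u = ⊤
    · have h0 : f₁ u = 0 := by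
        by_contra h0
        exact hu (by rw [ht₂, ENNReal.mul_top h0])
      rw [← hu₁ ht₁, h0]
      simp
    · rw [hu₁ ht₁, hu₂ ht₂]

/-- A piece of the antiderivative that belongs to a zero piece of `g` is the constant that `atTop`
and `atBot` read off. -/
theorem PW.ev_look_antideriv_const {g : PW ℝ} {x : ℝ} (h : ∀ y, (g.look x).ev y = 0) :
    (((antideriv g).val.look x).headD 0) = (antideriv g).val.ev x := by
  have hd (y : ℝ) := hasDerivAt_look_antideriv g x y
  simp only [h] at hd
  have hconst := is_const_of_deriv_eq_zero (fun y => (hd y).differentiableAt)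
    (fun y => (hd y).deriv)
  exact (Poly.headD_eq_of_infinite _ _ Set.univ Set.infinite_univ fun y _ => hconst y x).1

/-- If `g` represents the integrand `f` and `h` is the indicator of a finite union of intervals with
end points in `Y` on which `f` has a finite integral, then this integral is the signed sum of the
values of an antiderivative of `g` at the end points. -/
theorem toReal_lintegral_eq {g : PW ℝ} {f : ℝ → ℝ≥0∞} (hgf : Represents g f) (Y : Finset ℝ)
    (h : ℝ → Bool) (hm : Measurable h)
    (hh : ∀ u u', u ∉ Y → u' ∉ Y → (∀ y ∈ Y, y < u ↔ y < u') → h u = h u')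
    (hfin : ∫⁻ u, (if h u then f u else 0) ≠ ⊤)
    (b c : ℝ → ℝ) (hb : ∀ y ∈ Y, b y < y ∧ ∀ z ∈ Y, z < y → z < b y)
    (hc : ∀ y ∈ Y, y < c y ∧ ∀ z ∈ Y, y < z → c y < z)
    (u₀ : ℝ) (hu₀ : ∀ y ∈ Y, u₀ < y) (w₀ : ℝ) (hw₀ : ∀ y ∈ Y, y < w₀) :
    (∫⁻ u, (if h u then f u else 0)).toReal =
      (if h w₀ then (PW.atTop (PW.antideriv g).val).val else 0) -
          (if h u₀ then (PW.atBot (PW.antideriv g).val).val else 0) +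
        ∑ y ∈ Y, ((if h (b y) then 1 else 0) - (if h (c y) then 1 else 0)) *
          (PW.antideriv g).val.ev y := by
  obtain ⟨hg, hfm, hae⟩ := hgf
  set F := (PW.antideriv g).val with hF
  set φ : ℝ → ℝ := fun u => if h u then 1 else 0 with hφdef
  have hA : MeasurableSet {u | h u = true} := hm (measurableSet_singleton true)
  have hφm : Measurable φ := Measurable.ite hA measurable_const measurable_const
  have hφh : ∀ u u', u ∉ Y → u' ∉ Y → (∀ y ∈ Y, y < u ↔ y < u') → φ u = φ u' :=
    fun u u' hu hu' huu => by simp only [hφdef, hh u u' hu hu' huu]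
  have hu₀Y : u₀ ∉ Y := fun h => lt_irrefl _ (hu₀ _ h)
  have hw₀Y : w₀ ∉ Y := fun h => lt_irrefl _ (hw₀ _ h)
  -- Almost everywhere, the integrand is finite and given by `g`.
  have hfm' : Measurable fun u => if h u then f u else 0 := Measurable.ite hA hfm measurable_const
  have hae' : ∀ᵐ u, h u = true → 0 ≤ g.ev u ∧ f u = ENNReal.ofReal (g.ev u) := by
    filter_upwards [hae, ae_lt_top hfm' hfin] with u hu₁ hu₂ hu
    rw [if_pos hu] at hu₂
    rw [← hu₁ hu₂.ne]
    exact ⟨ENNReal.toReal_nonneg, (ENNReal.ofReal_toReal hu₂.ne).symm⟩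
  have hae'' : (fun u => if h u then f u else 0) =ᵐ[volume]
      fun u => ENNReal.ofReal (φ u * g.ev u) := by
    filter_upwards [hae'] with u hu
    by_cases hhu : h u = true
    · simp [hφdef, hhu, (hu hhu).2]
    · simp [hφdef, hhu]
  have hfin' : ∫⁻ u, ENNReal.ofReal (φ u * g.ev u) ≠ ⊤ := by rwa [← lintegral_congr_ae hae'']
  have hint : (∫⁻ u, (if h u then f u else 0)).toReal = ∫ u, φ u * g.ev u := by
    rw [lintegral_congr_ae hae'', integral_eq_lintegral_of_nonneg_ae]
    · filter_upwards [hae'] with u hu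
      by_cases hhu : h u = true
      · simp [hφdef, hhu, (hu hhu).1]
      · simp [hφdef, hhu]
    · exact (hφm.mul (PW.measurable_ev g)).aestronglyMeasurable
  -- Outside `[a, b]`, there are no end points of intervals and no breakpoints.
  obtain ⟨a, ha⟩ : ∃ a, ∀ y ∈ Y ∪ insert u₀ (insert w₀ g.bpts.toFinset), a < y := by
    obtain ⟨a, ha⟩ := (Y ∪ insert u₀ (insert w₀ g.bpts.toFinset)).bddBelow
    exact ⟨a - 1, fun y hy => by linarith [ha hy]⟩
  obtain ⟨d, hd⟩ : ∃ d, ∀ y ∈ Y ∪ insert u₀ (insert w₀ g.bpts.toFinset), y < d := by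
    obtain ⟨a, ha⟩ := (Y ∪ insert u₀ (insert w₀ g.bpts.toFinset)).bddAbove
    exact ⟨a + 1, fun y hy => by linarith [ha hy]⟩
  simp only [Finset.mem_union, Finset.mem_insert, List.mem_toFinset] at ha hd
  have haφ : ∀ u ≤ a, h u = h u₀ := fun u hu => by
    refine hh _ _ (fun hY => ?_) hu₀Y fun y hy => ?_
    · linarith [ha u (Or.inl hY)]
    · exact iff_of_false (by linarith [ha y (Or.inl hy)]) (hu₀ y hy).not_gt
  have hdφ : ∀ u, d ≤ u → h u = h w₀ := fun u hu => by
    refine hh _ _ (fun hY => ?_) hw₀Y fun y hy => ?_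
    · linarith [hd u (Or.inl hY)]
    · exact iff_of_true (by linarith [hd y (Or.inl hy)]) (hw₀ y hy)
  have hag : ∀ u ≤ a, g.look u = g.look a := fun u hu => PW.look_congr g fun y hy =>
    iff_of_false (by linarith [ha y (by simp [hy])]) (by linarith [ha y (by simp [hy])])
  have hdg : ∀ u, d ≤ u → g.look u = g.look d := fun u hu => PW.look_congr g fun y hy =>
    iff_of_true (by linarith [hd y (by simp [hy])]) (by linarith [hd y (by simp [hy])])
  -- An unbounded interval on which the integral is finite carries the zero polynomial.
  have hzeroa : h u₀ = true → ∀ y, (g.look a).ev y = 0 := fun hu => by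
    refine Poly.ev_eq_zero_of_lintegral_ne_top' _ a ?_ ?_
    · filter_upwards [hae'] with u hu₁ hua
      have := (hu₁ ((haφ u hua.le).trans hu)).1
      rwa [PW.ev, hag u hua.le] at this
    · refine ne_top_of_le_ne_top hfin' ?_
      refine le_trans (le_of_eq ?_) (setLIntegral_le_lintegral (Set.Iio a) _)
      refine setLIntegral_congr_fun measurableSet_Iio fun u hua => ?_
      have hua' : u ≤ a := le_of_lt hua
      simp [hφdef, haφ u hua', hu, PW.ev, hag u hua']
  have hzerod : h w₀ = true → ∀ y, (g.look d).ev y = 0 := fun hw => by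
    refine Poly.ev_eq_zero_of_lintegral_ne_top _ d ?_ ?_
    · filter_upwards [hae'] with u hu₁ hua
      have := (hu₁ ((hdφ u hua.le).trans hw)).1
      rwa [PW.ev, hdg u hua.le] at this
    · refine ne_top_of_le_ne_top hfin' ?_
      refine le_trans (le_of_eq ?_) (setLIntegral_le_lintegral (Set.Ioi d) _)
      refine setLIntegral_congr_fun measurableSet_Ioi fun u hua => ?_
      have hua' : d ≤ u := le_of_lt hua
      simp [hφdef, hdφ u hua', hw, PW.ev, hdg u hua']
  have hsupp : Function.support (fun u => φ u * g.ev u) ⊆ Set.Ioc a d := by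
    intro u hu
    by_contra hnot
    refine hu ?_
    rw [Set.mem_Ioc, not_and_or, not_lt, not_le] at hnot
    rcases hnot with hua | hud
    · by_cases hu' : h u₀ = true
      · simp [PW.ev, hag u hua, hzeroa hu']
      · simp [hφdef, haφ u hua, hu']
    · by_cases hw' : h w₀ = true
      · simp [PW.ev, hdg u hud.le, hzerod hw']
      · simp [hφdef, hdφ u hud.le, hw']
  have hφ₁ : ∀ u, |φ u| ≤ 1 := fun u => by
    simp only [hφdef]
    split_ifs <;> simp
  have hstep := integral_step_mul hg Y φ hφm hφ₁ (fun y => φ (c y) - φ (b y)) (φ u₀) a d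
    (fun u hu => eq_add_sum_jumps Y φ hφh b c hb hc u₀ hu₀ u hu)
    (fun y hy => ha y (Or.inl hy)) (fun y hy => hd y (Or.inl hy))
  rw [hint, ← intervalIntegral.integral_eq_integral_of_support_subset hsupp, hstep]
  have htop : φ d * F.ev d = if h w₀ then (PW.atTop F).val else 0 := by
    by_cases hw : h w₀ = true
    · rw [PW.val_atTop F (x := d), PW.ev_look_antideriv_const (hzerod hw)]
      · simp [hφdef, hdφ d le_rfl, hw, hF]
      · rw [hF, PW.bpts_antideriv]
        exact fun y hy => (hd y (by simp [hy])).le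
    · simp [hφdef, hdφ d le_rfl, hw]
  have hbot : φ u₀ * F.ev a = if h u₀ then (PW.atBot F).val else 0 := by
    by_cases hu : h u₀ = true
    · rw [PW.val_atBot F (x := a), PW.ev_look_antideriv_const (hzeroa hu)]
      · simp [hφdef, hu, hF]
      · rw [hF, PW.bpts_antideriv]
        exact fun y hy => ha y (by simp [hy])
    · simp [hφdef, hu]
  rw [htop, hbot, sub_eq_add_neg _ (∑ y ∈ Y, _), ← Finset.sum_neg_distrib]
  congr 1
  refine Finset.sum_congr rfl fun y _ => ?_
  simp only [hφdef]
  ring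

end Integration

/-! ### The exact messages -/

section Exact

variable {n : ℕ}

theorem lmarginal_mul_left (s : Finset (Fin n)) (f g : (Fin n → ℝ) → ℝ≥0∞) (hg : Measurable g)
    (hf : ∀ x y, (∀ k, k ∉ s → x k = y k) → f x = f y) (x : Fin n → ℝ) :
    (∫⋯∫⁻_s, (fun z => f z * g z) ∂fun _ => volume) x =
      f x * (∫⋯∫⁻_s, g ∂fun _ => volume) x := by
  simp only [lmarginal]
  rw [← lintegral_const_mul]
  · refine lintegral_congr fun y => ?_
    rw [hf (Function.updateFinset x s y) x fun k hk => by simp [Function.updateFinset, hk]]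
  · exact hg.comp measurable_updateFinset

theorem lmarginal_congr_of_dependsOn (s t : Finset (Fin n)) (f : (Fin n → ℝ) → ℝ≥0∞)
    (hf : ∀ x y, (∀ k, k ∈ s ∪ t → x k = y k) → f x = f y) {x x' : Fin n → ℝ}
    (hx : ∀ k ∈ t, x k = x' k) :
    (∫⋯∫⁻_s, f ∂fun _ => volume) x = (∫⋯∫⁻_s, f ∂fun _ => volume) x' := by
  simp only [lmarginal]
  refine lintegral_congr fun y => hf _ _ fun k hk => ?_
  by_cases hks : k ∈ s
  · simp [Function.updateFinset, hks]
  · simp only [Function.updateFinset, hks, dif_neg, not_false_eq_true]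
    exact hx k ((Finset.mem_union.1 hk).resolve_left hks)

theorem Literal.holds_congr (ℓ : Literal n ℝ) {x y : Fin n → ℝ}
    (h : ∀ k, ℓ.coeff k ≠ 0 → x k = y k) : ℓ.Holds x ↔ ℓ.Holds y := by
  have : ∑ k, ℓ.coeff k * x k = ∑ k, ℓ.coeff k * y k := by
    refine Finset.sum_congr rfl fun k _ => ?_
    by_cases hk : ℓ.coeff k = 0
    · simp [hk]
    · rw [h k hk]
  rw [Literal.Holds, Literal.Holds, this]

theorem Literal.measurableSet_holds (ℓ : Literal n ℝ) : MeasurableSet {x | ℓ.Holds x} := by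
  have h : Measurable fun x : Fin n → ℝ => ∑ k, ℓ.coeff k * x k := by fun_prop
  have : MeasurableSet {x : Fin n → ℝ | ℓ.rel.Holds (∑ k, ℓ.coeff k * x k) ℓ.const} := by
    cases ℓ.rel
    · exact measurableSet_lt h measurable_const
    · exact measurableSet_le h measurable_const
    · exact measurableSet_eq_fun h measurable_const
  simp only [Literal.Holds]
  cases ℓ.pos
  · simp only [Bool.false_eq_true, iff_false]
    exact this.compl
  · simp only [iff_true]
    exact this

/-- All clauses of `Δ` selected by `p` hold at `x`. -/
def SatOn (Δ : CNF n ℝ) (p : Clause n ℝ → Prop) (x : Fin n → ℝ) : Prop :=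
  ∀ Γ ∈ Δ, p Γ → ∃ ℓ ∈ Γ, ℓ.Holds x

theorem measurableSet_satOn (Δ : CNF n ℝ) (p : Clause n ℝ → Prop) :
    MeasurableSet {x | SatOn Δ p x} := by
  have h (Γ : Clause n ℝ) : MeasurableSet {x | ∃ ℓ ∈ Γ, ℓ.Holds x} := by
    induction Γ with
    | nil => simp
    | cons ℓ Γ ih =>
      simp only [List.exists_mem_cons_iff]
      exact ℓ.measurableSet_holds.union ih
  induction Δ with
  | nil => simp [SatOn]
  | cons Γ Δ ih =>
    simp only [SatOn, List.forall_mem_cons] at ih ⊢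
    refine MeasurableSet.inter ?_ ih
    by_cases hp : p Γ
    · simp only [hp, true_implies]
      exact h Γ
    · simp only [hp, false_implies]
      exact MeasurableSet.univ

variable (Δ : CNF n ℝ)

/-- The clauses that concern the branch of `i` at `j`: those in which one of its variables appears,
and those without variables, which belong to the formula `Δ_i` of every node `i`. -/
def OnBranch (i j : Fin n) (Γ : Clause n ℝ) : Prop :=
  (∃ k ∈ branch (primalGraph Δ) i j, Appears k Γ) ∨ ∀ k, ¬ Appears k Γ

/-- The indicator function of the clauses that concern the branch of `i` at `j`. -/
noncomputable def branchIndicator (i j : Fin n) : (Fin n → ℝ) → ℝ≥0∞ :=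
  {x | SatOn Δ (OnBranch Δ i j) x}.indicator 1

/-- The exact message from `i` to `j`: the integral of the indicator function of the branch of `i`
at `j` over all variables of the branch. It depends on the variable `X_j` alone, so the other
coordinates of the point at which it is evaluated do not matter. -/
noncomputable def exactMessage (i j : Fin n) (v : ℝ) : ℝ≥0∞ :=
  (∫⋯∫⁻_branch (primalGraph Δ) i j, branchIndicator Δ i j ∂fun _ => volume) fun _ => v

theorem measurable_branchIndicator (i j : Fin n) : Measurable (branchIndicator Δ i j) :=
  measurable_one.indicator (measurableSet_satOn _ _)

theorem measurable_exactMessage (i j : Fin n) : Measurable (exactMessage Δ i j) :=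
  ((measurable_branchIndicator Δ i j).lmarginal _).comp
    (measurable_pi_lambda _ fun _ => measurable_id)

variable {Δ}

theorem adj_of_appears {Γ : Clause n ℝ} (hΓ : Γ ∈ Δ) {i j : Fin n} (hi : Appears i Γ)
    (hj : Appears j Γ) (h : i ≠ j) : (primalGraph Δ).Adj i j := ⟨h, Γ, hΓ, hi, hj⟩

theorem exists_holds_congr {Γ : Clause n ℝ} {x y : Fin n → ℝ}
    (h : ∀ k, Appears k Γ → x k = y k) : (∃ ℓ ∈ Γ, ℓ.Holds x) ↔ ∃ ℓ ∈ Γ, ℓ.Holds y :=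
  exists_congr fun ℓ => and_congr_right fun hℓ => ℓ.holds_congr fun k hk => h k ⟨ℓ, hℓ, hk⟩

/-- The clauses that concern a branch contain no variables but those of the branch and its parent.
-/
theorem branchIndicator_congr (hG : (primalGraph Δ).IsTree) {i j : Fin n}
    (hij : (primalGraph Δ).Adj i j)
    (x y : Fin n → ℝ) (h : ∀ k ∈ branch (primalGraph Δ) i j ∪ {j}, x k = y k) :
    branchIndicator Δ i j x = branchIndicator Δ i j y := by
  have : SatOn Δ (OnBranch Δ i j) x ↔ SatOn Δ (OnBranch Δ i j) y := by
    refine forall₂_congr fun Γ hΓ => forall_congr' fun hp => exists_holds_congr fun l hl => ?_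
    rcases hp with ⟨k, hk, hkΓ⟩ | hp
    · refine h l (Finset.mem_union.2 ?_)
      by_contra hnot
      rw [not_or, Finset.mem_singleton] at hnot
      refine hnot.2 (eq_of_adj_of_notMem_branch hG hij ?_ hk hnot.1)
      exact adj_of_appears hΓ hkΓ hl (by rintro rfl; exact hnot.1 hk)
    · exact absurd hl (hp l)
  classical
  simp only [branchIndicator, Set.indicator_apply, Set.mem_ofPred_eq, this, Pi.one_apply]

theorem lmarginal_branchIndicator (hG : (primalGraph Δ).IsTree) {i j : Fin n}
    (hij : (primalGraph Δ).Adj i j)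
    (x : Fin n → ℝ) :
    (∫⋯∫⁻_branch (primalGraph Δ) i j, branchIndicator Δ i j ∂fun _ => volume) x =
      exactMessage Δ i j (x j) :=
  lmarginal_congr_of_dependsOn _ {j} _ (branchIndicator_congr hG hij) (by simp)

/-- A tree has no triangles, so that no clause contains three variables. -/
theorem not_appears_of_edge (hG : (primalGraph Δ).IsTree) {i j k : Fin n} (hij : i ≠ j)
    {Γ : Clause n ℝ}
    (hΓ : Γ ∈ Δ) (hi : Appears i Γ) (hj : Appears j Γ) (hki : k ≠ i) (hkj : k ≠ j) :
    ¬ Appears k Γ := by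
  intro hk
  have h₁ := dist_adj hG (adj_of_appears hΓ hi hj hij) k
  rw [SimpleGraph.dist_eq_one_iff_adj.2 (adj_of_appears hΓ hk hi hki),
    SimpleGraph.dist_eq_one_iff_adj.2 (adj_of_appears hΓ hk hj hkj)] at h₁
  omega

theorem sat_edgeFormula (hG : (primalGraph Δ).IsTree) {i j : Fin n} (hij : i ≠ j) (x : Fin n → ℝ) :
    Sat (edgeFormula Δ i j).val x ↔
      (edgeTest (edgeFormula Δ i j).val i j (x i) (x j)).val = true := by
  rw [edgeTest_eq_true]
  refine forall₂_congr fun Γ hΓ => exists_congr fun ℓ => and_congr_right fun hℓ => ?_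
  obtain ⟨hΓ, hi, hj⟩ := mem_edgeFormula.1 hΓ
  rw [Literal.Holds, Finset.sum_eq_add i j hij]
  · rintro k _ ⟨hki, hkj⟩
    have : ℓ.coeff k = 0 := by
      by_contra h
      exact not_appears_of_edge hG hij hΓ hi hj hki hkj ⟨ℓ, hℓ, h⟩
    rw [this, zero_mul]
  · simp
  · simp

/-- The clauses that concern a branch are those of the edge at which it was cut off, those of its
root, and those that concern the branches at its root. -/
theorem satOn_branch_iff (hG : (primalGraph Δ).IsTree) {i j : Fin n}
    (hij : (primalGraph Δ).Adj i j) (cs : List (Fin n))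
    (hcs : ∀ c, c ∈ cs ↔ (primalGraph Δ).Adj c i ∧ c ≠ j) (x : Fin n → ℝ) :
    SatOn Δ (OnBranch Δ i j) x ↔
      Sat (edgeFormula Δ i j).val x ∧ Sat (nodeFormula Δ i).val x ∧
        ∀ c ∈ cs, SatOn Δ (OnBranch Δ c i) x := by
  constructor
  · intro h
    refine ⟨fun Γ hΓ => ?_, fun Γ hΓ => ?_, fun c hc Γ hΓ hp => h Γ hΓ ?_⟩
    · obtain ⟨hΓ, hi, -⟩ := mem_edgeFormula.1 hΓ
      exact h Γ hΓ (Or.inl ⟨i, self_mem_branch hij, hi⟩)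
    · obtain ⟨hΓ, hk⟩ := mem_nodeFormula.1 hΓ
      refine h Γ hΓ ?_
      by_cases hi : Appears i Γ
      · exact Or.inl ⟨i, self_mem_branch hij, hi⟩
      · refine Or.inr fun k => ?_
        by_cases hki : k = i
        · rwa [hki]
        · exact hk k hki
    · obtain ⟨hc, hcj⟩ := (hcs c).1 hc
      rcases hp with ⟨k, hk, hkΓ⟩ | hp
      · exact Or.inl ⟨k, branch_subset hG hij.symm hc hcj hk, hkΓ⟩
      · exact Or.inr hp
  · rintro ⟨he, hn, hc⟩ Γ hΓ hp
    by_cases hnode : ∀ k, k ≠ i → ¬ Appears k Γ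
    · exact hn Γ (mem_nodeFormula.2 ⟨hΓ, hnode⟩)
    · rcases hp with ⟨k, hk, hkΓ⟩ | hp
      · rcases mem_branch_cases hG hk with rfl | ⟨c, hci, hcj, hkc⟩
        · push Not at hnode
          obtain ⟨l, hlk, hl⟩ := hnode
          by_cases hlj : l = j
          · exact he Γ (mem_edgeFormula.2 ⟨hΓ, hkΓ, hlj ▸ hl⟩)
          · have hadj := adj_of_appears hΓ hl hkΓ hlk
            exact hc l ((hcs l).2 ⟨hadj, hlj⟩) Γ hΓ (Or.inl ⟨l, self_mem_branch hadj, hl⟩)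
        · exact hc c ((hcs c).2 ⟨hci, hcj⟩) Γ hΓ (Or.inl ⟨k, hkc, hkΓ⟩)
      · exact absurd (fun k _ => hp k) hnode

theorem sat_iff_branches (hG : (primalGraph Δ).IsTree) (r : Fin n) (cs : List (Fin n))
    (hcs : ∀ c, c ∈ cs ↔ (primalGraph Δ).Adj c r) (x : Fin n → ℝ) :
    Sat Δ x ↔ Sat (nodeFormula Δ r).val x ∧ ∀ c ∈ cs, SatOn Δ (OnBranch Δ c r) x := by
  constructor
  · intro h
    exact ⟨fun Γ hΓ => h Γ (mem_nodeFormula.1 hΓ).1, fun c _ Γ hΓ _ => h Γ hΓ⟩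
  · rintro ⟨hn, hc⟩ Γ hΓ
    by_cases hnode : ∀ k, k ≠ r → ¬ Appears k Γ
    · exact hn Γ (mem_nodeFormula.2 ⟨hΓ, hnode⟩)
    · push Not at hnode
      obtain ⟨k, hkr, hk⟩ := hnode
      obtain ⟨c, hcr, hkc⟩ := exists_mem_branch hG hkr
      exact hc c ((hcs c).2 hcr) Γ hΓ (Or.inl ⟨k, hkc, hk⟩)

theorem prod_indicator (cs : List (Fin n)) (A : Fin n → Set (Fin n → ℝ)) (x : Fin n → ℝ) :
    (cs.map fun c => (A c).indicator (1 : (Fin n → ℝ) → ℝ≥0∞) x).prod =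
      {x | ∀ c ∈ cs, x ∈ A c}.indicator 1 x := by
  classical
  induction cs with
  | nil => simp
  | cons c cs ih =>
    rw [List.map_cons, List.prod_cons, ih]
    simp only [Set.indicator_apply, Set.mem_ofPred_eq, List.forall_mem_cons, Pi.one_apply]
    split_ifs <;> simp_all

theorem measurable_prod_branchIndicator (i : Fin n) (cs : List (Fin n)) :
    Measurable fun z => (cs.map fun c => branchIndicator Δ c i z).prod := by
  simp only [branchIndicator, prod_indicator]
  refine measurable_one.indicator ?_
  rw [show {x | ∀ c ∈ cs, x ∈ {x | SatOn Δ (OnBranch Δ c i) x}} =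
    ⋂ c ∈ cs.toFinset, {x | SatOn Δ (OnBranch Δ c i) x} by ext; simp]
  exact Finset.measurableSet_biInter _ fun c _ => measurableSet_satOn _ _

/-- Different branches at a vertex have no variables in common, so that the integral of the product
of their indicator functions is the product of the messages. -/
theorem lmarginal_prod (hG : (primalGraph Δ).IsTree) (i : Fin n) (cs : List (Fin n))
    (hnd : cs.Nodup)
    (hcs : ∀ c ∈ cs, (primalGraph Δ).Adj c i) (x : Fin n → ℝ) :
    (∫⋯∫⁻_cs.toFinset.biUnion (fun c => branch (primalGraph Δ) c i),
      (fun z => (cs.map fun c => branchIndicator Δ c i z).prod) ∂fun _ => volume) x =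
      (cs.map fun c => exactMessage Δ c i (x i)).prod := by
  induction cs generalizing x with
  | nil => simp
  | cons c cs ih =>
    rw [List.nodup_cons] at hnd
    simp only [List.forall_mem_cons] at hcs
    simp only [List.map_cons, List.prod_cons, List.toFinset_cons, Finset.biUnion_insert]
    have hm := measurable_prod_branchIndicator (Δ := Δ) i cs
    have hdisj : Disjoint (branch (primalGraph Δ) c i)
        (cs.toFinset.biUnion fun c => branch (primalGraph Δ) c i) := by
      rw [Finset.disjoint_biUnion_right]
      intro c' hc'
      rw [List.mem_toFinset] at hc'
      exact disjoint_branch hG hcs.1 (hcs.2 c' hc') (by rintro rfl; exact hnd.1 hc')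
    have hi : i ∉ cs.toFinset.biUnion fun c => branch (primalGraph Δ) c i := by simp [notMem_branch]
    have hmul : Measurable fun z =>
        branchIndicator Δ c i z * (cs.map fun c => branchIndicator Δ c i z).prod :=
      (measurable_branchIndicator Δ c i).mul hm
    rw [lmarginal_union _ _ hmul hdisj]
    have h₁ : (∫⋯∫⁻_cs.toFinset.biUnion (fun c => branch (primalGraph Δ) c i), (fun z =>
        branchIndicator Δ c i z * (cs.map fun c => branchIndicator Δ c i z).prod) ∂fun _ => volume) =
        fun z => (cs.map fun c => exactMessage Δ c i (z i)).prod * branchIndicator Δ c i z := by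
      funext z
      rw [lmarginal_mul_left _ _ _ hm, ih hnd.2 hcs.2, mul_comm]
      intro y y' hy
      refine branchIndicator_congr hG hcs.1 _ _ fun k hk => hy k fun hk' => ?_
      rcases Finset.mem_union.1 hk with hk | hk
      · exact Finset.disjoint_left.1 hdisj hk hk'
      · rw [Finset.mem_singleton.1 hk] at hk'
        exact hi hk'
    rw [h₁, lmarginal_mul_left _ _ _ (measurable_branchIndicator Δ c i),
      lmarginal_branchIndicator hG hcs.1, mul_comm]
    intro y y' hy
    rw [hy i notMem_branch]

/-- The integral over the root of a branch and the branches at this root, where the factor `A`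
depends only on variables outside the latter. -/
theorem lmarginal_insert_mul_prod (hG : (primalGraph Δ).IsTree) (i : Fin n) (cs : List (Fin n))
    (hnd : cs.Nodup) (hcs : ∀ c ∈ cs, (primalGraph Δ).Adj c i) (A : (Fin n → ℝ) → ℝ≥0∞)
    (hA : ∀ x y, (∀ k, k ∉ cs.toFinset.biUnion (fun c => branch (primalGraph Δ) c i) → x k = y k) →
      A x = A y)
    (hm : Measurable fun z => A z * (cs.map fun c => branchIndicator Δ c i z).prod)
    (x : Fin n → ℝ) :
    (∫⋯∫⁻_insert i (cs.toFinset.biUnion fun c => branch (primalGraph Δ) c i),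
      (fun z => A z * (cs.map fun c => branchIndicator Δ c i z).prod) ∂fun _ => volume) x =
      ∫⁻ u, A (Function.update x i u) * (cs.map fun c => exactMessage Δ c i u).prod := by
  have hi : i ∉ cs.toFinset.biUnion fun c => branch (primalGraph Δ) c i := by simp [notMem_branch]
  rw [lmarginal_insert _ hm hi]
  refine lintegral_congr fun u => ?_
  rw [lmarginal_mul_left _ _ _ (measurable_prod_branchIndicator i cs) hA,
    lmarginal_prod hG i cs hnd hcs, Function.update_self]

/-- The exact messages satisfy the recursion that defines the messages of the algorithm. -/
theorem exactMessage_eq (hG : (primalGraph Δ).IsTree) {i j : Fin n} (hij : (primalGraph Δ).Adj i j)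
    (cs : List (Fin n))
    (hnd : cs.Nodup) (hcs : ∀ c, c ∈ cs ↔ (primalGraph Δ).Adj c i ∧ c ≠ j) (v : ℝ) :
    exactMessage Δ i j v =
      ∫⁻ u, if (edgeTest (edgeFormula Δ i j).val i j u v).val then
        (if (nodeTest (nodeFormula Δ i).val i u).val then 1 else 0) *
          (cs.map fun c => exactMessage Δ c i u).prod else 0 := by
  have hbranch : branch (primalGraph Δ) i j =
      insert i (cs.toFinset.biUnion fun c => branch (primalGraph Δ) c i) := by
    ext k
    simp only [Finset.mem_insert, Finset.mem_biUnion, List.mem_toFinset, hcs]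
    constructor
    · intro hk
      rcases mem_branch_cases hG hk with rfl | ⟨c, hc, hcj, hk⟩
      · exact Or.inl rfl
      · exact Or.inr ⟨c, ⟨hc, hcj⟩, hk⟩
    · rintro (rfl | ⟨c, ⟨hc, hcj⟩, hk⟩)
      · exact self_mem_branch hij
      · exact branch_subset hG hij.symm hc hcj hk
  have hi : i ∉ cs.toFinset.biUnion fun c => branch (primalGraph Δ) c i := by simp [notMem_branch]
  have hj : j ∉ cs.toFinset.biUnion fun c => branch (primalGraph Δ) c i := fun h =>
    (notMem_branch : j ∉ branch (primalGraph Δ) i j) (hbranch ▸ Finset.mem_insert_of_mem h)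
  have hfac : branchIndicator Δ i j = fun z =>
      (if (edgeTest (edgeFormula Δ i j).val i j (z i) (z j)).val then
        (if (nodeTest (nodeFormula Δ i).val i (z i)).val then 1 else 0) else 0) *
          (cs.map fun c => branchIndicator Δ c i z).prod := by
    classical
    funext z
    simp only [branchIndicator, prod_indicator]
    simp only [Set.indicator_apply, Set.mem_ofPred_eq, satOn_branch_iff hG hij cs hcs,
      sat_edgeFormula hG hij.ne, sat_nodeFormula, Pi.one_apply]
    split_ifs <;> simp_all
  rw [exactMessage, hbranch, hfac, lmarginal_insert_mul_prod hG i cs hnd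
    (fun c hc => ((hcs c).1 hc).1) _ (fun y y' hy => by rw [hy i hi, hy j hj])
    (hfac ▸ measurable_branchIndicator Δ i j)]
  refine lintegral_congr fun u => ?_
  simp only [Function.update_self, Function.update_of_ne hij.ne.symm]
  split_ifs <;> simp

theorem MI_eq (hG : (primalGraph Δ).IsTree) (r : Fin n) (cs : List (Fin n))
    (hnd : cs.Nodup) (hcs : ∀ c, c ∈ cs ↔ (primalGraph Δ).Adj c r) :
    MI Δ = ∫⁻ u, (if (nodeTest (nodeFormula Δ r).val r u).val then 1 else 0) *
      (cs.map fun c => exactMessage Δ c r u).prod := by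
  have huniv : Finset.univ =
      insert r (cs.toFinset.biUnion fun c => branch (primalGraph Δ) c r) := by
    ext k
    simp only [Finset.mem_univ, Finset.mem_insert, Finset.mem_biUnion, List.mem_toFinset, hcs,
      true_iff]
    by_cases hk : k = r
    · exact Or.inl hk
    · exact Or.inr (exists_mem_branch hG hk)
  have hr : r ∉ cs.toFinset.biUnion fun c => branch (primalGraph Δ) c r := by simp [notMem_branch]
  have hfac : {x | Sat Δ x}.indicator (1 : (Fin n → ℝ) → ℝ≥0∞) = fun z =>
      (if (nodeTest (nodeFormula Δ r).val r (z r)).val then 1 else 0) *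
        (cs.map fun c => branchIndicator Δ c r z).prod := by
    classical
    funext z
    simp only [branchIndicator, prod_indicator]
    simp only [Set.indicator_apply, Set.mem_ofPred_eq, sat_iff_branches hG r cs hcs,
      sat_nodeFormula, Pi.one_apply]
    split_ifs <;> simp_all
  have hm : Measurable ({x | Sat Δ x}.indicator (1 : (Fin n → ℝ) → ℝ≥0∞)) := by
    have := measurableSet_satOn Δ fun _ => True
    simp only [SatOn, true_implies] at this
    exact measurable_one.indicator this
  rw [MI, volume_pi, lintegral_eq_lmarginal_univ 0, huniv, hfac, lmarginal_insert_mul_prod hG r cs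
    hnd (fun c hc => (hcs c).1 hc) _ (fun y y' hy => by rw [hy r hr]) (hfac ▸ hm)]
  simp only [Function.update_self]

end Exact

/-! ### Messages computed by symbolic integration -/

theorem length_le_of_pairwise_lt {l l' : List ℝ} (h : l.Pairwise (· < ·))
    (hs : ∀ x ∈ l, x ∈ l') : l.length ≤ l'.length :=
  (List.subperm_of_subset (h.imp ne_of_lt) hs).length_le

theorem PW.length_bpts_mul_le {f g : PW ℝ} (hf : f.Sorted) (hg : g.Sorted) :
    (PW.mul f g).val.bpts.length ≤ f.bpts.length + g.bpts.length := by
  rw [← List.length_append]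
  refine length_le_of_pairwise_lt (PW.sorted_zip _ hf hg) fun x hx => ?_
  rw [List.mem_append]
  exact (PW.mem_bpts_zip _ _ _ _).1 hx

theorem ae_notMem_list (l : List ℝ) : ∀ᵐ u : ℝ, u ∉ l := by
  filter_upwards [(l.finite_toSet).countable.ae_notMem volume] with u hu using hu

section Message

variable {n : ℕ} {Δ : CNF n ℝ}

/-- The formulas of a vertex and of the edges at it have no clauses in common. For this reason the
numbers of breakpoints multiply only along paths of the tree, while they add up over the neighbours
of a vertex. -/
theorem numLiterals_star_le (hG : (primalGraph Δ).IsTree) (i : Fin n) (cs : List (Fin n))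
    (hnd : cs.Nodup) (hcs : ∀ c ∈ cs, (primalGraph Δ).Adj c i) :
    numLiterals (nodeFormula Δ i).val +
      (cs.map fun c => numLiterals (edgeFormula Δ c i).val).sum ≤ numLiterals Δ := by
  classical
  have h := sum_numLiterals_filter_le
    ((fun Γ => decide (∀ k, k ≠ i → ¬ Appears k Γ)) ::
      cs.map fun c Γ => decide (Appears c Γ ∧ Appears i Γ)) Δ ?_
  · rw [val_nodeFormula]
    simp only [val_edgeFormula]
    simpa [List.map_map, Function.comp_def] using h
  · rw [List.pairwise_cons, List.pairwise_map]
    refine ⟨?_, ?_⟩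
    · intro q hq Γ _ h
      obtain ⟨c, hc, rfl⟩ := List.mem_map.1 hq
      simp only [decide_eq_true_eq, decide_eq_false_iff_not] at h ⊢
      exact fun h' => h c (hcs c hc).ne h'.1
    · refine hnd.imp_of_mem fun {c c'} hc hc' hne Γ hΓ h => ?_
      simp only [decide_eq_true_eq, decide_eq_false_iff_not] at h ⊢
      exact fun h' => not_appears_of_edge hG (hcs c hc).ne hΓ h.1 h.2 hne.symm
        (hcs c' hc').ne h'.1

/-- `g` represents the message from `i` to `j`, its number of breakpoints is at most exponential in
the number of levels of the branch of `i` at `j`, and its degree is at most the number of vertices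
of this branch. -/
structure IsMessage (Δ : CNF n ℝ) (g : PW ℝ) (i j : Fin n) : Prop where
  represents : Represents g (exactMessage Δ i j)
  length_le : g.bpts.length ≤ numLiterals (edgeFormula Δ i j).val *
    numLiterals Δ ^ branchDepth (primalGraph Δ) i j
  coeffsLe : g.CoeffsLe ((branch (primalGraph Δ) i j).card + 1)

theorem Represents.congr {g : PW ℝ} {f f' : ℝ → ℝ≥0∞} (h : Represents g f) (hf : f = f') :
    Represents g f' := hf ▸ h

/-- The product of messages, for a loop that starts with any factor `b`; in the cost bound, `K` is a
bound for the number of breakpoints of all partial products. -/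
theorem foldT_mul_spec (M : Fin n → Fin n → PW ℝ) (i : Fin n) (cs : List (Fin n))
    (hM : ∀ c ∈ cs, IsMessage Δ (M c i) c i) {b : PW ℝ} {f : ℝ → ℝ≥0∞} {s : ℕ}
    (hb : Represents b f) (hs : b.CoeffsLe (s + 1)) :
    let r := foldT (fun b c => PW.mul (M c i) b) b cs
    let t := (cs.map fun c => (branch (primalGraph Δ) c i).card).sum + s
    let k := (cs.map fun c => (M c i).bpts.length).sum + b.bpts.length
    Represents r.val (fun u => (cs.map fun c => exactMessage Δ c i u).prod * f u) ∧
      r.val.CoeffsLe (t + 1) ∧ r.val.bpts.length ≤ k ∧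
      ∀ K, t + 1 ≤ n → k ≤ K → r.steps ≤ cs.length * ((K + 1) * (n * (3 * n + 4) + 2) + 2) + 1 := by
  induction cs generalizing b f s with
  | nil => simpa [foldT] using ⟨hb, hs⟩
  | cons c cs ih =>
    have hc := hM c List.mem_cons_self
    obtain ⟨hco, hst⟩ := PW.mul_cost hc.coeffsLe hs
    obtain ⟨h₁, h₂, h₃, h₄⟩ := ih (fun c' h => hM c' (List.mem_cons_of_mem _ h))
      (hc.represents.mul hb) hco
    have hlen := PW.length_bpts_mul_le hc.represents.1 hb.1
    simp only [foldT, Timed.val_bind, Timed.steps_bind, steps_tick, List.map_cons, List.sum_cons,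
      List.prod_cons, List.length_cons] at h₁ h₂ h₃ h₄ ⊢
    refine ⟨h₁.congr (funext fun u => by ring), h₂.mono (by omega), by omega, fun K ht hk => ?_⟩
    have := h₄ K (by omega) (by omega)
    have h5 : ((M c i).bpts.length + b.bpts.length + 1) *
        (((branch (primalGraph Δ) c i).card + 1) * (3 * (s + 1) + 4) + 2) ≤
        (K + 1) * (n * (3 * n + 4) + 2) := by
      gcongr <;> omega
    rw [add_mul]
    omega

theorem PW.sorted_one : (⟨[1], []⟩ : PW ℝ).Sorted := List.Pairwise.nil

theorem represents_one : Represents ⟨[1], []⟩ fun _ => 1 :=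
  ⟨PW.sorted_one, measurable_const, Filter.Eventually.of_forall fun u _ => by
    simp [PW.ev, PW.look, PW.lookFrom, Poly.ev]⟩

theorem product_spec (M : Fin n → Fin n → PW ℝ) (i : Fin n) (cs : List (Fin n))
    (hM : ∀ c ∈ cs, IsMessage Δ (M c i) c i) :
    let t := (cs.map fun c => (branch (primalGraph Δ) c i).card).sum
    let k := (cs.map fun c => (M c i).bpts.length).sum
    Represents (product M i cs).val (fun u => (cs.map fun c => exactMessage Δ c i u).prod) ∧
      (product M i cs).val.CoeffsLe (t + 1) ∧ (product M i cs).val.bpts.length ≤ k ∧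
      ∀ K, t + 1 ≤ n → k ≤ K →
        (product M i cs).steps ≤ cs.length * ((K + 1) * (n * (3 * n + 4) + 2) + 2) + 1 := by
  obtain ⟨h₁, h₂, h₃, h₄⟩ := foldT_mul_spec (Δ := Δ) M i cs hM (s := 0) represents_one
    ⟨by simp, by simp⟩
  exact ⟨h₁.congr (by simp), h₂, h₃, h₄⟩

theorem sum_length_bpts_le {M : Fin n → Fin n → PW ℝ} {i : Fin n} {cs : List (Fin n)}
    (hM : ∀ c ∈ cs, IsMessage Δ (M c i) c i) (hm : 1 ≤ numLiterals Δ) {d : ℕ}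
    (hd : ∀ c ∈ cs, branchDepth (primalGraph Δ) c i ≤ d) :
    (cs.map fun c => (M c i).bpts.length).sum ≤
      (cs.map fun c => numLiterals (edgeFormula Δ c i).val).sum * numLiterals Δ ^ d := by
  rw [← List.sum_map_mul_right]
  refine List.sum_le_sum fun c hc => (hM c hc).length_le.trans ?_
  gcongr
  exact hd c hc

theorem represents_nodeIndicator (Δ : CNF n ℝ) (i : Fin n) :
    Represents (nodeIndicator Δ i).val
      fun u => if (nodeTest (nodeFormula Δ i).val i u).val then 1 else 0 := by
  refine ⟨sorted_nodeIndicator Δ i, ?_, ?_⟩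
  · refine Measurable.ite ?_ measurable_const measurable_const
    have h := (measurableSet_satOn (nodeFormula Δ i).val fun _ => True).preimage
      (measurable_pi_lambda (fun (u : ℝ) (_ : Fin n) => u) fun _ => measurable_id)
    convert h using 1
    ext u
    have := sat_nodeFormula Δ i fun _ => u
    simpa [SatOn, Sat] using this.symm
  · filter_upwards [ae_notMem_list (nodeIndicator Δ i).val.bpts] with u hu _
    rw [ev_nodeIndicator Δ i hu]
    split_ifs <;> simp

theorem measurable_edgeTest (hG : (primalGraph Δ).IsTree) {i j : Fin n} (hij : i ≠ j) (v : ℝ) :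
    Measurable fun u => (edgeTest (edgeFormula Δ i j).val i j u v).val := by
  refine measurable_to_bool ?_
  have h := (measurableSet_satOn (edgeFormula Δ i j).val fun _ => True).preimage
    (measurable_update (fun _ => v) (a := i))
  convert h using 1
  ext u
  have := sat_edgeFormula hG hij (Function.update (fun _ => v) i u)
  rw [Function.update_self, Function.update_of_ne hij.symm] at this
  simpa [SatOn, Sat] using this.symm

section Fold

variable {α : Type} (σ γ : α → Timed (PW ℝ))

/-- Adds the products `σ L * γ L` to `b`. -/
noncomputable def addProducts (b : PW ℝ) (S : List α) : Timed (PW ℝ) :=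
  foldT (fun m L => do
    let s ← σ L
    let g ← γ L
    let t ← PW.mul s g
    PW.add t m) b S

theorem addProducts_spec (b : PW ℝ) (S : List α) (hb : b.Sorted)
    (hσ : ∀ L ∈ S, (σ L).val.Sorted) (hγ : ∀ L ∈ S, (γ L).val.Sorted) :
    (addProducts σ γ b S).val.Sorted ∧
      (∀ x, x ∈ (addProducts σ γ b S).val.bpts ↔
        x ∈ b.bpts ∨ ∃ L ∈ S, x ∈ (σ L).val.bpts ∨ x ∈ (γ L).val.bpts) ∧
      ∀ x, (addProducts σ γ b S).val.ev x =
        b.ev x + (S.map fun L => (σ L).val.ev x * (γ L).val.ev x).sum := by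
  induction S generalizing b with
  | nil => simpa [addProducts, foldT] using hb
  | cons L S ih =>
    have ht := PW.sorted_zip Poly.mul (hσ L List.mem_cons_self) (hγ L List.mem_cons_self)
    obtain ⟨h₁, h₂, h₃⟩ := ih _ (PW.sorted_zip Poly.add ht hb)
      (fun L' h => hσ L' (List.mem_cons_of_mem _ h)) fun L' h => hγ L' (List.mem_cons_of_mem _ h)
    refine ⟨h₁, fun x => (h₂ x).trans ?_, fun x => (h₃ x).trans ?_⟩
    · rw [PW.mem_bpts_zip, PW.mem_bpts_zip]
      simp only [List.mem_cons, exists_eq_or_imp]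
      rw [or_comm (b := x ∈ b.bpts), or_assoc]
    · have h4 : (PW.zip Poly.add (PW.zip Poly.mul (σ L).val (γ L).val).val b).val.ev x =
          (σ L).val.ev x * (γ L).val.ev x + b.ev x := by
        rw [← PW.ev_mul]
        exact PW.ev_add _ _ x
      rw [h4, List.map_cons, List.sum_cons]
      ring

/-- All breakpoints that occur are in `Q`. The functions `σ L` share their breakpoints, so that this
bound is better than the sum over all `L`. -/
theorem addProducts_cost (b : PW ℝ) (S : List α) (hb : b.Sorted)
    (hσ : ∀ L ∈ S, (σ L).val.Sorted) (hγ : ∀ L ∈ S, (γ L).val.Sorted) {d c c' : ℕ}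
    (hbd : b.CoeffsLe (d + 1))
    (hσd : ∀ L ∈ S, (σ L).val.CoeffsLe 1 ∧ (σ L).steps ≤ c)
    (hγd : ∀ L ∈ S, (γ L).val.CoeffsLe (d + 1) ∧ (γ L).steps ≤ c')
    (Q : List ℝ) (hbQ : ∀ x ∈ b.bpts, x ∈ Q) (hσQ : ∀ L ∈ S, ∀ x ∈ (σ L).val.bpts, x ∈ Q)
    (hγQ : ∀ L ∈ S, ∀ x ∈ (γ L).val.bpts, x ∈ Q) :
    (addProducts σ γ b S).val.CoeffsLe (d + 1) ∧
      (addProducts σ γ b S).steps ≤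
        S.length * (c + c' + (2 * Q.length + 1) * (4 * d + 12) + 3) + 1 := by
  induction S generalizing b with
  | nil => simpa [addProducts, foldT] using hbd
  | cons L S ih =>
    have hL : L ∈ L :: S := List.mem_cons_self
    have hS {L'} (h : L' ∈ S) : L' ∈ L :: S := List.mem_cons_of_mem _ h
    have ht := PW.sorted_zip Poly.mul (hσ L hL) (hγ L hL)
    have htQ : ∀ x ∈ (PW.mul (σ L).val (γ L).val).val.bpts, x ∈ Q := fun x hx =>
      ((PW.mem_bpts_zip _ _ _ _).1 hx).elim (hσQ L hL x) (hγQ L hL x)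
    obtain ⟨h₁, h₂⟩ := PW.mul_cost (hσd L hL).1 (d₁ := 0) (hγd L hL).1
    rw [Nat.zero_add] at h₁
    obtain ⟨h₃, h₄⟩ := PW.add_cost h₁ hbd
    obtain ⟨h₅, h₆⟩ := ih _ (PW.sorted_zip Poly.add ht hb) (fun L' h => hσ L' (hS h))
      (fun L' h => hγ L' (hS h)) h₃ (fun L' h => hσd L' (hS h)) (fun L' h => hγd L' (hS h))
      (fun x hx => ((PW.mem_bpts_zip _ _ _ _).1 hx).elim (htQ x) (hbQ x))
      (fun L' h => hσQ L' (hS h)) (fun L' h => hγQ L' (hS h))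
    refine ⟨h₅, ?_⟩
    have hlσ := length_le_of_pairwise_lt (hσ L hL) (hσQ L hL)
    have hlγ := length_le_of_pairwise_lt (hγ L hL) (hγQ L hL)
    have hlb := length_le_of_pairwise_lt hb hbQ
    have hlt := length_le_of_pairwise_lt ht htQ
    have e₁ : (PW.mul (σ L).val (γ L).val).steps ≤
        (2 * Q.length + 1) * ((0 + 1) * (3 * (d + 1) + 4) + 2) + 1 :=
      h₂.trans (by gcongr; omega)
    have e₂ : (PW.add (PW.mul (σ L).val (γ L).val).val b).steps ≤
        (2 * Q.length + 1) * (d + 1 + 2) + 1 :=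
      h₄.trans (by gcongr; change (PW.mul (σ L).val (γ L).val).val.bpts.length ≤ _ at hlt; omega)
    have e₃ : (addProducts σ γ b (L :: S)).steps = 1 + ((σ L).steps + ((γ L).steps +
        ((PW.mul (σ L).val (γ L).val).steps +
          (PW.add (PW.mul (σ L).val (γ L).val).val b).steps)) +
        (addProducts σ γ (PW.add (PW.mul (σ L).val (γ L).val).val b).val S).steps) := rfl
    have hc := (hσd L hL).2
    have hc' := (hγd L hL).2
    change (addProducts σ γ (PW.add (PW.mul (σ L).val (γ L).val).val b).val S).steps ≤ _ at h₆
    rw [e₃, List.length_cons, add_mul]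
    have e₄ : (2 * Q.length + 1) * (4 * d + 12) =
        (2 * Q.length + 1) * ((0 + 1) * (3 * (d + 1) + 4) + 2) +
      (2 * Q.length + 1) * (d + 1 + 2) := by ring
    omega

end Fold

end Message

/-! ### The message across an edge -/

section Send

variable {n : ℕ} {Δ : CNF n ℝ}

/-- The symbolic integral of `f` over the values of `X_i` that satisfy `D`, as a function of
`X_j`. -/
noncomputable def symbolicIntegral (D : CNF n ℝ) (i j : Fin n) (f : PW ℝ) : Timed (PW ℝ) :=
  let F := (PW.antideriv f).val
  let S := (boundLines D i j).val
  let P := (criticalPoints D i j S).val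
  addProducts (boundSign D i j S P) (fun L => PW.comp L.1 L.2 F)
    (infiniteBounds D i j S P (PW.atBot F).val (PW.atTop F).val).val S

theorem symbolicIntegral_sorted {f : PW ℝ} (hf : f.Sorted) (D : CNF n ℝ) (i j : Fin n) :
    let P := (criticalPoints D i j (boundLines D i j).val).val
    let F := (PW.antideriv f).val
    (symbolicIntegral D i j f).val.Sorted ∧
      (∀ x, x ∈ (symbolicIntegral D i j f).val.bpts ↔
        x ∈ P ∨ ∃ L ∈ (boundLines D i j).val, x ∈ P ∨ x ∈ (PW.comp L.1 L.2 F).val.bpts) ∧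
      ∀ x, (symbolicIntegral D i j f).val.ev x =
        (infiniteBounds D i j (boundLines D i j).val P (PW.atBot F).val (PW.atTop F).val).val.ev x +
          ((boundLines D i j).val.map fun L => (boundSign D i j (boundLines D i j).val P L).val.ev x *
            (PW.comp L.1 L.2 F).val.ev x).sum := by
  intro P F
  have hF : F.Sorted := by rwa [PW.Sorted, PW.bpts_antideriv]
  have hP := pairwise_criticalPoints D i j (boundLines D i j).val
  have h := addProducts_spec (boundSign D i j (boundLines D i j).val P)
    (fun L => PW.comp L.1 L.2 F)
    (infiniteBounds D i j (boundLines D i j).val P (PW.atBot F).val (PW.atTop F).val).val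
    (boundLines D i j).val (by rwa [PW.Sorted, bpts_infiniteBounds])
    (fun L _ => by rwa [PW.Sorted, bpts_boundSign]) (fun L _ => PW.sorted_comp _ _ hF)
  simp only [bpts_infiniteBounds, bpts_boundSign] at h
  exact h

/-- Off the critical points, the lines have distinct values, and integration in `X_i` between them
gives the sum that the algorithm forms. -/
theorem represents_symbolicIntegral (hG : (primalGraph Δ).IsTree) {i j : Fin n} (hij : i ≠ j)
    {g : PW ℝ} {f : ℝ → ℝ≥0∞} (hg : Represents g f)
    (hm : Measurable fun v =>
      ∫⁻ u, if (edgeTest (edgeFormula Δ i j).val i j u v).val then f u else 0) :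
    Represents (symbolicIntegral (edgeFormula Δ i j).val i j g).val
      fun v => ∫⁻ u, if (edgeTest (edgeFormula Δ i j).val i j u v).val then f u else 0 := by
  set D := (edgeFormula Δ i j).val with hD
  obtain ⟨h₁, h₂, h₃⟩ := symbolicIntegral_sorted hg.1 D i j
  refine ⟨h₁, hm, ?_⟩
  filter_upwards [ae_notMem_list (symbolicIntegral D i j g).val.bpts] with v hv hfin
  rw [h₂, not_or, not_exists] at hv
  obtain ⟨hv, hvL⟩ := hv
  have hF : (PW.antideriv g).val.Sorted := by rw [PW.Sorted, PW.bpts_antideriv]; exact hg.1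
  set S := (boundLines D i j).val with hS
  set ys := S.map fun L => lineAt L v with hys
  have hnd : ys.Nodup := (nodup_boundLines D i j).map_on fun L hL L' hL' h => by
    by_contra hne
    exact lineAt_ne hv hL hL' hne h
  have hmem {L} (hL : L ∈ S) : lineAt L v ∈ ys.toFinset :=
    List.mem_toFinset.2 (List.mem_map_of_mem hL)
  obtain ⟨u₀, hu₀⟩ := ys.toFinset.finite_toSet.bddBelow
  obtain ⟨w₀, hw₀⟩ := ys.toFinset.finite_toSet.bddAbove
  have hu {y} (hy : y ∈ ys.toFinset) : u₀ - 1 < y := by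
    linarith [hu₀ (Finset.mem_coe.2 hy)]
  have hw {y} (hy : y ∈ ys.toFinset) : y < w₀ + 1 := by
    linarith [hw₀ (Finset.mem_coe.2 hy)]
  rw [toReal_lintegral_eq hg ys.toFinset (fun u => (edgeTest D i j u v).val)
    (measurable_edgeTest hG hij v) ?_ hfin
    (fun y => (justBelow y ys).val) (fun y => (justAbove y ys).val) ?_ ?_ (u₀ - 1) (fun y => hu)
    (w₀ + 1) (fun y => hw), h₃, List.sum_toFinset _ hnd, hys, List.map_map,
    ev_infiniteBounds hv (fun L hL => hu (hmem hL)) (fun L hL => hw (hmem hL))]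
  · congr 2
    refine List.map_congr_left fun L hL => ?_
    have hx : v ∉ (PW.comp L.1 L.2 (PW.antideriv g).val).val.bpts := fun h => hvL L ⟨hL, Or.inr h⟩
    rw [ev_boundSign hL hv (justBelow_spec _ _) (justAbove_spec _ _), PW.ev_comp hF hx]
    rfl
  · intro u u' hu hu' h
    refine edgeTest_congr ⟨hv, hv, fun _ _ => Iff.rfl⟩ (fun L hL => h _ (hmem hL)) fun L hL => ?_
    have hn : lineAt L v ≠ u := fun e => hu (e ▸ hmem hL)
    have hn' : lineAt L v ≠ u' := fun e => hu' (e ▸ hmem hL)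
    rw [← not_le, ← not_le, hn.le_iff_lt, hn'.le_iff_lt, h _ (hmem hL)]
  · intro y hy
    have := justBelow_spec y ys
    simpa [JustBelow] using this
  · intro y hy
    have := justAbove_spec y ys
    simpa [JustAbove] using this

/-- The part of the integrand of the message from `i` that depends only on `X_i`. -/
noncomputable def integrand (Δ : CNF n ℝ) (M : Fin n → Fin n → PW ℝ) (i : Fin n)
    (cs : List (Fin n)) : PW ℝ :=
  (PW.mul (nodeIndicator Δ i).val (product M i cs).val).val

/-- The senders of the messages that enter the message from `i` to `j`. -/
noncomputable def senders (Δ : CNF n ℝ) (i j : Fin n) : List (Fin n) :=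
  (neighbours Δ i).val.filter fun c => decide (c ≠ j)

theorem mem_senders {i j c : Fin n} :
    c ∈ senders Δ i j ↔ (primalGraph Δ).Adj c i ∧ c ≠ j := by
  simp [senders, mem_neighbours, SimpleGraph.adj_comm]

theorem nodup_senders (i j : Fin n) : (senders Δ i j).Nodup := (nodup_neighbours Δ i).filter _

theorem val_sendMessage (M : Fin n → Fin n → PW ℝ) (i j : Fin n) :
    (sendMessage Δ M i j).val =
      (symbolicIntegral (edgeFormula Δ i j).val i j (integrand Δ M i (senders Δ i j))).val := by
  have h : (filterT (fun c => do
      tick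
      return decide (c ≠ j)) (neighbours Δ i).val).val = senders Δ i j := by
    rw [val_filterT]
    rfl
  simp only [sendMessage, Timed.val_bind, h]
  rfl

theorem steps_sendMessage (M : Fin n → Fin n → PW ℝ) (i j : Fin n) :
    let D := (edgeFormula Δ i j).val
    let S := (boundLines D i j).val
    let b := (product M i (senders Δ i j)).val
    let f := integrand Δ M i (senders Δ i j)
    let F := (PW.antideriv f).val
    (sendMessage Δ M i j).steps ≤
      (neighbours Δ i).steps + ((neighbours Δ i).val.length * 2 + 1) +
      (product M i (senders Δ i j)).steps + (nodeIndicator Δ i).steps +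
      (PW.mul (nodeIndicator Δ i).val b).steps + (PW.antideriv f).steps +
      (edgeFormula Δ i j).steps + (boundLines D i j).steps + (criticalPoints D i j S).steps +
      (PW.atBot F).steps + (PW.atTop F).steps +
      (infiniteBounds D i j S (criticalPoints D i j S).val (PW.atBot F).val
        (PW.atTop F).val).steps + (symbolicIntegral D i j f).steps := by
  intro D S b f F
  have h : (filterT (fun c => do
      tick
      return decide (c ≠ j)) (neighbours Δ i).val).val = senders Δ i j := by
    rw [val_filterT]
    rfl
  have hs : (filterT (fun c => do
      tick
      return decide (c ≠ j)) (neighbours Δ i).val).steps ≤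
        (neighbours Δ i).val.length * 2 + 1 :=
    steps_filterT_le _ _ _ fun c _ => by simp
  simp only [sendMessage, Timed.steps_bind, h]
  simp only [symbolicIntegral, addProducts, f, F, S, D, b, integrand] at *
  omega

/-- The integrand is a product over a vertex and its neighbours, so that the numbers of breakpoints
of its factors add up. In the cost bound, `A` stands for the power of `numLiterals Δ` that occurs in
the running time of the algorithm. -/
theorem integrand_spec (hΔ : ∀ Γ ∈ Δ, Γ ≠ []) (hG : (primalGraph Δ).IsTree)
    (hm : 1 ≤ numLiterals Δ) {M : Fin n → Fin n → PW ℝ} {i : Fin n} {cs : List (Fin n)}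
    (hnd : cs.Nodup) (hcs : ∀ c ∈ cs, (primalGraph Δ).Adj c i)
    (hM : ∀ c ∈ cs, IsMessage Δ (M c i) c i) {d : ℕ}
    (hd : ∀ c ∈ cs, branchDepth (primalGraph Δ) c i ≤ d) :
    Represents (integrand Δ M i cs) (fun u =>
        (if (nodeTest (nodeFormula Δ i).val i u).val then 1 else 0) *
          (cs.map fun c => exactMessage Δ c i u).prod) ∧
      (integrand Δ M i cs).CoeffsLe
        ((cs.map fun c => (branch (primalGraph Δ) c i).card).sum + 1) ∧
      (integrand Δ M i cs).bpts.length ≤ (numLiterals (nodeFormula Δ i).val +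
        (cs.map fun c => numLiterals (edgeFormula Δ c i).val).sum) * numLiterals Δ ^ d ∧
      ∀ A, numLiterals Δ ^ 3 ≤ A → numLiterals Δ * numLiterals Δ ^ d ≤ A →
        (product M i cs).steps ≤ 25 * (n ^ 3 * A) ∧
          (nodeIndicator Δ i).steps ≤ 30 * (n ^ 3 * A) ∧
          (PW.mul (nodeIndicator Δ i).val (product M i cs).val).steps ≤ 20 * (n ^ 3 * A) := by
  have ht := sum_card_branch_le hG i cs hnd hcs
  have hn : 1 ≤ n := by omega
  obtain ⟨h₁, h₂, h₃, h₄⟩ := product_spec M i cs hM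
  obtain ⟨hχ₁, hχ₂, hχ₃⟩ := nodeIndicator_cost hΔ i le_rfl hm hn
  obtain ⟨h₅, h₆⟩ := PW.mul_cost (d₁ := 0) hχ₁ h₂
  have hχ := represents_nodeIndicator Δ i
  have hsum := sum_length_bpts_le hM hm hd
  have hpow : 1 ≤ numLiterals Δ ^ d := Nat.one_le_pow _ _ hm
  have hstar := numLiterals_star_le hG i cs hnd hcs
  have hlen : (cs.map fun c => (M c i).bpts.length).sum + numLiterals (nodeFormula Δ i).val ≤
      (numLiterals (nodeFormula Δ i).val +
        (cs.map fun c => numLiterals (edgeFormula Δ c i).val).sum) * numLiterals Δ ^ d := by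
    have := Nat.le_mul_of_pos_right (numLiterals (nodeFormula Δ i).val) hpow
    rw [add_mul]
    omega
  refine ⟨hχ.mul h₁, h₅.mono (by omega), (PW.length_bpts_mul_le hχ.1 h₁.1).trans (by omega),
    fun A hA hA' => ?_⟩
  have hK := hlen.trans ((Nat.mul_le_mul_right _ hstar).trans hA')
  have hA₁ : 1 ≤ A := (Nat.one_le_pow 3 _ hm).trans hA
  have hc : cs.length ≤ n := by
    simpa using hnd.length_le_card
  have hN {a b : ℕ} (ha : a ≤ 3) (hb : b ≤ 1) : n ^ a * A ^ b ≤ n ^ 3 * A := by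
    gcongr
    exact (pow_le_pow_right₀ hA₁ hb).trans_eq (pow_one A)
  have n00 := hN (Nat.zero_le 3) (Nat.zero_le 1)
  have n10 := hN (show 1 ≤ 3 by omega) (Nat.zero_le 1)
  have n20 := hN (show 2 ≤ 3 by omega) (Nat.zero_le 1)
  have n30 := hN (show 3 ≤ 3 by omega) (Nat.zero_le 1)
  have n01 := hN (Nat.zero_le 3) (le_refl 1)
  have n11 := hN (show 1 ≤ 3 by omega) (le_refl 1)
  have n21 := hN (show 2 ≤ 3 by omega) (le_refl 1)
  refine ⟨?_, ?_, ?_⟩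
  · calc (product M i cs).steps ≤ cs.length * ((A + 1) * (n * (3 * n + 4) + 2) + 2) + 1 :=
          h₄ A (by omega) (by omega)
      _ ≤ n * ((A + 1) * (n * (3 * n + 4) + 2) + 2) + 1 := by gcongr
      _ ≤ 25 * (n ^ 3 * A) := by linarith
  · calc (nodeIndicator Δ i).steps ≤ 30 * (n * numLiterals Δ ^ 3) := hχ₃
      _ ≤ 30 * (n * A) := by gcongr
      _ ≤ 30 * (n ^ 3 * A) := by linarith
  · calc _ ≤ _ := h₆
      _ ≤ (A + 1) * ((0 + 1) * (3 * n + 4) + 2) + 1 := by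
        gcongr
        omega
      _ ≤ 20 * (n ^ 3 * A) := by linarith

end Send

/-! ### Correctness and cost of a message -/

section Send

variable {n : ℕ} {Δ : CNF n ℝ}

theorem length_boundLines_le {D : CNF n ℝ} (i j : Fin n) (hD : ∀ Γ ∈ D, Γ ≠ []) :
    (boundLines D i j).val.length ≤ numLiterals D := by
  have := (boundLines_cost i j le_rfl hD).1
  have := countLiterals_add_le (fun ℓ : Literal n ℝ => decide (ℓ.coeff i ≠ 0)) (fun _ => false)
    (fun _ _ => rfl) D
  omega

theorem length_criticalPoints_le {D : CNF n ℝ} (i j : Fin n) (hD : ∀ Γ ∈ D, Γ ≠ []) :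
    (criticalPoints D i j (boundLines D i j).val).val.length ≤ numLiterals D ^ 2 := by
  have := (criticalPoints_cost i j _ le_rfl hD (boundLines_cost i j le_rfl hD).1).1 0
  simpa [sq] using this

/-- The breakpoints of the result are the critical points and, for each line, the preimages of the
breakpoints of the integrand under this line. -/
theorem symbolicIntegral_cost {D : CNF n ℝ} {i j : Fin n} {g : PW ℝ} (hg : g.Sorted) {d m K : ℕ}
    (hD : ∀ Γ ∈ D, Γ ≠ []) (hDm : numLiterals D ≤ m) (hgd : g.CoeffsLe (d + 1))
    (hgK : g.bpts.length ≤ K) :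
    (symbolicIntegral D i j g).val.CoeffsLe (d + 2) ∧
      (symbolicIntegral D i j g).val.bpts.length ≤ numLiterals D * (numLiterals D + K) ∧
      (symbolicIntegral D i j g).steps ≤
        m * ((m ^ 2 + 1) * (14 * m + 7) + (K + 1) * ((d + 2) * (6 * (d + 2) + 12) + 5) +
          (2 * (m * (m + K)) + 1) * (4 * (d + 1) + 12) + 3) + 1 := by
  set F := (PW.antideriv g).val with hF
  set S := (boundLines D i j).val with hS
  set P := (criticalPoints D i j S).val with hP
  have hFs : F.Sorted := by rwa [PW.Sorted, PW.bpts_antideriv]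
  have hPs : P.Pairwise (· < ·) := pairwise_criticalPoints D i j S
  have hFd : F.CoeffsLe (d + 1 + 1) := (PW.antideriv_cost hgd).1
  have hFl : F.bpts.length ≤ K := by rwa [hF, PW.bpts_antideriv]
  have hSe : S.length ≤ numLiterals D := length_boundLines_le i j hD
  have hQ := (criticalPoints_cost i j S le_rfl hD (boundLines_cost i j le_rfl hD).1).1
  have hPl : P.length ≤ m ^ 2 :=
    (length_criticalPoints_le i j hD).trans (Nat.pow_le_pow_left hDm 2)
  set Q := P ++ S.flatMap fun L => (PW.comp L.1 L.2 F).val.bpts with hQdef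
  have hQl : Q.length ≤ P.length + S.length * K := by
    rw [hQdef, List.length_append, List.length_flatMap]
    refine Nat.add_le_add_left (sum_map_le_length_mul _ _ _ fun L _ => ?_) _
    exact (PW.length_bpts_comp_le _ _ _).trans hFl
  have hQm : Q.length ≤ m * (m + K) := (hQl.trans (hQ K)).trans (by gcongr)
  obtain ⟨s₁, s₂, -⟩ := symbolicIntegral_sorted hg D i j
  have hcost := addProducts_cost (boundSign D i j S P) (fun L => PW.comp L.1 L.2 F)
    (infiniteBounds D i j S P (PW.atBot F).val (PW.atTop F).val).val S
    (by rwa [PW.Sorted, bpts_infiniteBounds])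
    (fun L _ => by rwa [PW.Sorted, bpts_boundSign]) (fun L _ => PW.sorted_comp _ _ hFs)
    (d := d + 1) ((infiniteBounds_cost hDm hD (hSe.trans hDm) P _ _).1.mono (by omega))
    (fun L _ => boundSign_cost hDm hD (hSe.trans hDm) P L)
    (c' := (K + 1) * ((d + 2) * (6 * (d + 2) + 12) + 5))
    (fun L _ => ⟨(PW.comp_cost L.1 L.2 hFd (by omega)).1,
      (PW.comp_cost L.1 L.2 hFd (by omega)).2.trans (by gcongr)⟩) Q
    (by simp only [bpts_infiniteBounds]; exact fun x hx => List.mem_append_left _ hx)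
    (by simp only [bpts_boundSign]; exact fun _ _ x hx => List.mem_append_left _ hx)
    fun L hL x hx => List.mem_append_right _ (List.mem_flatMap.2 ⟨L, hL, hx⟩)
  refine ⟨hcost.1, ?_, hcost.2.trans ?_⟩
  · refine (length_le_of_pairwise_lt s₁ (l' := Q) fun x hx => ?_).trans (hQl.trans (hQ K))
    rcases (s₂ x).1 hx with h | ⟨L, hL, h | h⟩
    · exact List.mem_append_left _ h
    · exact List.mem_append_left _ h
    · exact List.mem_append_right _ (List.mem_flatMap.2 ⟨L, hL, h⟩)
  · have := hSe.trans hDm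
    gcongr

/-- One step of message passing: if the messages that enter the message from `i` to `j` are correct,
then so is this message. With `m` literals, of which `e` are in `Δ_{i,j}`, the integrand has at most
`(m - e) * m ^ d` breakpoints, and hence the message at most `e * (e + (m - e) * m ^ d)`, which is
bounded by `e * m ^ (d + 1)`; here `d + 1` is the number of levels of the branch of `i` at `j`. -/
theorem isMessage_sendMessage (hΔ : ∀ Γ ∈ Δ, Γ ≠ []) (hG : (primalGraph Δ).IsTree)
    (hm : 1 ≤ numLiterals Δ) {M : Fin n → Fin n → PW ℝ} {i j : Fin n}
    (hij : (primalGraph Δ).Adj i j) (hM : ∀ c ∈ senders Δ i j, IsMessage Δ (M c i) c i) :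
    IsMessage Δ (sendMessage Δ M i j).val i j ∧
      ∀ E, branchDepth (primalGraph Δ) i j + 2 ≤ E → 4 ≤ E →
        (sendMessage Δ M i j).steps ≤ 400 * (n ^ 3 * numLiterals Δ ^ E) := by
  have hcs {c} (hc : c ∈ senders Δ i j) : (primalGraph Δ).Adj c i := (mem_senders.1 hc).1
  have hcj {c} (hc : c ∈ senders Δ i j) : c ≠ j := (mem_senders.1 hc).2
  obtain ⟨d, hd⟩ : ∃ d, branchDepth (primalGraph Δ) i j = d + 1 :=
    ⟨_, (Nat.sub_add_cancel (one_le_branchDepth hij)).symm⟩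
  have hdepth : ∀ c ∈ senders Δ i j, branchDepth (primalGraph Δ) c i ≤ d := fun c hc => by
    have := branchDepth_add_one_le hG hij.symm (hcs hc) (hcj hc)
    omega
  have hcard := sum_card_branch_add_one_le hG hij.symm (senders Δ i j) (nodup_senders i j)
    fun c hc => mem_senders.1 hc
  have hcardn : (branch (primalGraph Δ) i j).card + 1 ≤ n := by
    simpa using sum_card_branch_le hG j [i] (List.nodup_singleton i) (by simpa using hij)
  obtain ⟨f₁, f₂, f₃, f₄⟩ := integrand_spec hΔ hG hm (nodup_senders i j) (fun c => hcs) hM hdepth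
  set m := numLiterals Δ with hmdef
  set e := numLiterals (edgeFormula Δ i j).val with he
  set κ := numLiterals (nodeFormula Δ i).val +
    ((senders Δ i j).map fun c => numLiterals (edgeFormula Δ c i).val).sum with hκ
  have heκ : e + κ ≤ m := by
    have := numLiterals_star_le hG i (j :: senders Δ i j)
      (List.nodup_cons.2 ⟨fun h => hcj h rfl, nodup_senders i j⟩)
      (List.forall_mem_cons.2 ⟨hij.symm, fun c => hcs⟩)
    rw [List.map_cons, List.sum_cons, edgeFormula_comm Δ j i] at this
    omega
  have hD : ∀ Γ ∈ (edgeFormula Δ i j).val, Γ ≠ [] := fun Γ h => hΔ Γ (mem_edgeFormula.1 h).1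
  obtain ⟨r₁, r₂, r₃⟩ := symbolicIntegral_cost (i := i) (j := j) f₁.1 hD
    (show e ≤ m by omega) f₂ f₃
  have hpow : 1 ≤ m ^ d := Nat.one_le_pow _ _ hm
  have hK : e + κ * m ^ d ≤ m ^ (d + 1) := calc
    e + κ * m ^ d ≤ e * m ^ d + κ * m ^ d := by
      gcongr
      exact Nat.le_mul_of_pos_right _ hpow
    _ = (e + κ) * m ^ d := (add_mul _ _ _).symm
    _ ≤ m * m ^ d := by gcongr
    _ = m ^ (d + 1) := (pow_succ' m d).symm
  have hexact := exactMessage_eq hG hij (senders Δ i j) (nodup_senders i j) fun c => mem_senders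
  refine ⟨⟨?_, ?_, ?_⟩, fun E hE hE' => ?_⟩
  · rw [val_sendMessage]
    have := represents_symbolicIntegral hG hij.ne f₁
      ((funext hexact : exactMessage Δ i j = _) ▸ measurable_exactMessage Δ i j)
    exact this.congr (funext fun v => (hexact v).symm)
  · rw [val_sendMessage, hd]
    exact r₂.trans (by gcongr)
  · rw [val_sendMessage]
    exact r₁.mono (by omega)
  -- The most expensive part is the sum over at most `m` lines of piecewise polynomials with at most
  -- `m ^ (d + 2)` breakpoints and degree at most `n`.
  · set A := m ^ E with hA
    have hmA {k : ℕ} (hk : k ≤ 4) : m ^ k ≤ A := Nat.pow_le_pow_right hm (hk.trans hE')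
    have hdA : m ^ (d + 3) ≤ A := Nat.pow_le_pow_right hm (by omega)
    have hdA' : m * m ^ d ≤ A := by
      rw [← pow_succ']
      exact Nat.pow_le_pow_right hm (by omega)
    set K := κ * m ^ d with hKdef
    have hK' : K ≤ m ^ (d + 1) := (Nat.le_add_left _ _).trans hK
    have hKA {k : ℕ} (hk : k ≤ 2) : m ^ k * K ≤ A := calc
      m ^ k * K ≤ m ^ k * m ^ (d + 1) := by gcongr
      _ = m ^ (k + (d + 1)) := (pow_add _ _ _).symm
      _ ≤ A := Nat.pow_le_pow_right hm (by omega)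
    have hN {a x : ℕ} (ha : a ≤ 3) (hx : x ≤ A) : n ^ a * x ≤ n ^ 3 * A := by
      gcongr
      omega
    have h0 {x : ℕ} (hx : x ≤ A) := hN (Nat.zero_le 3) hx
    have h1 {x : ℕ} (hx : x ≤ A) := hN (show 1 ≤ 3 by omega) hx
    have h2 {x : ℕ} (hx : x ≤ A) := hN (show 2 ≤ 3 by omega) hx
    have a0 := hmA (show 0 ≤ 4 by omega)
    have a1 := hmA (show 1 ≤ 4 by omega)
    have a2 := hmA (show 2 ≤ 4 by omega)
    have a3 := hmA (show 3 ≤ 4 by omega)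
    have a4 := hmA (show 4 ≤ 4 by omega)
    have b0 := hKA (show 0 ≤ 2 by omega)
    have b1 := hKA (show 1 ≤ 2 by omega)
    have b2 := hKA (show 2 ≤ 2 by omega)
    obtain ⟨s₁, s₂, s₃⟩ := f₄ A a3 hdA'
    have hsteps := steps_sendMessage (Δ := Δ) M i j
    have c₁ := steps_neighbours_le hΔ i
    have c₂ := length_neighbours_le Δ i
    have c₃ := (PW.antideriv_cost f₂).2
    have c₄ := steps_edgeFormula_le hΔ i j
    have c₅ := (boundLines_cost i j (show e ≤ m by omega) hD).2
    have c₆ := (criticalPoints_cost i j _ (show e ≤ m by omega) hD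
      (boundLines_cost i j le_rfl hD).1).2
    have hem : e ≤ m := by omega
    have hP : (criticalPoints (edgeFormula Δ i j).val i j
        (boundLines (edgeFormula Δ i j).val i j).val).val.length ≤ m ^ 2 :=
      (length_criticalPoints_le i j hD).trans (Nat.pow_le_pow_left hem 2)
    have c₇ := (infiniteBounds_cost (i := i) (j := j) hem hD
      ((length_boundLines_le i j hD).trans hem)
      (criticalPoints (edgeFormula Δ i j).val i j (boundLines (edgeFormula Δ i j).val i j).val).val
      (PW.atBot (PW.antideriv (integrand Δ M i (senders Δ i j))).val).val
      (PW.atTop (PW.antideriv (integrand Δ M i (senders Δ i j))).val).val).2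
    simp only [PW.steps_atBot, PW.steps_atTop, PW.bpts_antideriv] at hsteps
    set t := ((senders Δ i j).map fun c => (branch (primalGraph Δ) c i).card).sum
    have d₃ : (PW.antideriv (integrand Δ M i (senders Δ i j))).steps ≤
        (K + 1) * (4 * n + 10) :=
      c₃.trans (by gcongr; omega)
    have d₇ := c₇.trans (Nat.mul_le_mul_right (14 * m + 7) (Nat.succ_le_succ hP))
    have d₈ : (symbolicIntegral (edgeFormula Δ i j).val i j
        (integrand Δ M i (senders Δ i j))).steps ≤
        m * ((m ^ 2 + 1) * (14 * m + 7) + (K + 1) * (n * (6 * n + 12) + 5) +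
          (2 * (m * (m + K)) + 1) * (4 * n + 12) + 3) + 1 :=
      r₃.trans (by gcongr <;> omega)
    have e₁ : (neighbours Δ i).steps + ((neighbours Δ i).val.length * 2 + 1) +
        (edgeFormula Δ i j).steps ≤ 30 * (n ^ 3 * A) := by
      linarith [h1 a0, h1 a1, h0 a0, h0 a1]
    have e₂ : (PW.antideriv (integrand Δ M i (senders Δ i j))).steps + 1 +
        ((integrand Δ M i (senders Δ i j)).bpts.length + 2) ≤ 40 * (n ^ 3 * A) := by
      linarith [h1 a0, h1 b0, h0 a0, h0 b0]
    have e₃ : m * (m * (2 * m + 3) + 2) + 1 + (m * (m * (m + 3) + 2) + 1 +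
        (m * (m * (m * m + 3) + 2) + 1)) + (m ^ 2 + 1) * (14 * m + 7) ≤ 70 * (n ^ 3 * A) := by
      linarith [h0 a0, h0 a1, h0 a2, h0 a3, h0 a4]
    have e₄ : m * ((m ^ 2 + 1) * (14 * m + 7) + (K + 1) * (n * (6 * n + 12) + 5) +
        (2 * (m * (m + K)) + 1) * (4 * n + 12) + 3) + 1 ≤ 175 * (n ^ 3 * A) := by
      linarith [h0 a0, h0 a1, h0 a2, h0 a3, h0 a4, h0 b0, h0 b1, h0 b2, h1 a1, h1 a3, h1 b1,
        h1 b2, h2 a1, h2 b1]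
    refine hsteps.trans ?_
    linarith

end Send

/-! ### The order of the nodes -/

section Preorder

variable {n : ℕ} {Δ : CNF n ℝ}

/-- In the list of nodes with their parents, all children of a node come after it. -/
def ChildrenAfter (Δ : CNF n ℝ) : List (Fin n × Option (Fin n)) → Prop
  | [] => True
  | a :: s => (∀ c, (primalGraph Δ).Adj c a.1 → some c ≠ a.2 → (c, some a.1) ∈ s) ∧
      ChildrenAfter Δ s

/-- In the list of nodes with their parents, the parent of a node comes before it, or is in `K`. -/
def ParentsBefore : Set (Fin n) → List (Fin n × Option (Fin n)) → Prop
  | _, [] => True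
  | K, a :: s => (∀ q, a.2 = some q → q ∈ K) ∧ ParentsBefore (insert a.1 K) s

theorem ChildrenAfter.append {s t : List (Fin n × Option (Fin n))} (hs : ChildrenAfter Δ s)
    (ht : ChildrenAfter Δ t) : ChildrenAfter Δ (s ++ t) := by
  induction s with
  | nil => exact ht
  | cons a s ih =>
    exact ⟨fun c hc hne => List.mem_append_left _ (hs.1 c hc hne), ih hs.2⟩

theorem ChildrenAfter.flatten {l : List (List (Fin n × Option (Fin n)))}
    (h : ∀ s ∈ l, ChildrenAfter Δ s) : ChildrenAfter Δ l.flatten := by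
  induction l with
  | nil => exact trivial
  | cons s l ih =>
    exact (h s List.mem_cons_self).append (ih fun t ht => h t (List.mem_cons_of_mem _ ht))

theorem ChildrenAfter.mem {V : List (Fin n × Option (Fin n))} (h : ChildrenAfter Δ V)
    {a : Fin n × Option (Fin n)} (ha : a ∈ V) {c : Fin n} (hc : (primalGraph Δ).Adj c a.1)
    (hne : some c ≠ a.2) : (c, some a.1) ∈ V := by
  induction V with
  | nil => simp at ha
  | cons b s ih =>
    rcases List.mem_cons.1 ha with rfl | ha
    · exact List.mem_cons_of_mem _ (h.1 c hc hne)
    · exact List.mem_cons_of_mem _ (ih h.2 ha)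

theorem ParentsBefore.append {s t : List (Fin n × Option (Fin n))} {K : Set (Fin n)}
    (hs : ParentsBefore K s) (ht : ∀ K', K ⊆ K' → ParentsBefore K' t) :
    ParentsBefore K (s ++ t) := by
  induction s generalizing K with
  | nil => exact ht K subset_rfl
  | cons a s ih =>
    exact ⟨hs.1, ih hs.2 fun K' h => ht K' ((Set.subset_insert _ _).trans h)⟩

theorem ParentsBefore.flatten {l : List (List (Fin n × Option (Fin n)))} {K : Set (Fin n)}
    (h : ∀ s ∈ l, ∀ K', K ⊆ K' → ParentsBefore K' s) : ParentsBefore K l.flatten := by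
  induction l generalizing K with
  | nil => exact trivial
  | cons s l ih =>
    exact (h s List.mem_cons_self K subset_rfl).append fun K' hK =>
      ih fun t ht K'' hK' => h t (List.mem_cons_of_mem _ ht) K'' (hK.trans hK')

/-- The neighbours of `i` other than its parent. -/
noncomputable def children (Δ : CNF n ℝ) (p : Option (Fin n)) (i : Fin n) : List (Fin n) :=
  (neighbours Δ i).val.filter fun c => decide (some c ≠ p)

theorem mem_children {p : Option (Fin n)} {i c : Fin n} :
    c ∈ children Δ p i ↔ (primalGraph Δ).Adj c i ∧ some c ≠ p := by
  simp [children, mem_neighbours, SimpleGraph.adj_comm]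

/-- The number of nodes that are reached from `i` without passing through its parent. -/
noncomputable def reachSize (Δ : CNF n ℝ) (i : Fin n) : Option (Fin n) → ℕ
  | none => n
  | some q => (branch (primalGraph Δ) i q).card

theorem sum_card_branch_children_le (hG : (primalGraph Δ).IsTree) {p : Option (Fin n)} {i : Fin n}
    (hp : ∀ q, p = some q → (primalGraph Δ).Adj i q) :
    ((children Δ p i).map fun c => (branch (primalGraph Δ) c i).card).sum + 1 ≤
      reachSize Δ i p := by
  have hnd : (children Δ p i).Nodup := (nodup_neighbours Δ i).filter _
  cases p with
  | none => exact sum_card_branch_le hG i _ hnd fun c hc => (mem_children.1 hc).1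
  | some q =>
    exact sum_card_branch_add_one_le hG (hp q rfl).symm _ hnd fun c hc =>
      ⟨(mem_children.1 hc).1, fun h => (mem_children.1 hc).2 (h ▸ rfl)⟩

theorem preorder_succ (fuel : ℕ) (p : Option (Fin n)) (i : Fin n) :
    (preorder Δ (fuel + 1) p i).val =
        (i, p) :: ((children Δ p i).map fun c => (preorder Δ fuel (some i) c).val).flatten ∧
      (preorder Δ (fuel + 1) p i).steps ≤ (neighbours Δ i).steps +
        ((neighbours Δ i).val.length * 2) + 3 * (children Δ p i).length + 4 +
        ((children Δ p i).map fun c => (preorder Δ fuel (some i) c).val.length).sum +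
        ((children Δ p i).map fun c => (preorder Δ fuel (some i) c).steps).sum := by
  have h : (filterT (fun c => do
      tick
      return decide (some c ≠ p)) (neighbours Δ i).val).val = children Δ p i := by
    rw [val_filterT]
    rfl
  have hs : (filterT (fun c => do
      tick
      return decide (some c ≠ p)) (neighbours Δ i).val).steps ≤
        (neighbours Δ i).val.length * 2 + 1 :=
    steps_filterT_le _ _ _ fun c _ => by simp
  refine ⟨?_, ?_⟩
  · simp only [preorder, Timed.val_bind, Timed.val_pure, h, val_mapT, val_flattenT]
  · simp only [preorder, Timed.steps_bind, Timed.steps_pure, steps_tick, h, val_mapT, steps_mapT,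
      steps_flattenT, List.map_map, Function.comp_def, List.sum_map_add, List.map_const',
      List.sum_replicate, smul_eq_mul]
    omega

/-- The fuel suffices, since the branches at a vertex of a branch have fewer vertices than the
branch. -/
theorem preorder_spec (hΔ : ∀ Γ ∈ Δ, Γ ≠ []) (hG : (primalGraph Δ).IsTree) (fuel : ℕ)
    (p : Option (Fin n)) (i : Fin n) (hp : ∀ q, p = some q → (primalGraph Δ).Adj i q)
    (hf : reachSize Δ i p ≤ fuel) :
    (i, p) ∈ (preorder Δ fuel p i).val ∧
      ChildrenAfter Δ (preorder Δ fuel p i).val ∧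
      (∀ K : Set (Fin n), (∀ q, p = some q → q ∈ K) →
        ParentsBefore K (preorder Δ fuel p i).val) ∧
      (∀ a ∈ (preorder Δ fuel p i).val, ∀ q, a.2 = some q → (primalGraph Δ).Adj a.1 q) ∧
      (preorder Δ fuel p i).val.length ≤ reachSize Δ i p ∧
      (preorder Δ fuel p i).steps ≤ reachSize Δ i p * (n * (7 * numLiterals Δ + 9) + 5) := by
  have hsum := sum_card_branch_children_le hG hp
  induction fuel generalizing p i with
  | zero => omega
  | succ fuel ih =>
    obtain ⟨hv, hst⟩ := preorder_succ (Δ := Δ) fuel p i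
    have hc (c) (hc : c ∈ children Δ p i) := ih (some i) c
      (fun q h => Option.some_injective _ h ▸ (mem_children.1 hc).1)
      (by
        have : (branch (primalGraph Δ) c i).card ≤
            ((children Δ p i).map fun c => (branch (primalGraph Δ) c i).card).sum :=
          List.single_le_sum (by simp) _ (List.mem_map_of_mem hc)
        change (branch (primalGraph Δ) c i).card ≤ fuel
        omega)
      (sum_card_branch_children_le hG
        fun q h => Option.some_injective _ h ▸ (mem_children.1 hc).1)
    have hlen : ((children Δ p i).map fun c => (preorder Δ fuel (some i) c).val.length).sum ≤
        ((children Δ p i).map fun c => (branch (primalGraph Δ) c i).card).sum :=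
      List.sum_le_sum fun c h => (hc c h).2.2.2.2.1
    have hsteps : ((children Δ p i).map fun c => (preorder Δ fuel (some i) c).steps).sum ≤
        ((children Δ p i).map fun c => (branch (primalGraph Δ) c i).card).sum *
          (n * (7 * numLiterals Δ + 9) + 5) := by
      rw [← List.sum_map_mul_right]
      exact List.sum_le_sum fun c h => (hc c h).2.2.2.2.2
    rw [hv]
    refine ⟨List.mem_cons_self, ⟨fun c hadj hne => ?_, ?_⟩, fun K hK => ⟨hK, ?_⟩, ?_, ?_, ?_⟩
    · have hmem := mem_children.2 ⟨hadj, hne⟩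
      exact List.mem_flatten_of_mem (List.mem_map_of_mem hmem) (hc c hmem).1
    · refine ChildrenAfter.flatten fun s hs => ?_
      obtain ⟨c, hcm, rfl⟩ := List.mem_map.1 hs
      exact (hc c hcm).2.1
    · refine ParentsBefore.flatten fun s hs K' hK' => ?_
      obtain ⟨c, hcm, rfl⟩ := List.mem_map.1 hs
      exact (hc c hcm).2.2.1 K' fun q h =>
        Option.some_injective _ h ▸ hK' (Set.mem_insert i K)
    · intro a ha
      rcases List.mem_cons.1 ha with rfl | ha
      · exact hp
      · obtain ⟨s, hs, has⟩ := List.mem_flatten.1 ha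
        obtain ⟨c, hcm, rfl⟩ := List.mem_map.1 hs
        exact (hc c hcm).2.2.2.1 a has
    · rw [List.length_cons, List.length_flatten, List.map_map]
      exact (Nat.succ_le_succ hlen).trans hsum
    · have h₁ := steps_neighbours_le hΔ i
      have h₂ := length_neighbours_le Δ i
      have h₃ : (children Δ p i).length ≤ (neighbours Δ i).val.length := List.length_filter_le _ _
      have h₄ : ((children Δ p i).map fun c => (branch (primalGraph Δ) c i).card).sum + 1 ≤ n :=
        sum_card_branch_le hG i _ ((nodup_neighbours Δ i).filter _)
          fun c hc => (mem_children.1 hc).1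
      calc _ ≤ (((children Δ p i).map fun c => (branch (primalGraph Δ) c i).card).sum + 1) *
            (n * (7 * numLiterals Δ + 9) + 5) := by
            rw [add_mul]
            linarith
        _ ≤ _ := Nat.mul_le_mul_right _ hsum

end Preorder

/-! ### The two passes -/

section Passes

variable {n : ℕ} {Δ : CNF n ℝ}

theorem isMessage_store {M : Fin n → Fin n → PW ℝ} {i j : Fin n} {g : PW ℝ}
    (hg : IsMessage Δ g i j) {a b : Fin n}
    (h : (a, b) ≠ (i, j) → IsMessage Δ (M a b) a b) :
    IsMessage Δ ((store M i j g).val a b) a b := by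
  simp only [store, Timed.val_bind, Timed.val_pure]
  by_cases ha : a = i
  · subst ha
    rw [Function.update_self]
    by_cases hb : b = j
    · subst hb
      rwa [Function.update_self]
    · rw [Function.update_of_ne hb]
      exact h (by simp [hb])
  · rw [Function.update_of_ne ha]
    exact h (by simp [ha])

/-- Since children come first in this pass, the messages that enter a message to a parent are
correct when it is computed. -/
theorem upward_spec (hΔ : ∀ Γ ∈ Δ, Γ ≠ []) (hG : (primalGraph Δ).IsTree)
    (hm : 1 ≤ numLiterals Δ) {E : ℕ} (hE : ∀ i j, branchDepth (primalGraph Δ) i j + 2 ≤ E)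
    (hE' : 4 ≤ E) (V : List (Fin n × Option (Fin n))) (hV : ChildrenAfter Δ V)
    (hadj : ∀ a ∈ V, ∀ q, a.2 = some q → (primalGraph Δ).Adj a.1 q) (M : Fin n → Fin n → PW ℝ) :
    (∀ a ∈ V, ∀ q, a.2 = some q → IsMessage Δ ((upward Δ V M).val a.1 q) a.1 q) ∧
      (upward Δ V M).steps ≤ V.length * (400 * (n ^ 3 * numLiterals Δ ^ E) + 3) + 1 := by
  induction V with
  | nil => simp [upward, foldrT]
  | cons a s ih =>
    obtain ⟨h₁, h₂⟩ := ih hV.2 fun b hb => hadj b (List.mem_cons_of_mem _ hb)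
    obtain ⟨i, p⟩ := a
    cases p with
    | none =>
      have hval : (upward Δ ((i, none) :: s) M).val = (upward Δ s M).val := rfl
      have hsteps : (upward Δ ((i, none) :: s) M).steps = 1 + ((upward Δ s M).steps + (1 + 0)) :=
        rfl
      refine ⟨fun b hb q hq => ?_, ?_⟩
      · rcases List.mem_cons.1 hb with rfl | hb
        · simp at hq
        · exact hval ▸ h₁ b hb q hq
      · rw [hsteps, List.length_cons, add_mul]
        omega
    | some p =>
      have hip : (primalGraph Δ).Adj i p := hadj _ List.mem_cons_self p rfl
      obtain ⟨h₃, h₄⟩ := isMessage_sendMessage hΔ hG hm (M := (upward Δ s M).val) hip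
        fun c hc => h₁ (c, some i) (hV.1 c (mem_senders.1 hc).1
          fun h => (mem_senders.1 hc).2 (Option.some_injective _ h)) i rfl
      have hval : (upward Δ ((i, some p) :: s) M).val =
        (store (upward Δ s M).val i p (sendMessage Δ (upward Δ s M).val i p).val).val := rfl
      have hsteps : (upward Δ ((i, some p) :: s) M).steps = 1 + ((upward Δ s M).steps +
        (1 + ((sendMessage Δ (upward Δ s M).val i p).steps + 1))) := rfl
      refine ⟨fun b hb q hq => ?_, ?_⟩
      · rw [hval]
        refine isMessage_store h₃ fun hne => ?_
        rcases List.mem_cons.1 hb with rfl | hb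
        · exact absurd (by rw [Option.some_injective _ hq]) hne
        · exact h₁ b hb q hq
      · have := h₄ E (hE _ _) hE'
        rw [hsteps, List.length_cons, add_mul]
        omega

/-- The downward pass along a list `V` of nodes: `K` is the set of nodes that have received all
their messages before, and `W` is the list of all nodes, which have sent their messages upward. -/
theorem downward_spec (hΔ : ∀ Γ ∈ Δ, Γ ≠ []) (hG : (primalGraph Δ).IsTree)
    (hm : 1 ≤ numLiterals Δ) {E : ℕ} (hE : ∀ i j, branchDepth (primalGraph Δ) i j + 2 ≤ E)
    (hE' : 4 ≤ E) {W : List (Fin n × Option (Fin n))} (hW : ChildrenAfter Δ W)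
    (hadj : ∀ a ∈ W, ∀ q, a.2 = some q → (primalGraph Δ).Adj a.1 q)
    (V : List (Fin n × Option (Fin n))) (hVW : ∀ a ∈ V, a ∈ W) (K : Set (Fin n))
    (hV : ParentsBefore K V) (M : Fin n → Fin n → PW ℝ)
    (hup : ∀ a ∈ W, ∀ q, a.2 = some q → IsMessage Δ (M a.1 q) a.1 q)
    (hK : ∀ q ∈ K, ∀ c, (primalGraph Δ).Adj c q → IsMessage Δ (M c q) c q) :
    (∀ q, (q ∈ K ∨ ∃ p, (q, p) ∈ V) → ∀ c, (primalGraph Δ).Adj c q →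
        IsMessage Δ ((downward Δ V M).val c q) c q) ∧
      (downward Δ V M).steps ≤ V.length * (400 * (n ^ 3 * numLiterals Δ ^ E) + 3) + 1 := by
  induction V generalizing K M with
  | nil => simpa [downward, foldT] using hK
  | cons a s ih =>
    have haW : a ∈ W := hVW a List.mem_cons_self
    -- Once the message from its parent has been received, `a` has received all its messages.
    have hins (M' : Fin n → Fin n → PW ℝ)
        (hM : ∀ c q, IsMessage Δ (M c q) c q → IsMessage Δ (M' c q) c q)
        (hp : ∀ p, a.2 = some p → IsMessage Δ (M' p a.1) p a.1) :
        ∀ q ∈ insert a.1 K, ∀ c, (primalGraph Δ).Adj c q → IsMessage Δ (M' c q) c q := by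
      rintro q (rfl | hq) c hc
      · by_cases hne : some c = a.2
        · exact hp c hne.symm
        · exact hM _ _ (hup _ (hW.mem haW hc hne) _ rfl)
      · exact hM _ _ (hK q hq c hc)
    have hmem {q} (h : q ∈ K ∨ ∃ p, (q, p) ∈ a :: s) :
        q ∈ insert a.1 K ∨ ∃ p, (q, p) ∈ s := by
      rcases h with h | ⟨p, h⟩
      · exact Or.inl (Set.mem_insert_of_mem _ h)
      · rcases List.mem_cons.1 h with rfl | h
        · exact Or.inl (Set.mem_insert _ _)
        · exact Or.inr ⟨p, h⟩
    have ih' := ih (fun b hb => hVW b (List.mem_cons_of_mem _ hb)) (insert a.1 K) hV.2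
    obtain ⟨i, p⟩ := a
    cases p with
    | none =>
      obtain ⟨h₁, h₂⟩ := ih' M hup (hins M (fun _ _ h => h) (by simp))
      have hval : (downward Δ ((i, none) :: s) M).val = (downward Δ s M).val := rfl
      have hsteps : (downward Δ ((i, none) :: s) M).steps =
        1 + ((1 + 0) + (downward Δ s M).steps) := rfl
      refine ⟨fun q hq c hc => hval ▸ h₁ q (hmem hq) c hc, ?_⟩
      rw [hsteps, List.length_cons, add_mul]
      omega
    | some p =>
      have hip : (primalGraph Δ).Adj i p := hadj _ haW p rfl
      obtain ⟨h₃, h₄⟩ := isMessage_sendMessage hΔ hG hm (M := M) hip.symm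
        fun c hc => hK p (hV.1 p rfl) c (mem_senders.1 hc).1
      have hst {c q : Fin n} (h : IsMessage Δ (M c q) c q) :
          IsMessage Δ ((store M p i (sendMessage Δ M p i).val).val c q) c q :=
        isMessage_store h₃ fun _ => h
      obtain ⟨h₁, h₂⟩ := ih' (store M p i (sendMessage Δ M p i).val).val
        (fun a ha q hq => hst (hup a ha q hq))
        (hins _ (fun _ _ => hst) fun q hq => by
          obtain rfl := Option.some_injective _ hq
          exact isMessage_store h₃ fun h => absurd rfl h)
      have hval : (downward Δ ((i, some p) :: s) M).val =
        (downward Δ s (store M p i (sendMessage Δ M p i).val).val).val := rfl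
      have hsteps : (downward Δ ((i, some p) :: s) M).steps =
        1 + ((1 + ((sendMessage Δ M p i).steps + 1)) +
          (downward Δ s (store M p i (sendMessage Δ M p i).val).val).steps) := rfl
      refine ⟨fun q hq c hc => hval ▸ h₁ q (hmem hq) c hc, ?_⟩
      have := h₄ E (hE _ _) hE'
      rw [hsteps, List.length_cons, add_mul]
      omega

end Passes

/-! ### Beliefs, and the whole algorithm -/

section Whole

variable {n : ℕ} {Δ : CNF n ℝ}

/-- The integral over the whole line is the case of `toReal_lintegral_eq` without end points. -/
theorem val_integrateBelief {r : Fin n} {b : PW ℝ} {f : ℝ → ℝ≥0∞}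
    (hb : Represents (PW.mul (nodeIndicator Δ r).val b).val f) (hf : ∫⁻ u, f u ≠ ⊤) :
    (integrateBelief Δ r b).val = (∫⁻ u, f u).toReal := by
  have h := toReal_lintegral_eq hb ∅ (fun _ => true) measurable_const (fun _ _ _ _ _ => rfl)
    (by simpa using hf) (fun y => y) (fun y => y) (by simp) (by simp) 0 (by simp) 0 (by simp)
  simp only [if_true, Finset.sum_empty, add_zero] at h
  rw [h]
  rfl

theorem belief_eq (M : Fin n → Fin n → PW ℝ) (i : Fin n) :
    (belief Δ M i).val = (product M i (neighbours Δ i).val).val ∧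
      (belief Δ M i).steps = (neighbours Δ i).steps + (product M i (neighbours Δ i).val).steps :=
  ⟨rfl, rfl⟩

/-- There are at most `n` calls of `sendMessage` in each of the passes, and these dominate the cost.
-/
theorem mpmi_spec (hΔ : ∀ Γ ∈ Δ, Γ ≠ []) (hG : (primalGraph Δ).IsTree)
    (hm : 1 ≤ numLiterals Δ) {E : ℕ} (hE : ∀ i j, branchDepth (primalGraph Δ) i j + 2 ≤ E)
    (hE' : 4 ≤ E) (r : Fin n) :
    (mpmi Δ r).steps ≤ 1000 * (n ^ 4 * numLiterals Δ ^ E) ∧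
      (MI Δ ≠ ⊤ → (mpmi Δ r).val.value = (MI Δ).toReal) := by
  set V := (preorder Δ n none r).val with hVdef
  set M₁ := (upward Δ V fun _ _ => ⟨[], []⟩).val with hM₁
  set M₂ := (downward Δ V M₁).val with hM₂
  set A := numLiterals Δ ^ E with hA
  obtain ⟨v₁, v₂, v₃, v₄, v₅, v₆⟩ := preorder_spec hΔ hG n none r (by simp) le_rfl
  obtain ⟨u₁, u₂⟩ := upward_spec hΔ hG hm hE hE' V v₂ v₄ fun _ _ => ⟨[], []⟩
  obtain ⟨d₁, d₂⟩ := downward_spec hΔ hG hm hE hE' v₂ v₄ V (fun _ h => h) ∅ (v₃ ∅ (by simp)) M₁ u₁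
    (by simp)
  have hn : 1 ≤ n := r.pos
  have hdepth (i : Fin n) : ∀ c ∈ (neighbours Δ i).val,
      branchDepth (primalGraph Δ) c i ≤ E - 2 := fun c _ => Nat.le_sub_of_add_le (hE c i)
  have hadj {i c : Fin n} (hc : c ∈ (neighbours Δ i).val) : (primalGraph Δ).Adj c i :=
    ((mem_neighbours Δ i c).1 hc).symm
  have hgood {i : Fin n} {p : Option (Fin n)} (hi : (i, p) ∈ V) :=
    integrand_spec hΔ hG hm (nodup_neighbours Δ i) (fun c hc => hadj hc)
      (fun c hc => d₁ i (Or.inr ⟨p, hi⟩) c (hadj hc)) (hdepth i)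
  have hA₃ : numLiterals Δ ^ 3 ≤ A := Nat.pow_le_pow_right hm (by omega)
  have hA' : numLiterals Δ * numLiterals Δ ^ (E - 2) ≤ A := by
    rw [← pow_succ']
    exact Nat.pow_le_pow_right hm (by omega)
  have hmA : numLiterals Δ ≤ A :=
    (Nat.le_self_pow (show 3 ≠ 0 by decide) _).trans hA₃
  have hA₁ : 1 ≤ A := hm.trans hmA
  obtain ⟨r₁, r₂, r₃, r₄⟩ := hgood v₁
  refine ⟨?_, fun hfin => ?_⟩
  · have hN {a x : ℕ} (ha : a ≤ 3) (hx : x ≤ A) : n ^ a * x ≤ n ^ 3 * A := by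
      gcongr
    have h0 {x : ℕ} (hx : x ≤ A) := hN (Nat.zero_le 3) hx
    have h1 {x : ℕ} (hx : x ≤ A) := hN (show 1 ≤ 3 by omega) hx
    have hnb (i : Fin n) : (neighbours Δ i).steps ≤ 11 * (n ^ 3 * A) := by
      linarith [steps_neighbours_le hΔ i, h1 hmA, h1 hA₁, h0 hA₁]
    have hbelief {i : Fin n} {p : Option (Fin n)} (hi : (i, p) ∈ V) :
        (belief Δ M₂ i).steps ≤ 36 * (n ^ 3 * A) := by
      rw [(belief_eq M₂ i).2]
      linarith [hnb i, ((hgood hi).2.2.2 A hA₃ hA').1]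
    have hbs := steps_mapT_le (fun a : Fin n × Option (Fin n) => do
      let b ← belief Δ M₂ a.1
      return (a.1, b)) V (36 * (n ^ 3 * A)) fun a ha => hbelief (p := a.2) ha
    set f := integrand Δ M₂ r (neighbours Δ r).val with hf
    have hlen : f.bpts.length ≤ A :=
      r₃.trans ((Nat.mul_le_mul_right _ (numLiterals_star_le hG r _ (nodup_neighbours Δ r)
        fun c hc => hadj hc)).trans hA')
    have hcard := sum_card_branch_le hG r _ (nodup_neighbours Δ r) fun c hc => hadj hc
    have hanti : (PW.antideriv f).steps ≤ (A + 1) * (4 * n + 10) :=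
      (PW.antideriv_cost r₂).2.trans (by gcongr)
    have hint : (integrateBelief Δ r (belief Δ M₂ r).val).steps ≤ 90 * (n ^ 3 * A) := by
      have hsteps : (integrateBelief Δ r (belief Δ M₂ r).val).steps =
        (nodeIndicator Δ r).steps + ((PW.mul (nodeIndicator Δ r).val
          (product M₂ r (neighbours Δ r).val).val).steps + ((PW.antideriv f).steps +
          ((PW.atBot (PW.antideriv f).val).steps + ((PW.atTop (PW.antideriv f).val).steps +
          (1 + 0))))) := rfl
      obtain ⟨-, t₁, t₂⟩ := r₄ A hA₃ hA'
      rw [hsteps, PW.steps_atBot, PW.steps_atTop, PW.bpts_antideriv]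
      linarith [h1 hA₁, h1 le_rfl, h0 hA₁, h0 le_rfl]
    have hsteps : (mpmi Δ r).steps = (preorder Δ n none r).steps +
      ((upward Δ V fun _ _ => ⟨[], []⟩).steps + ((downward Δ V M₁).steps +
        ((mapT (fun a : Fin n × Option (Fin n) => do
          let b ← belief Δ M₂ a.1
          return (a.1, b)) V).steps + ((belief Δ M₂ r).steps +
          ((integrateBelief Δ r (belief Δ M₂ r).val).steps + 0))))) := rfl
    have hVn : V.length ≤ n := v₅
    have hpre : (preorder Δ n none r).steps ≤ n * (21 * (n ^ 3 * A)) := by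
      refine v₆.trans (Nat.mul_le_mul_left n ?_)
      linarith [h1 hmA, h1 hA₁, h0 hA₁]
    have hpass : V.length * (400 * (n ^ 3 * A) + 3) + 1 ≤ n * (404 * (n ^ 3 * A)) := calc
      _ ≤ n * (400 * (n ^ 3 * A) + 3) + 1 := by gcongr
      _ ≤ n * (400 * (n ^ 3 * A) + 4) := by linarith
      _ ≤ n * (404 * (n ^ 3 * A)) := Nat.mul_le_mul_left n (by linarith [h0 hA₁])
    have hbs' : V.length * (36 * (n ^ 3 * A) + 1) + 1 ≤ n * (38 * (n ^ 3 * A)) := calc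
      _ ≤ n * (36 * (n ^ 3 * A) + 1) + 1 := by gcongr
      _ ≤ n * (36 * (n ^ 3 * A) + 2) := by linarith
      _ ≤ n * (38 * (n ^ 3 * A)) := Nat.mul_le_mul_left n (by linarith [h0 hA₁])
    have hlast : 126 * (n ^ 3 * A) ≤ n * (126 * (n ^ 3 * A)) := Nat.le_mul_of_pos_left _ hn
    have hr := hbelief v₁
    calc (mpmi Δ r).steps ≤ n * (21 * (n ^ 3 * A)) + n * (404 * (n ^ 3 * A)) +
          n * (404 * (n ^ 3 * A)) + n * (38 * (n ^ 3 * A)) + n * (126 * (n ^ 3 * A)) := by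
          have q₁ := u₂.trans hpass
          have q₂ := d₂.trans hpass
          have q₃ := hbs.trans hbs'
          rw [hsteps]
          omega
      _ ≤ 1000 * (n ^ 4 * A) := by linarith [Nat.zero_le (n ^ 4 * A)]
  · have hMI := MI_eq hG r (neighbours Δ r).val (nodup_neighbours Δ r)
      fun c => by rw [mem_neighbours, SimpleGraph.adj_comm]
    rw [hMI] at hfin ⊢
    exact val_integrateBelief r₁ hfin

end Whole

end MPMI

theorem mainTheorem8 :
    ∃ C : ℕ, ∀ (n : ℕ) (Δ : MPMI.CNF n ℝ),
      2 ≤ n →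
      (∀ Γ ∈ Δ, Γ ≠ []) →
      (MPMI.primalGraph Δ).IsTree →
      ∀ (rp : Fin n) (T : SimpleGraph (Fin n)) (r : Fin n),
        MPMI.IsPseudoTree (MPMI.primalGraph Δ) T →
        (MPMI.mpmi Δ r).steps ≤
            C * (MPMI.numLeaves T r *
              (n ^ 3 * MPMI.numLiterals Δ ^ MPMI.height (MPMI.primalGraph Δ) rp) ^
                MPMI.height T r) ∧
          (MPMI.MI Δ ≠ ⊤ → (MPMI.mpmi Δ r).val.value = (MPMI.MI Δ).toReal) := by
  refine ⟨1000, fun n Δ hn hΔ hG rp T r hT => ?_⟩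
  have hp := MPMI.two_le_height hn hG rp
  have ht := MPMI.two_le_height hn hT.2.1 r
  have hl := MPMI.one_le_numLeaves T r
  -- A connected graph with two vertices has an edge, and this edge comes from a non-empty clause.
  have hm : 1 ≤ MPMI.numLiterals Δ := by
    have : Nontrivial (Fin n) := Fin.nontrivial_iff_two_le.2 hn
    obtain ⟨j, -, Γ, hΓ, ⟨ℓ, hℓ, -⟩, -⟩ := hG.connected.preconnected.exists_adj_of_nontrivial r
    exact (List.length_pos_of_mem hℓ).trans_le (MPMI.length_clause_le hΓ)
  set h := MPMI.height (MPMI.primalGraph Δ) rp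
  set k := MPMI.height T r
  -- The exponent `h * k` of `m` dominates the sum of the heights, since both are at least `2`.
  have hhk : h + k ≤ h * k := by nlinarith
  obtain ⟨hsteps, hval⟩ := MPMI.mpmi_spec hΔ hG hm (E := h * k)
    (fun i j => (MPMI.branchDepth_add_two_le hG hT.2.1 hT.1 rp r i j).trans hhk) (by omega) r
  refine ⟨hsteps.trans (Nat.mul_le_mul_left _ ?_), hval⟩
  calc n ^ 4 * MPMI.numLiterals Δ ^ (h * k)
      ≤ n ^ (3 * k) * MPMI.numLiterals Δ ^ (h * k) := by
        gcongr <;> omega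
    _ = (n ^ 3 * MPMI.numLiterals Δ ^ h) ^ k := by rw [mul_pow, pow_mul, pow_mul]
    _ ≤ _ := Nat.le_mul_of_pos_left _ hl
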